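/- **Conventions.** A fuzzy subset of a set $U$ is a map $U\to[0,1]$; its support is the set of elements of positive degree. Let $\Delta,\Gamma$ be finite nonempty alphabets, each with a fixed numbering of its symbols, and let $F\Theta_1$, $F\Theta_2$ be sets of fuzzy subsets of $\Delta^*$, resp. $\Gamma^*$, all with finite nonempty support (for instance, sets of fuzzy strings). For $s\in F\Theta_1$ let $\ell(s)=\max\{|x| : s(x)>0\}$. The auxiliary operators are the standard ones, $\mu_1=\min$, $\mu_2=\mu_3=\xi=\max$ (value $0$ on the empty family), together with $\mu_2'=\min$. **DFTMs.** A deterministic fuzzy Turing machine $M$ has a finite state set $Q$, an initial state $q_0\in Q$, a set $F\subseteq Q$ of halting states, a two-way infinite input/work tape over a finite alphabet $\Sigma_1$ that contains $\Delta$, distinct endmarkers ¢, \$ outside $\Delta$, and a blank, a read-only auxiliary tape, a write-only output tape, and a transition function $\delta$ that maps $(q,\sigma_1,\sigma_2)$, with $q\in Q\setminus F$ and $\sigma_1,\sigma_2$ the symbols scanned on the first two tapes, to a fuzzy subset of $Q\times\Sigma_1\times(\Gamma\cup\{\lambda\})\times\{0,\pm1\}^2$ (new state, symbol written on the work tape,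 symbol or $\lambda$ appended to the output, moves of the first two heads). On input $s$, $\mathrm{conf}_0$ has degree $s(x)$ at the initial configuration with ¢$x$\$ on the work tape and ¢$1^{\ell(s)}$\$ on the auxiliary tape (¢ in cell $0$, blanks elsewhere), both heads at cell $0$, state $q_0$ and empty output, and degree $0$ at all other configurations; $\mathrm{conf}_{i+1}(c')$ is the maximum of $\min(\mathrm{conf}_i(c),\text{degree of the move})$ over all non-halting configurations $c$ and all moves leading from $c$ to $c'$. The running time of $M$ on $s$ is the last time $t$ at which some configuration in a halting state has positive degree $\mathrm{conf}_t$ (so at least one such time exists, and there are only finitely many), and the output $M(s)$ gives to $w\in\Gamma^*$ the maximum of $\mathrm{conf}_i(c)$ over $i\le t$ and all configurations $c$ in a halting state with output $w$. $M$ computes $f:F\Theta_1\to F\Theta_2$ in polynomial time if for some polynomial $p$ and all $s\in F\Theta_1$ the running time of $M$ on $s$ exists and is at most $p(\ell(s))$, and $M(s)=f(s)$. **Circuits.** A fuzzy gate with $a\ge0$ inputs and $b\ge0$ outputs is a function $G$ from $\{0,1\}^a$ to the fuzzy subsets of $\{0,1\}^b$ (a gate with $a=0$ is a fuzzy constant).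 In a layered fuzzy circuit each level consists of at least one gate; each gate has distinct input variables among the variables of the preceding level and distinct output variables; gates may share input variables, and each variable of the new level is an output variable of exactly one gate. On a fuzzy set $s$ of assignments of the input variables, $\mathrm{conf}_0=s$ and $$\mathrm{conf}_{t+1}(w)=\max_{v\in\mathrm{supp}(\mathrm{conf}_t)}\ \min_k\ \min\bigl(\mathrm{conf}_t(v),\,G_k(v_k)(w_k)\bigr),$$ where $G_k$ runs over the gates of level $t+1$ and $v_k,w_k$ are the restrictions of $v,w$ to the input and output variables of $G_k$. The outcome $C(s)$ is the configuration at the last level; the size of $C$ is the number of gates plus the number of wires between gates and variables. A family $(C_n)_{n\in\mathbb N}$ is uniform if only finitely many distinct degrees occur in its gates and a deterministic (crisp) Turing machine, given $1^n$, writes in time polynomial in $n$ a description of $C_n$ that lists, level by level, the input labels, output labels and full truth table of every gate, over a finite alphabet containing names for these degrees. A string $x$ of length at most $n$ over an alphabet $A$ is coded by the bits $[x_i=\sigma]$, $i<n$, $\sigma\in A$; a fuzzy set of strings of length at most $n$ is coded by the fuzzy set having the same degrees at the codes and degree $0$ at all other bit vectors. The family, where $C_n$ has input variables for codes of strings of $\Delta^*$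 of length at most $n$ and output variables for codes of strings of $\Gamma^*$ of length at most some $m(n)$, computes $f$ if for each $s\in F\Theta_1$, with $n=\ell(s)$, the support of $f(s)$ consists of strings of length at most $m(n)$ and $C_n$ maps the code of $s$ to the code of $f(s)$. **Theorem.** Let $f$ be any fuzzy function from $F\Theta_1$ to $F\Theta_2$. (1) If there is a DFTM computing $f$ in polynomial time, then there exists a uniform family of fuzzy circuits of polynomial size that computes $f$. (2) If there is a uniform family of polynomial-size fuzzy circuits computing $f$, then there exists a DFTM that computes $f$ in polynomial time. -/

import Mathlib

open scoped unitInterval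

namespace Fuzzy

/-! ### Fuzzy sets and fuzzy strings -/

/-- A fuzzy subset of the universe `U`: a map from `U` to `[0,1]`. -/
abbrev FuzzySet (U : Type) : Type := U → I

/-- The support of a fuzzy set. -/
def supp {U : Type} (s : FuzzySet U) : Set U := {x | 0 < s x}

/-- Fuzzy string quantities (fuzzy subsets of `Σ*`) admitted as inputs and outputs: those with
finite nonempty support. Every fuzzy string (finite support, with a target of degree `1`),
for whatever distance measure on strings, is of this kind. -/
def IsAdmissible {A : Type} (s : FuzzySet (List A)) : Prop :=
  (supp s).Finite ∧ (supp s).Nonempty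

/-- The length `ℓ(s)`: the maximal length of a string in the (finite, nonempty) support. -/
noncomputable def len {A : Type} (s : FuzzySet (List A)) : ℕ :=
  sSup (List.length '' supp s)

/-! ### The standard auxiliary operators

`μ₁ = min` and `μ₂ = μ₃ = ξ = max` (with value `0` on the empty family), and `μ₂' = min`.
All families to which they are applied below take finitely many values, so that the suprema and
infima are maxima and minima. -/

noncomputable def mu1 (a b : I) : I := min a b
noncomputable def mu2 {ι : Type} (a : ι → I) : I := ⨆ r, a r
noncomputable def mu3 {ι : Type} (a : ι → I) : I := ⨆ r, a r
noncomputable def xi {ι : Type} (a : ι → I) : I := ⨆ r, a r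
noncomputable def mu2' {ι : Type} (a : ι → I) : I := ⨅ r, a r

/-! ### Deterministic fuzzy Turing machines -/

/-- The alphabet of the read-only auxiliary tape. -/
inductive AuxSym where
  | cent
  | dollar
  | one
  | blank

/-- A deterministic fuzzy Turing machine with input alphabet `Δ` and output alphabet `Γ`.
The head directions `0, ±1` are elements of `SignType`; writing `none : Option Γ` on the output
tape means writing nothing. -/
structure DFTM (Δ Γ : Type) where
  /-- inner states -/
  Q : Type
  finite_Q : Finite Q
  /-- the alphabet of the input/work tape -/
  S : Type
  finite_S : Finite S
  /-- the inclusion of the input alphabet in the alphabet of the input/work tape -/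
  inp : Δ → S
  inp_injective : Function.Injective inp
  cent : S
  dollar : S
  blank : S
  cent_ne_dollar : cent ≠ dollar
  cent_ne_blank : cent ≠ blank
  dollar_ne_blank : dollar ≠ blank
  inp_ne_cent : ∀ a, inp a ≠ cent
  inp_ne_dollar : ∀ a, inp a ≠ dollar
  /-- the initial state -/
  q₀ : Q
  /-- the set of halting states -/
  F : Set Q
  /-- the fuzzy transition function -/
  δ : {q : Q // q ∉ F} → S → AuxSym → FuzzySet (Q × S × Option Γ × SignType × SignType)

namespace DFTM

variable {Δ Γ : Type} (M : DFTM Δ Γ)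

/-- A configuration: inner state, content and head position of the input/work tape, head position
on the auxiliary tape, content of the output tape. Cells are indexed by integers. -/
structure Config where
  state : M.Q
  tape : ℤ → M.S
  head : ℤ
  auxHead : ℤ
  out : List Γ

/-- The input/work tape with `¢ x $` written on it, `¢` being in cell `0`. -/
def initTape (x : List Δ) (i : ℤ) : M.S :=
  if i = 0 then M.cent
  else if i = x.length + 1 then M.dollar
  else if 0 < i then ((x[(i - 1).toNat]?).map M.inp).getD M.blank
  else M.blank

/-- The auxiliary tape with `¢ 1ⁿ $` written on it, `¢` being in cell `0`. -/
def auxTape (n : ℕ) (i : ℤ) : AuxSym :=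
  if i = 0 then AuxSym.cent
  else if 0 < i ∧ i ≤ n then AuxSym.one
  else if i = n + 1 then AuxSym.dollar
  else AuxSym.blank

/-- The initial configuration with crisp string `x`. -/
def initConfig (x : List Δ) : M.Config where
  state := M.q₀
  tape := M.initTape x
  head := 0
  auxHead := 0
  out := []

/-- The configuration reached from `c` by a move `(p, τ, η, d₁, d₂)`. -/
def next (c : M.Config) (e : M.Q × M.S × Option Γ × SignType × SignType) : M.Config where
  state := e.1
  tape := Function.update c.tape c.head e.2.1
  head := c.head + (e.2.2.2.1 : ℤ)
  auxHead := c.auxHead + (e.2.2.2.2 : ℤ)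
  out := c.out ++ e.2.2.1.toList

/-- The fuzzy configuration of `M` on fuzzy input `s` at each time. A configuration at time `i + 1`
takes part in the family under `μ₂` with each non-halting configuration `c` and each move that
leads from `c` to it. -/
noncomputable def conf (s : FuzzySet (List Δ)) : ℕ → FuzzySet M.Config
  | 0 => fun c => ⨆ x : {x : List Δ // c = M.initConfig x}, s x
  | i + 1 => fun c' =>
      mu2 fun m : {m : {c : M.Config // c.state ∉ M.F} ×
            (M.Q × M.S × Option Γ × SignType × SignType) // M.next m.1.1 m.2 = c'} =>
        mu1 (conf s i m.1.1.1)
          (M.δ ⟨m.1.1.1.state, m.1.1.2⟩ (m.1.1.1.tape m.1.1.1.head)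
            (auxTape (len s) m.1.1.1.auxHead) m.1.2)

/-- The possibility degree of a final configuration at time `t`. -/
noncomputable def final (s : FuzzySet (List Δ)) (t : ℕ) (c : M.Config) : I :=
  open Classical in
  if c.state ∈ M.F then mu3 fun i : Fin (t + 1) => M.conf s i c else 0

/-- The fuzzy output `M(s)`, when read off at time `t`. -/
noncomputable def output (s : FuzzySet (List Δ)) (t : ℕ) : FuzzySet (List Γ) := fun w =>
  xi fun c : {c : M.Config // c.state ∈ M.F ∧ c.out = w} => M.final s t c

/-- `t` is the running time of `M` on `s`: the last time at which
a final configuration is reached with positive degree. -/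
def IsRunningTime (s : FuzzySet (List Δ)) (t : ℕ) : Prop :=
  (∃ c : M.Config, c.state ∈ M.F ∧ 0 < M.conf s t c) ∧
    ∀ i, t < i → ∀ c : M.Config, c.state ∈ M.F → M.conf s i c = 0

/-- `M` computes the fuzzy function `f` in time polynomial in `ℓ(s)`. -/
def ComputesInPolyTime {FΘ₁ : Set (FuzzySet (List Δ))} {FΘ₂ : Set (FuzzySet (List Γ))}
    (f : FΘ₁ → FΘ₂) : Prop :=
  ∃ p : Polynomial ℕ, ∀ s : FΘ₁, ∃ t : ℕ,
    M.IsRunningTime s.1 t ∧ t ≤ p.eval (len s.1) ∧ M.output s.1 t = (f s).1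

end DFTM

/-! ### Layered fuzzy circuits

The degrees are taken in a type `K`: `K = [0,1]` for fuzzy circuits, and a finite set of names of
degrees for their descriptions. The variables of a level are labelled `0, …, d - 1`. -/

/-- A gate between a level with `c` variables and a level with `d` variables: distinct input
variables, distinct output variables, and a function from `{0,1}^a` to the `K`-valued functions on
`{0,1}^b`. A gate with `a = 0` is a fuzzy constant. -/
structure Gate (K : Type) (c d : ℕ) where
  a : ℕ
  b : ℕ
  inVar : Fin a ↪ Fin c
  outVar : Fin b ↪ Fin d
  fn : (Fin a → Bool) → (Fin b → Bool) → K

/-- The gates aligned at one level. Each variable of the next level is an output variable of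
exactly one gate; input variables may be shared. -/
structure Level (K : Type) (c d : ℕ) where
  numGates : ℕ
  numGates_pos : 0 < numGates
  gate : Fin numGates → Gate K c d
  existsUnique_out : ∀ j : Fin d, ∃! o : (Σ k, Fin (gate k).b), (gate o.1).outVar o.2 = j

/-- A layered circuit with `n` input variables and `d` output variables. -/
inductive Circuit (K : Type) (n : ℕ) : ℕ → Type
  | input : Circuit K n n
  | layer {c d : ℕ} (C : Circuit K n c) (L : Level K c d) : Circuit K n d

/-- A layered fuzzy circuit. -/
abbrev FuzzyCircuit (n d : ℕ) : Type := Circuit I n d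

/-- Replace the degrees of a gate. -/
def Gate.map {K K' : Type} {c d : ℕ} (D : K → K') (G : Gate K c d) : Gate K' c d where
  a := G.a
  b := G.b
  inVar := G.inVar
  outVar := G.outVar
  fn := fun x y => D (G.fn x y)

/-- Replace the degrees of the gates of a level. -/
def Level.map {K K' : Type} {c d : ℕ} (D : K → K') (L : Level K c d) : Level K' c d where
  numGates := L.numGates
  numGates_pos := L.numGates_pos
  gate := fun k => (L.gate k).map D
  existsUnique_out := L.existsUnique_out

/-- Replace the degrees of the gates of a circuit. -/
def Circuit.map {K K' : Type} {n : ℕ} (D : K → K') : {d : ℕ} → Circuit K n d → Circuit K' n d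
  | _, .input => .input
  | _, .layer C L => .layer (C.map D) (L.map D)

/-- The size of a circuit: the number of gates plus the number of wires between variables and
gates. -/
def Circuit.size {K : Type} {n : ℕ} : {d : ℕ} → Circuit K n d → ℕ
  | _, .input => 0
  | _, .layer C L => C.size + ∑ k, (1 + (L.gate k).a + (L.gate k).b)

/-- The outcome `C(s)`: the global configuration at the last level of `C`. -/
noncomputable def Circuit.eval {n : ℕ} :
    {d : ℕ} → FuzzyCircuit n d → FuzzySet (Fin n → Bool) → FuzzySet (Fin d → Bool)
  | _, .input, s => s
  | _, .layer C L, s => fun w =>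
      mu3 fun v : supp (C.eval s) =>
        mu2' fun k : Fin L.numGates =>
          mu1 (C.eval s v.1)
            ((L.gate k).fn (fun i => v.1 ((L.gate k).inVar i)) (fun j => w ((L.gate k).outVar j)))

/-! ### Descriptions of circuits and uniformity -/

/-- The finite alphabet of descriptions, with `r` names of degrees. -/
inductive DescSym (r : ℕ) where
  | one
  | comma
  | semicolon
  | endGate
  | endLevel
  | deg (i : Fin r)

/-- A number in unary, followed by a comma. -/
def unary {r : ℕ} (j : ℕ) : List (DescSym r) := List.replicate j DescSym.one ++ [DescSym.comma]

/-- The bit vector of length `a` that is the binary expansion of `N`, least significant first. -/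
def bits (a N : ℕ) : Fin a → Bool := fun i => N.testBit i

/-- The description of a gate: its input labels, its output labels, and its truth table. -/
def Gate.describe {r c d : ℕ} (G : Gate (Fin r) c d) : List (DescSym r) :=
  (List.ofFn fun i => unary (G.inVar i : ℕ)).flatten ++ [DescSym.semicolon] ++
    (List.ofFn fun j => unary (G.outVar j : ℕ)).flatten ++ [DescSym.semicolon] ++
    (List.range (2 ^ G.a)).flatMap (fun x =>
      (List.range (2 ^ G.b)).map fun y => DescSym.deg (G.fn (bits G.a x) (bits G.b y))) ++
    [DescSym.endGate]

/-- The description of a circuit: the descriptions of the gates, level by level. -/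
def Circuit.describe {r n : ℕ} : {d : ℕ} → Circuit (Fin r) n d → List (DescSym r)
  | _, .input => []
  | _, .layer C L =>
      C.describe ++ (List.ofFn fun k => (L.gate k).describe).flatten ++ [DescSym.endLevel]

/-- A family of fuzzy circuits is uniform: finitely many degrees `D i` occur in it, and a crisp
deterministic Turing machine, given `1ⁿ`, writes a description of the `n`-th circuit in time
polynomial in `n`. -/
def IsUniform {a b : ℕ → ℕ} (C : ∀ n, FuzzyCircuit (a n) (b n)) : Prop :=
  ∃ (r : ℕ) (D : Fin r → I) (C' : ∀ n, Circuit (Fin r) (a n) (b n)),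
    (∀ n, C n = (C' n).map D) ∧
    Nonempty (Turing.TM2ComputableInPolyTime Computability.unaryEncodeNat
      (id : List (DescSym r) → List (DescSym r)) fun n => (C' n).describe)

/-- A family of fuzzy circuits has polynomial size. -/
def HasPolySize {a b : ℕ → ℕ} (C : ∀ n, FuzzyCircuit (a n) (b n)) : Prop :=
  ∃ p : Polynomial ℕ, ∀ n, (C n).size ≤ p.eval n

/-! ### Circuits on fuzzy strings over arbitrary alphabets -/

/-- The code of a string `x` of length at most `n` over an alphabet with `k` symbols:
the variable with label `i * k + σ` tells whether the `i`-th symbol of `x` is `σ`. -/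
def encode {A : Type} {k : ℕ} (e : A ≃ Fin k) (n : ℕ) (x : List A) : Fin (n * k) → Bool := fun v =>
  (x[(finProdFinEquiv.symm v).1.1]?).map e == some (finProdFinEquiv.symm v).2

/-- The fuzzy set of bit vectors that has the degree `s x` at the code of each string `x` of length
at most `n`, and the degree `0` at all other bit vectors. -/
noncomputable def encodeFuzzy {A : Type} {k : ℕ} (e : A ≃ Fin k) (n : ℕ) (s : FuzzySet (List A)) :
    FuzzySet (Fin (n * k) → Bool) := fun v =>
  ⨆ x : {x : List A // x.length ≤ n ∧ encode e n x = v}, s x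

/-- The family `C` computes `f`: on each `s`, the circuit of index `ℓ(s)` turns
(the code of) `s` into (the code of) `f(s)`. -/
def FamilyComputes {Δ Γ : Type} {k l : ℕ} (eΔ : Δ ≃ Fin k) (eΓ : Γ ≃ Fin l) {m : ℕ → ℕ}
    (C : ∀ n, FuzzyCircuit (n * k) (m n * l))
    {FΘ₁ : Set (FuzzySet (List Δ))} {FΘ₂ : Set (FuzzySet (List Γ))} (f : FΘ₁ → FΘ₂) : Prop :=
  ∀ s : FΘ₁,
    (∀ w ∈ supp (f s).1, w.length ≤ m (len s.1)) ∧
      (C (len s.1)).eval (encodeFuzzy eΔ (len s.1) s.1) = encodeFuzzy eΓ (m (len s.1)) (f s).1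

end Fuzzy

/-!
Both directions are simulations, and both hinge on the same device: the degree computed by a fuzzy
machine or circuit is a supremum of minima, so that it is enough to know, for each bound `u`, when
the degree is `≤ u`. Since `[0, 1]` is a Heyting algebra, such a statement can be pushed back through
one step or one level at a time (`le_himp_iff`), and the suprema never have to be manipulated.

*From circuits to machines.* A fuzzy Turing machine first writes the description of `C n` and then
evaluates it. The nondeterminism consists of guesses of single bits: a new variable receives an
arbitrary value when a gate first mentions it, and each gate imposes the degree that its truth table
gives to the values of its variables. Along one sequence of guesses the machine therefore accumulates
the minimum that the sequence contributes to the outcome of the circuit (`Circuit.eval_le_iff`,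
`runs_evaluator`). The machine is not programmed with tapes: it is a stack machine (`Mach`), which
takes its bits from a stream and has a calculus of timed runs (`Mach.Runs`). Stack machines are
simulated by fuzzy Turing machines, with one track of the work tape for each stack (`toDFTM`,
`sim_runs`), and `DFTM.Choice.conf_le_iff` and `DFTM.Choice.output_eq` turn the statement about all
streams into one about degrees. A crisp machine that describes the family becomes a part of the stack
machine (`ofTM2_runs`); of its stack alphabets, which may be infinite, only the finitely many symbols
that can be pushed are kept (`Pushable`). This gives `exists_DFTM_of_circuits`.

*From machines to circuits.* The circuit is a cellular automaton: a level consists of blocks of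
variables, one block for each cell of the three tapes within a window of polynomial size, and one
more block for a guess. The only gate that is not crisp is the one that guesses: it is a fuzzy constant
that proposes the state, the scanned symbols and a move, each with the degree that the transition
function gives to it. The other gates compute the new content of a cell from the guess and three
neighbouring cells, and have no value if a head in the cell contradicts the guess, so that wrong
guesses get degree `0` (`DFTM.agrees_of_cell_next`). As the output of the machine collects the halting
configurations of all times, a guess may also be to idle, with degree `1`; configurations that are
reached early thus survive until the last level (`DFTM.simCircuit_eval_le_iff`), which selects the
halting ones and extracts their outputs (`DFTM.outCircuit_eval_le_iff`). The position of `$` depends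
on the length of the input, which no gate of bounded size can see; cells that cannot yet know their
symbol leave it undetermined, and the next level recovers it from the neighbour on the left.

*Uniformity.* The description of the simulating circuit is a text with a few nested loops, the gates
in a loop having truth tables of constant size. Such texts are written by stack machines in polynomial
time (`Emits`, `computable_of_emits`), and stack machines without guesses are crisp Turing machines
(`Mach.toTM2`). A uniform family has polynomial size, because its descriptions have polynomial length
and are at least as long as the circuits are large (`IsUniform.hasPolySize`).
-/

namespace Fuzzy

/-! ### Runs of partial step functions -/

/-- `Steps f t a b`: exactly `t` steps of the partial function `f` lead from `a` to `b`. -/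
def Steps {α : Type} (f : α → Option α) : ℕ → α → α → Prop
  | 0, a, b => a = b
  | t + 1, a, b => ∃ c, f a = some c ∧ Steps f t c b

theorem Steps.trans {α : Type} {f : α → Option α} : ∀ {t u : ℕ} {a b c : α},
    Steps f t a b → Steps f u b c → Steps f (t + u) a c
  | 0, u, a, b, c, h, h' => by
      cases h; rwa [Nat.zero_add]
  | t + 1, u, a, b, c, ⟨d, hd, h⟩, h' => by
      rw [Nat.add_right_comm]
      exact ⟨d, hd, h.trans h'⟩

theorem Steps.one {α : Type} {f : α → Option α} {a b : α} (h : f a = some b) : Steps f 1 a b :=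
  ⟨b, h, rfl⟩

theorem Steps.succ_iff {α : Type} {f : α → Option α} : ∀ {t : ℕ} {a c : α},
    Steps f (t + 1) a c ↔ ∃ b, Steps f t a b ∧ f b = some c
  | 0, a, c => by simp [Steps]
  | t + 1, a, c => by
      constructor
      · rintro ⟨d, hd, h⟩
        obtain ⟨b, hb, hb'⟩ := Steps.succ_iff.1 h
        exact ⟨b, ⟨d, hd, hb⟩, hb'⟩
      · rintro ⟨b, ⟨d, hd, h⟩, hb⟩
        exact ⟨d, hd, Steps.succ_iff.2 ⟨b, h, hb⟩⟩

/-- A run that ends in a configuration without successor is unique. -/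
theorem Steps.eq_of_stuck {α : Type} {f : α → Option α} : ∀ {t u : ℕ} {a b c : α},
    Steps f t a b → Steps f u a c → f b = none → f c = none → t = u ∧ b = c
  | 0, 0, a, b, c, h, h', _, _ => ⟨rfl, h.symm.trans h'⟩
  | 0, u + 1, a, b, c, h, ⟨d, hd, _⟩, hb, _ => by
      cases h; simp [hb] at hd
  | t + 1, 0, a, b, c, ⟨d, hd, _⟩, h, _, hc => by
      cases h; simp [hc] at hd
  | t + 1, u + 1, a, b, c, ⟨d, hd, h⟩, ⟨d', hd', h'⟩, hb, hc => by
      obtain rfl : d = d' := by simpa [hd] using hd'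
      obtain ⟨rfl, rfl⟩ := Steps.eq_of_stuck h h' hb hc
      exact ⟨rfl, rfl⟩

theorem Steps.map {α β : Type} {f : α → Option α} {g : β → Option β} (φ : α → β)
    (h : ∀ a b, f a = some b → g (φ a) = some (φ b)) :
    ∀ {t : ℕ} {a b : α}, Steps f t a b → Steps g t (φ a) (φ b)
  | 0, _, _, hab => congrArg φ hab
  | _ + 1, _, _, ⟨c, hc, hs⟩ => ⟨φ c, h _ _ hc, Steps.map φ h hs⟩

/-! ### Stack machines -/

/-- An instruction of a stack machine with stacks `k : K` over the alphabets `Γ k`, output alphabet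
`G`, and jump targets `Q`: push a symbol; read (and possibly erase) the top symbol of a stack;
impose a degree and append a string to the output; branch on an arbitrary bit. -/
inductive Op (K : Type) (Γ : K → Type) (G Q : Type) where
  | push (k : K) (a : Γ k) (q : Q)
  | read (k : K) (erase : Bool) (f : Option (Γ k) → Q)
  | eff (w : I) (o : Option G) (q : Q)
  | guess (f : Bool → Q)

/-- Replacing the jump targets of an instruction. -/
def Op.map {K : Type} {Γ : K → Type} {G Q Q' : Type} (g : Q → Q') : Op K Γ G Q → Op K Γ G Q'
  | .push k a q => .push k a (g q)
  | .read k e f => .read k e (fun a => g (f a))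
  | .eff w o q => .eff w o (g q)
  | .guess f => .guess (fun b => g (f b))

/-- A stack machine: a finite set of states, each with its instruction. The jump target `none`
is the exit. -/
structure Mach (K : Type) (Γ : K → Type) (G : Type) where
  Q : Type
  finite_Q : Finite Q
  start : Option Q
  op : Q → Op K Γ G (Option Q)

attribute [instance] Mach.finite_Q

/-- The data of a stack machine: the stacks, the stream of bits that resolves the future arbitrary
branchings, the output, and the minimum of the degrees imposed so far. Relative to the stream, a
stack machine is deterministic. -/
@[ext] structure MState (K : Type) (Γ : K → Type) (G : Type) where
  stk : ∀ k, List (Γ k)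
  ρ : Stream' Bool
  out : List G
  wt : I

section Machines

variable {K : Type} [DecidableEq K] {Γ : K → Type} {G : Type}

/-- The effect of an instruction. -/
noncomputable def Op.exec {Q : Type} (s : MState K Γ G) : Op K Γ G Q → Q × MState K Γ G
  | .push k a q => (q, { s with stk := Function.update s.stk k (a :: s.stk k) })
  | .read k e f =>
      (f (s.stk k).head?,
        if e then { s with stk := Function.update s.stk k (s.stk k).tail } else s)
  | .eff w o q => (q, { s with out := s.out ++ o.toList, wt := min s.wt w })
  | .guess f => (f s.ρ.head, { s with ρ := s.ρ.tail })

theorem Op.exec_map {Q Q' : Type} (g : Q → Q') (s : MState K Γ G) (o : Op K Γ G Q) :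
    (o.map g).exec s = (g (o.exec s).1, (o.exec s).2) := by
  cases o <;> rfl

namespace Mach

/-- One step of a stack machine. -/
noncomputable def step (M : Mach K Γ G) :
    Option M.Q × MState K Γ G → Option (Option M.Q × MState K Γ G)
  | (none, _) => none
  | (some q, s) => some ((M.op q).exec s)

/-- Started on the data `s`, the machine exits with the data `s'` after at most `T` steps. -/
def Runs (M : Mach K Γ G) (s s' : MState K Γ G) (T : ℕ) : Prop :=
  ∃ t ≤ T, Steps M.step t (M.start, s) (none, s')

theorem Runs.mono {M : Mach K Γ G} {s s' : MState K Γ G} {T T' : ℕ} (h : M.Runs s s' T)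
    (hT : T ≤ T') : M.Runs s s' T' := by
  obtain ⟨t, ht, hs⟩ := h
  exact ⟨t, ht.trans hT, hs⟩

/-- The runs of a machine that is a part of another one are runs of the latter. -/
theorem steps_embed {N M : Mach K Γ G} (g : Option N.Q → Option M.Q)
    (h : ∀ q, ∃ q', g (some q) = some q' ∧ M.op q' = (N.op q).map g) {t : ℕ}
    {a b : Option N.Q × MState K Γ G} (hs : Steps N.step t a b) :
    Steps M.step t (g a.1, a.2) (g b.1, b.2) := by
  refine Steps.map (fun a => (g a.1, a.2)) ?_ hs
  rintro ⟨_ | q, s⟩ b hb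
  · simp [step] at hb
  · obtain ⟨q', hq', ho⟩ := h q
    simp only [step, Option.some.injEq] at hb
    subst hb
    simp only [hq', step, ho, Op.exec_map]

/-- The machine consisting of one instruction. -/
def prim (o : Op K Γ G Unit) : Mach K Γ G where
  Q := Unit
  finite_Q := inferInstance
  start := some ()
  op := fun _ => o.map fun _ => none

/-- The machine that does nothing. -/
def skip : Mach K Γ G where
  Q := Empty
  finite_Q := inferInstance
  start := none
  op := Empty.elim

/-- Sequential composition. -/
def seq (M N : Mach K Γ G) : Mach K Γ G where
  Q := M.Q ⊕ N.Q
  finite_Q := inferInstance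
  start := M.start.elim (N.start.map Sum.inr) (fun q => some (Sum.inl q))
  op := fun q => match q with
    | .inl q => (M.op q).map fun x => x.elim (N.start.map Sum.inr) (fun q => some (Sum.inl q))
    | .inr q => (N.op q).map (Option.map Sum.inr)

/-- Read the top of a stack and branch. -/
def case (k : K) [Finite (Γ k)] (e : Bool) (B : Option (Γ k) → Mach K Γ G) : Mach K Γ G where
  Q := Unit ⊕ (Σ a, (B a).Q)
  finite_Q := inferInstance
  start := some (Sum.inl ())
  op := fun q => match q with
    | .inl () => .read k e fun a => (B a).start.map fun q => Sum.inr ⟨a, q⟩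
    | .inr ⟨a, q⟩ => ((B a).op q).map (Option.map fun q => Sum.inr ⟨a, q⟩)

/-- Branch on an arbitrary bit. -/
def guess (B : Bool → Mach K Γ G) : Mach K Γ G where
  Q := Unit ⊕ (Σ a, (B a).Q)
  finite_Q := inferInstance
  start := some (Sum.inl ())
  op := fun q => match q with
    | .inl () => .guess fun a => (B a).start.map fun q => Sum.inr ⟨a, q⟩
    | .inr ⟨a, q⟩ => ((B a).op q).map (Option.map fun q => Sum.inr ⟨a, q⟩)

/-- As long as the top symbol `a` of stack `k` satisfies `c`, perform `B a`. -/
def loop (k : K) [Finite (Γ k)] (c : Γ k → Bool) (B : Γ k → Mach K Γ G) : Mach K Γ G where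
  Q := Unit ⊕ (Σ a, (B a).Q)
  finite_Q := inferInstance
  start := some (Sum.inl ())
  op := fun q => match q with
    | .inl () => .read k false fun a => a.elim none fun a =>
        if c a then some ((B a).start.elim (Sum.inl ()) fun q => Sum.inr ⟨a, q⟩) else none
    | .inr ⟨a, q⟩ => ((B a).op q).map fun x =>
        some (x.elim (Sum.inl ()) fun q => Sum.inr ⟨a, q⟩)

theorem runs_prim (o : Op K Γ G Unit) (s : MState K Γ G) : (prim o).Runs s (o.exec s).2 1 := by
  refine ⟨1, le_rfl, Steps.one ?_⟩
  simp only [prim, step, Op.exec_map]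

theorem runs_skip (s : MState K Γ G) : skip.Runs s s 0 := ⟨0, le_rfl, rfl⟩

theorem Runs.seq {M N : Mach K Γ G} {s s' s'' : MState K Γ G} {T T' : ℕ} (h : M.Runs s s' T)
    (h' : N.Runs s' s'' T') : (M.seq N).Runs s s'' (T + T') := by
  obtain ⟨t, ht, hs⟩ := h
  obtain ⟨t', ht', hs'⟩ := h'
  refine ⟨t + t', by omega, Steps.trans (b := (N.start.map Sum.inr, s')) ?_ ?_⟩
  · exact steps_embed (M := M.seq N)
      (fun x => x.elim (N.start.map Sum.inr) (fun q => some (Sum.inl q)))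
      (fun q => ⟨Sum.inl q, rfl, rfl⟩) hs
  · exact steps_embed (M := M.seq N) (Option.map Sum.inr) (fun q => ⟨Sum.inr q, rfl, rfl⟩) hs'

theorem Runs.case {k : K} [Finite (Γ k)] {e : Bool} {B : Option (Γ k) → Mach K Γ G}
    {s s' : MState K Γ G} {T : ℕ}
    (h : (B (s.stk k).head?).Runs
      (if e then { s with stk := Function.update s.stk k (s.stk k).tail } else s) s' T) :
    (case k e B).Runs s s' (T + 1) := by
  obtain ⟨t, ht, hs⟩ := h
  refine ⟨t + 1, by omega, _, rfl, ?_⟩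
  exact steps_embed (M := Mach.case k e B)
    (Option.map fun q => Sum.inr ⟨(s.stk k).head?, q⟩) (fun q => ⟨_, rfl, rfl⟩) hs

theorem Runs.guess {B : Bool → Mach K Γ G} {s s' : MState K Γ G} {T : ℕ}
    (h : (B s.ρ.head).Runs { s with ρ := s.ρ.tail } s' T) : (guess B).Runs s s' (T + 1) := by
  obtain ⟨t, ht, hs⟩ := h
  refine ⟨t + 1, by omega, _, rfl, ?_⟩
  exact steps_embed (M := Mach.guess B)
    (Option.map fun q => Sum.inr ⟨s.ρ.head, q⟩) (fun q => ⟨_, rfl, rfl⟩) hs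

theorem runs_loop_exit {k : K} [Finite (Γ k)] {c : Γ k → Bool} {B : Γ k → Mach K Γ G}
    {s : MState K Γ G} (h : ∀ a, (s.stk k).head? = some a → c a = false) :
    (loop k c B).Runs s s 1 := by
  refine ⟨1, le_rfl, Steps.one ?_⟩
  simp only [loop, step, Op.exec]
  cases hh : (s.stk k).head? with
  | none => simp
  | some a => simp [h a hh]

theorem Runs.loop {k : K} [Finite (Γ k)] {c : Γ k → Bool} {B : Γ k → Mach K Γ G}
    {s s' s'' : MState K Γ G} {a : Γ k} {T T' : ℕ} (ha : (s.stk k).head? = some a)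
    (hc : c a = true) (h : (B a).Runs s s' T) (h' : (loop k c B).Runs s' s'' T') :
    (loop k c B).Runs s s'' (T + T' + 1) := by
  obtain ⟨t, ht, hs⟩ := h
  obtain ⟨t', ht', hs'⟩ := h'
  refine ⟨t + t' + 1, by omega, _, rfl, Steps.trans ?_ hs'⟩
  have := steps_embed (M := Mach.loop k c B)
    (fun x => some (x.elim (Sum.inl ()) fun q => Sum.inr ⟨a, q⟩)) (fun q => ⟨_, rfl, rfl⟩) hs
  simpa [Mach.loop, Op.exec, ha, hc] using this

end Mach

end Machines


/-! ### Fuzzy machines whose moves depend on one arbitrary bit -/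

namespace DFTM

variable {Δ Γ : Type}

/-- A presentation of the transition function of a fuzzy machine: in each situation there are at
most two possible moves, chosen by a bit, and both have the same degree; `use` tells whether
the bit matters. -/
structure Choice (M : DFTM Δ Γ) where
  move : {q : M.Q // q ∉ M.F} → M.S → AuxSym → Bool →
    M.Q × M.S × Option Γ × SignType × SignType
  deg : {q : M.Q // q ∉ M.F} → M.S → AuxSym → I
  use : {q : M.Q // q ∉ M.F} → M.S → AuxSym → Bool
  δ_eq : ∀ q σ₁ τ m, M.δ q σ₁ τ m = ⨆ _ : {b : Bool // move q σ₁ τ b = m}, deg q σ₁ τ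
  move_eq : ∀ q σ₁ τ b b', use q σ₁ τ = false → move q σ₁ τ b = move q σ₁ τ b'

variable {M : DFTM Δ Γ} (R : M.Choice)

open Classical in
/-- One step of a fuzzy machine, with the arbitrary bits taken from a stream, and the degrees of
the moves accumulated. -/
noncomputable def Choice.step (n : ℕ) (X : M.Config × Stream' Bool × I) :
    Option (M.Config × Stream' Bool × I) :=
  if h : X.1.state ∉ M.F then
    let σ₁ := X.1.tape X.1.head
    let τ := auxTape n X.1.auxHead
    some (M.next X.1 (R.move ⟨X.1.state, h⟩ σ₁ τ X.2.1.head),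
      bif R.use ⟨X.1.state, h⟩ σ₁ τ then X.2.1.tail else X.2.1,
      min X.2.2 (R.deg ⟨X.1.state, h⟩ σ₁ τ))
  else none

/-- The rest of the stream does not influence a run. -/
theorem Choice.steps_stream {n t : ℕ} {c₀ c : M.Config} {ρ ρ' : Stream' Bool} {w₀ w : I}
    (h : Steps (R.step n) t (c₀, ρ, w₀) (c, ρ', w)) (ρ₁ : Stream' Bool) :
    ∃ ρ₀, Steps (R.step n) t (c₀, ρ₀, w₀) (c, ρ₁, w) := by
  induction t generalizing c ρ' w ρ₁ with
  | zero =>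
    simp only [Steps, Prod.mk.injEq] at h ⊢
    obtain ⟨rfl, -, rfl⟩ := h
    exact ⟨ρ₁, rfl, rfl, rfl⟩
  | succ t ih =>
    obtain ⟨⟨c₁, ρ₂, w₁⟩, h₁, h₂⟩ := Steps.succ_iff.1 h
    unfold Choice.step at h₂
    split at h₂
    case isFalse => simp at h₂
    rename_i hF
    simp only [Option.some.injEq, Prod.mk.injEq] at h₂
    obtain ⟨hc, -, hw⟩ := h₂
    cases hu : R.use ⟨c₁.state, hF⟩ (c₁.tape c₁.head) (auxTape n c₁.auxHead) with
    | false =>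
      obtain ⟨ρ₀, h₀⟩ := ih h₁ ρ₁
      refine ⟨ρ₀, Steps.succ_iff.2 ⟨_, h₀, ?_⟩⟩
      simp only [Choice.step, hF, not_false_eq_true, dite_true, hu, cond_false, hw]
      rw [R.move_eq _ _ _ _ ρ₂.head hu, hc]
    | true =>
      obtain ⟨ρ₀, h₀⟩ := ih h₁ (Stream'.cons ρ₂.head ρ₁)
      refine ⟨ρ₀, Steps.succ_iff.2 ⟨_, h₀, ?_⟩⟩
      simp only [Choice.step, hF, not_false_eq_true, dite_true, hu, cond_true, hw,
        Stream'.head_cons, Stream'.tail_cons, hc]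

/-- The degree of a configuration is the supremum of the degrees of the runs that lead to it. -/
theorem Choice.conf_le_iff (s : FuzzySet (List Δ)) {t : ℕ} {c : M.Config} {u : I} :
    M.conf s t c ≤ u ↔ ∀ x ρ ρ' w,
      Steps (R.step (len s)) t (M.initConfig x, ρ, 1) (c, ρ', w) → min (s x) w ≤ u := by
  induction t generalizing c u with
  | zero =>
    simp only [conf, iSup_le_iff, Steps, Prod.mk.injEq]
    constructor
    · rintro h x ρ ρ' w ⟨rfl, -, -⟩
      exact (min_le_left _ _).trans (h ⟨x, rfl⟩)
    · rintro h ⟨x, rfl⟩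
      exact (le_min le_rfl le_top).trans (h x default default 1 ⟨rfl, rfl, rfl⟩)
  | succ t ih =>
    simp only [conf, mu2, mu1, iSup_le_iff]
    constructor
    · intro h x ρ ρ' w hs
      obtain ⟨⟨c₁, ρ₂, w₁⟩, h₁, h₂⟩ := Steps.succ_iff.1 hs
      unfold Choice.step at h₂
      split at h₂
      case isFalse => simp at h₂
      rename_i hF
      simp only [Option.some.injEq, Prod.mk.injEq] at h₂
      obtain ⟨hc, -, hw⟩ := h₂
      refine le_trans ?_ (h ⟨⟨⟨c₁, hF⟩, _⟩, hc⟩)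
      rw [← hw, ← min_assoc]
      refine min_le_min (ih.1 le_rfl _ _ _ _ h₁) ?_
      rw [R.δ_eq]
      exact le_iSup_of_le ⟨ρ₂.head, rfl⟩ le_rfl
    · rintro h ⟨⟨⟨c₁, hF⟩, m⟩, hc⟩
      rw [R.δ_eq]
      change M.conf s t c₁ ⊓ _ ≤ u
      simp only at hc
      rw [inf_iSup_eq]
      refine iSup_le fun ⟨b, hb⟩ => ?_
      rw [← le_himp_iff]
      refine ih.2 fun x ρ ρ' w hs => ?_
      rw [le_himp_iff]
      obtain ⟨ρ₀, h₀⟩ := R.steps_stream hs (Stream'.cons b ρ')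
      subst hc
      have := h x ρ₀ _ _ (Steps.succ_iff.2 ⟨_, h₀, by
        simp only [Choice.step, hF, not_false_eq_true, dite_true, Stream'.head_cons, hb]; rfl⟩)
      rwa [← min_assoc] at this

theorem Choice.step_eq_none {n : ℕ} {X : M.Config × Stream' Bool × I} (h : X.1.state ∈ M.F) :
    R.step n X = none := by
  simp [Choice.step, h]

/-- If on every string of the support and for every choice of the arbitrary bits the machine halts
within time `T`, then its output is described by the halting configurations of these runs. -/
theorem Choice.output_eq {s : FuzzySet (List Δ)} {g : FuzzySet (List Γ)} {T : ℕ}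
    (O : List Δ → Stream' Bool → List Γ) (W : List Δ → Stream' Bool → I)
    (hT : ∀ x, 0 < s x → ∀ ρ, ∃ t ≤ T, ∃ ρ' c, c.state ∈ M.F ∧ c.out = O x ρ ∧
      Steps (R.step (len s)) t (M.initConfig x, ρ, 1) (c, ρ', W x ρ))
    (hg : ∀ y u, g y ≤ u ↔ ∀ x ρ, 0 < s x → O x ρ = y → min (s x) (W x ρ) ≤ u)
    (hne : ∃ y, 0 < g y) :
    ∃ t, M.IsRunningTime s t ∧ t ≤ T ∧ M.output s t = g := by
  classical
  -- every halting configuration of positive degree ends one of the given runs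
  have key : ∀ x ρ ρ' c w t, 0 < s x → c.state ∈ M.F →
      Steps (R.step (len s)) t (M.initConfig x, ρ, 1) (c, ρ', w) →
      t ≤ T ∧ c.out = O x ρ ∧ w = W x ρ := by
    intro x ρ ρ' c w t hx hc hs
    obtain ⟨t', ht', ρ'', c', hc', ho, hs'⟩ := hT x hx ρ
    obtain ⟨rfl, h⟩ := hs.eq_of_stuck hs' (R.step_eq_none hc) (R.step_eq_none hc')
    simp only [Prod.mk.injEq] at h
    obtain ⟨rfl, -, rfl⟩ := h
    exact ⟨ht', ho, rfl⟩
  have hpos : ∀ a : I, ¬ 0 < a → a = 0 := fun a h => le_antisymm (not_lt.1 h) bot_le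
  have hlate : ∀ i c, c.state ∈ M.F → 0 < M.conf s i c → i ≤ T := by
    intro i c hc hi
    by_contra hn
    refine hi.not_ge ((R.conf_le_iff s).2 fun x ρ ρ' w hs => ?_)
    by_cases hx : 0 < s x
    · exact absurd (key x ρ ρ' c w i hx hc hs).1 hn
    · rw [hpos _ hx]; exact min_le_left _ _
  have hex : ∃ i c, c.state ∈ M.F ∧ 0 < M.conf s i c := by
    obtain ⟨y, hy⟩ := hne
    by_contra! hn
    refine hy.not_ge ((hg y 0).2 fun x ρ hx hO => ?_)
    obtain ⟨t, -, ρ', c, hc, -, hs⟩ := hT x hx ρ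
    exact (R.conf_le_iff s).1 (hn t c hc) x ρ ρ' _ hs
  obtain ⟨i₀, hi₀⟩ := hex
  let P : ℕ → Prop := fun i => ∃ c, c.state ∈ M.F ∧ 0 < M.conf s i c
  have hi₀T : i₀ ≤ T := by
    obtain ⟨c, hc, h⟩ := hi₀
    exact hlate _ c hc h
  refine ⟨Nat.findGreatest P T, ⟨Nat.findGreatest_spec (P := P) hi₀T hi₀, ?_⟩,
    Nat.findGreatest_le _, ?_⟩
  · intro i hi c hc
    by_contra hn
    have hp : 0 < M.conf s i c := by
      by_contra h; exact hn (hpos _ h)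
    exact (Nat.le_findGreatest (P := P) (hlate i c hc hp) ⟨c, hc, hp⟩).not_gt hi
  · funext y
    apply le_antisymm
    · refine iSup_le fun ⟨c, hc, ho⟩ => ?_
      simp only [final, if_pos hc, mu3]
      refine iSup_le fun i => (R.conf_le_iff s).2 fun x ρ ρ' w hs => ?_
      by_cases hx : 0 < s x
      · obtain ⟨-, h₂, rfl⟩ := key x ρ ρ' c w i hx hc hs
        exact (hg y _).1 le_rfl x ρ hx (h₂.symm.trans ho)
      · rw [hpos _ hx]; exact (min_le_left _ _).trans bot_le
    · refine (hg y _).2 fun x ρ hx hO => ?_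
      obtain ⟨t, -, ρ', c, hc, ho, hs⟩ := hT x hx ρ
      have h₁ := (R.conf_le_iff s).1 le_rfl x ρ ρ' _ hs
      by_cases hp : 0 < M.conf s t c
      · refine h₁.trans ?_
        refine le_iSup_of_le ⟨c, hc, ho.trans hO⟩ ?_
        simp only [final, if_pos hc, mu3]
        exact le_iSup_of_le ⟨t, Nat.lt_succ_of_le
          (Nat.le_findGreatest (P := P) (hlate t c hc hp) ⟨c, hc, hp⟩)⟩ le_rfl
      · rw [hpos _ hp] at h₁
        exact h₁.trans bot_le

end DFTM

/-! ### Simulation of stack machines by fuzzy Turing machines -/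

/-- The marks on the input track of the work tape. -/
inductive Mark (Δ : Type) where
  | sym (a : Δ)
  | cent
  | dollar
  | blank

/-- The input symbol carried by a mark. -/
def Mark.sym? {Δ : Type} : Mark Δ → Option Δ
  | .sym a => some a
  | _ => none

/-- Is this the left endmarker? -/
def Mark.isCent {Δ : Type} : Mark Δ → Bool
  | .cent => true
  | _ => false

instance {Δ : Type} [Finite Δ] : Finite (Mark Δ) := by
  refine Finite.of_surjective
    (fun o : Option (Option (Option (Option Δ))) => match o with
      | none => Mark.cent
      | some none => Mark.dollar
      | some (some none) => Mark.blank
      | some (some (some none)) => Mark.blank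
      | some (some (some (some a))) => Mark.sym a) ?_
  rintro (a | _ | _ | _)
  · exact ⟨some (some (some (some a))), rfl⟩
  · exact ⟨none, rfl⟩
  · exact ⟨some none, rfl⟩
  · exact ⟨some (some none), rfl⟩

/-- The control states of the simulation of a stack machine with states `Q`: loading the input,
executing an instruction at the home cell or travelling there, travelling to the first free cell of
a track, and looking at the topmost symbol of a track. -/
inductive SimState (Q : Type) where
  | load
  | run (q : Option Q)
  | seek (q : Q)
  | top (q : Q)

instance {Q : Type} [Finite Q] : Finite (SimState Q) := by
  refine Finite.of_surjective
    (fun o : Option Q ⊕ Q ⊕ Q ⊕ Unit => match o with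
      | .inl q => SimState.run q
      | .inr (.inl q) => SimState.seek q
      | .inr (.inr (.inl q)) => SimState.top q
      | .inr (.inr (.inr ())) => SimState.load) ?_
  rintro (_ | q | q | q)
  · exact ⟨.inr (.inr (.inr ())), rfl⟩
  · exact ⟨.inl q, rfl⟩
  · exact ⟨.inr (.inl q), rfl⟩
  · exact ⟨.inr (.inr (.inl q)), rfl⟩

namespace Mach

variable {Δ G K : Type} [DecidableEq K] {Γ : K → Type}

/-- The work tape alphabet of the simulation: a mark, and one track for each stack. -/
abbrev SimSym (Δ : Type) {K : Type} (Γ : K → Type) : Type := Mark Δ × (∀ k, Option (Γ k))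

/-- The moves of the simulation. A stack occupies the cells `1, 2, …` of its track, its bottom being
in cell `1`. While loading, the two heads move in parallel; in cell `i` the stack `kx` receives
the `i`-th input symbol, if there is one, and the stack `kn` a unary digit. -/
def simMove (M : Mach K Γ G) (kx kn : K) (wx : Option Δ → Γ kx) (wn : Γ kn) :
    SimState M.Q → SimSym Δ Γ → AuxSym → Bool →
      SimState M.Q × SimSym Δ Γ × Option G × SignType × SignType
  | .load, y, .one, _ =>
      (.load, (y.1, Function.update (Function.update y.2 kx (some (wx y.1.sym?))) kn (some wn)),
        none, 1, 1)
  | .load, y, .cent, _ => (.load, y, none, 1, 1)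
  | .load, y, _, _ => (.run M.start, y, none, -1, 0)
  | .run none, y, _, _ => (.run none, y, none, 0, 0)
  | .run (some q), y, _, b =>
      if y.1.isCent then
        match M.op q with
        | .push _ _ _ => (.seek q, y, none, 1, 0)
        | .read _ _ _ => (.seek q, y, none, 1, 0)
        | .eff _ o q' => (.run q', y, o, 0, 0)
        | .guess f => (.run (f b), y, none, 0, 0)
      else (.run (some q), y, none, -1, 0)
  | .seek q, y, _, _ =>
      match M.op q with
      | .push k a q' => (y.2 k).elim
          (.run q', (y.1, Function.update y.2 k (some a)), none, -1, 0)
          fun _ => (.seek q, y, none, 1, 0)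
      | .read k _ _ => (y.2 k).elim (.top q, y, none, -1, 0) fun _ => (.seek q, y, none, 1, 0)
      | _ => (.seek q, y, none, 0, 0)
  | .top q, y, _, _ =>
      match M.op q with
      | .read k e f => (.run (f (y.2 k)), (y.1, if e then Function.update y.2 k none else y.2),
          none, if y.1.isCent then 0 else -1, 0)
      | _ => (.top q, y, none, 0, 0)

/-- The degrees of the moves of the simulation. -/
def simDeg (M : Mach K Γ G) : SimState M.Q → SimSym Δ Γ → I
  | .run (some q), y =>
      if y.1.isCent then
        match M.op q with
        | .eff w _ _ => w
        | _ => 1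
      else 1
  | _, _ => 1

/-- The situations in which the simulation branches. -/
def simUse (M : Mach K Γ G) : SimState M.Q → SimSym Δ Γ → Bool
  | .run (some q), y =>
      if y.1.isCent then
        match M.op q with
        | .guess _ => true
        | _ => false
      else false
  | _, _ => false

/-- The mark in cell `i` of the work tape on input `x`. -/
def mark (x : List Δ) (i : ℤ) : Mark Δ :=
  if i = 0 then .cent
  else if i = x.length + 1 then .dollar
  else if 0 < i then ((x[(i - 1).toNat]?).map .sym).getD .blank
  else .blank

/-- The work tape that represents the contents of the stacks. -/
def encTape (x : List Δ) (S : ∀ k, List (Γ k)) (i : ℤ) : SimSym Δ Γ :=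
  (mark x i, fun k => if 0 < i then (S k).reverse[(i - 1).toNat]? else none)

theorem isCent_mark (x : List Δ) (i : ℤ) : (mark x i).isCent = decide (i = 0) := by
  unfold mark
  split_ifs with h₁ h₂ h₃
  · simp [h₁, Mark.isCent]
  · simp [h₁, Mark.isCent]
  · cases x[(i - 1).toNat]? <;> simp [h₁, Mark.isCent]
  · simp [h₁, Mark.isCent]

theorem encTape_push (x : List Δ) (S : ∀ k, List (Γ k)) (k : K) (a : Γ k) :
    encTape x (Function.update S k (a :: S k)) =
      Function.update (encTape x S) ((S k).length + 1 : ℤ)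
        (mark x ((S k).length + 1), Function.update (encTape x S ((S k).length + 1)).2 k (some a)) := by
  funext i
  by_cases hi : i = (S k).length + 1
  · subst hi
    rw [Function.update_self]
    refine Prod.ext rfl ?_
    funext k'
    by_cases hk : k' = k
    · subst hk
      have : (0 : ℤ) < (S k').length + 1 := by positivity
      simp [encTape, this]
    · simp [encTape, hk]
  · rw [Function.update_of_ne hi]
    refine Prod.ext rfl ?_
    funext k'
    by_cases hk : k' = k
    · subst hk
      simp only [encTape, Function.update_self, List.reverse_cons]
      split_ifs with h0
      · obtain ⟨j, rfl⟩ : ∃ j : ℕ, i = j + 1 := ⟨(i - 1).toNat, by omega⟩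
        have hj : j ≠ (S k').length := by rintro rfl; exact hi rfl
        simp only [add_sub_cancel_right, Int.toNat_natCast]
        rcases lt_or_gt_of_ne hj with h | h
        · rw [List.getElem?_append_left (by simpa using h)]
        · rw [List.getElem?_eq_none (by simp; omega), List.getElem?_eq_none (by simp; omega)]
      · rfl
    · simp [encTape, hk]

theorem encTape_pop (x : List Δ) (S : ∀ k, List (Γ k)) (k : K) {a : Γ k} {l : List (Γ k)}
    (h : S k = a :: l) :
    encTape x (Function.update S k l) =
      Function.update (encTape x S) ((l.length : ℤ) + 1)
        (mark x (l.length + 1), Function.update (encTape x S (l.length + 1)).2 k none) := by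
  have h' := encTape_push x (Function.update S k l) k a
  simp only [Function.update_self, Function.update_idem] at h'
  rw [← h, Function.update_eq_self] at h'
  rw [h', Function.update_idem, Function.update_self]
  symm
  rw [Function.update_eq_iff]
  refine ⟨?_, fun _ _ => rfl⟩
  refine Prod.ext rfl ?_
  funext k'
  by_cases hk : k' = k
  · subst hk
    simp [encTape]
  · simp [hk]

theorem encTape_top {Δ K : Type} {Γ : K → Type} (x : List Δ) (S : ∀ k, List (Γ k)) (k : K) :
    (encTape x S ((S k).length : ℤ)).2 k = (S k).head? := by
  cases h : S k with
  | nil => simp [encTape]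
  | cons a l =>
    have : (0 : ℤ) < l.length + 1 := by positivity
    simp [encTape, h, this]

/-- The stacks after the input symbols from the first `j` cells have been loaded. -/
def loadStk (kx kn : K) (wx : Option Δ → Γ kx) (wn : Γ kn) (x : List Δ) :
    ℕ → ∀ k, List (Γ k)
  | 0 => fun _ => []
  | j + 1 =>
      let S := loadStk kx kn wx wn x j
      let S' := Function.update S kx (wx x[j]? :: S kx)
      Function.update S' kn (wn :: S' kn)

theorem length_exec_le {Q : Type} (o : Op K Γ G Q) (s : MState K Γ G) (k : K) :
    ((o.exec s).2.stk k).length ≤ (s.stk k).length + 1 := by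
  cases o with
  | push k' a q =>
    by_cases hk : k = k'
    · subst hk; simp [Op.exec]
    · simp [Op.exec, hk]
  | read k' e f =>
    cases e
    · simp [Op.exec]
    · by_cases hk : k = k'
      · subst hk; simp [Op.exec]; omega
      · simp [Op.exec, hk]
  | eff w o q => simp [Op.exec]
  | guess f => simp [Op.exec]

theorem length_loadStk (kx kn : K) (wx : Option Δ → Γ kx) (wn : Γ kn) (hk : kx ≠ kn) (x : List Δ) (j : ℕ) :
    (loadStk kx kn wx wn x j kx).length = j ∧ (loadStk kx kn wx wn x j kn).length = j := by
  induction j with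
  | zero => simp [loadStk]
  | succ j ih => simp [loadStk, hk, hk.symm, ih]

theorem length_loadStk_le (kx kn : K) (wx : Option Δ → Γ kx) (wn : Γ kn) (x : List Δ) (j : ℕ) (k : K) (hk : kx ≠ kn) :
    (loadStk kx kn wx wn x j k).length ≤ j := by
  induction j with
  | zero => simp [loadStk]
  | succ j ih =>
    obtain ⟨h₁, h₂⟩ := length_loadStk kx kn wx wn hk x j
    by_cases h : k = kn
    · subst h; simp [loadStk, hk.symm, h₂]
    · by_cases h' : k = kx
      · subst h'; simp [loadStk, hk, h₁]
      · simp [loadStk, h, h']; omega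

theorem sym?_mark (x : List Δ) (j : ℕ) : (mark x (j + 1)).sym? = x[j]? := by
  have h0 : (j : ℤ) + 1 ≠ 0 := by omega
  have h1 : (0 : ℤ) < j + 1 := by omega
  unfold mark
  rw [if_neg h0, if_pos h1]
  split_ifs with h
  · have : j = x.length := by omega
    rw [List.getElem?_eq_none (by omega)]
    rfl
  · simp only [add_sub_cancel_right, Int.toNat_natCast]
    cases x[j]? <;> rfl

variable [Finite Δ] [Finite K] [∀ k, Finite (Γ k)]

/-- The fuzzy Turing machine that simulates a stack machine. -/
noncomputable def toDFTM (M : Mach K Γ G) (kx kn : K) (wx : Option Δ → Γ kx) (wn : Γ kn) :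
    DFTM Δ G where
  Q := SimState M.Q
  finite_Q := inferInstance
  S := SimSym Δ Γ
  finite_S := inferInstance
  inp a := (.sym a, fun _ => none)
  inp_injective a b h := by simpa using h
  cent := (.cent, fun _ => none)
  dollar := (.dollar, fun _ => none)
  blank := (.blank, fun _ => none)
  cent_ne_dollar := by simp
  cent_ne_blank := by simp
  dollar_ne_blank := by simp
  inp_ne_cent := by simp
  inp_ne_dollar := by simp
  q₀ := .load
  F := {.run none}
  δ q y τ m := ⨆ _ : {b : Bool // simMove M kx kn wx wn q.1 y τ b = m}, simDeg M q.1 y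

variable (M : Mach K Γ G) (kx kn : K) (wx : Option Δ → Γ kx) (wn : Γ kn)

/-- The presentation of the simulation by arbitrary bits. -/
def simChoice : (toDFTM M kx kn wx wn).Choice where
  move q y τ b := simMove M kx kn wx wn q.1 y τ b
  deg q y _ := simDeg M q.1 y
  use q y _ := simUse M q.1 y
  δ_eq _ _ _ _ := rfl
  move_eq := by
    rintro ⟨_ | (_ | q) | q | q, hq⟩ y τ b b' h
    · cases τ <;> rfl
    · rfl
    · change simUse M (.run (some q)) y = false at h
      change simMove M kx kn wx wn (.run (some q)) y τ b =
        simMove M kx kn wx wn (.run (some q)) y τ b'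
      simp only [simMove, simUse] at h ⊢
      split_ifs with hc
      · rw [if_pos hc] at h
        cases ho : M.op q <;> simp [ho] at h ⊢
      · rfl
    · rfl
    · rfl

/-- A configuration of the simulation, together with the stream of bits and the accumulated
degree. -/
def simCfg (q : SimState M.Q) (T : ℤ → SimSym Δ Γ) (h p : ℤ) (s : MState K Γ G) :
    (toDFTM M kx kn wx wn).Config × Stream' Bool × I :=
  (⟨q, T, h, p, s.out⟩, s.ρ, s.wt)

theorem sim_step {q : SimState M.Q} (hq : q ≠ .run none) (n : ℕ) (T : ℤ → SimSym Δ Γ) (h p : ℤ)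
    (s : MState K Γ G) {m} (hm : simMove M kx kn wx wn q (T h) (DFTM.auxTape n p) s.ρ.head = m) :
    (simChoice M kx kn wx wn).step n (simCfg M kx kn wx wn q T h p s) =
      some (simCfg M kx kn wx wn m.1 (Function.update T h m.2.1) (h + (m.2.2.2.1 : ℤ))
        (p + (m.2.2.2.2 : ℤ))
        { s with
          ρ := bif simUse M q (T h) then s.ρ.tail else s.ρ
          out := s.out ++ m.2.2.1.toList
          wt := min s.wt (simDeg M q (T h)) }) := by
  subst hm
  have : (simCfg M kx kn wx wn q T h p s).1.state ∉ (toDFTM M kx kn wx wn).F := hq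
  rw [DFTM.Choice.step, dif_pos this]
  rfl

theorem sim_plain {q q' : SimState M.Q} (hq : q ≠ .run none) {n : ℕ} {T : ℤ → SimSym Δ Γ}
    {h p : ℤ} {s : MState K Γ G} {y : SimSym Δ Γ} {d d' : SignType}
    (hm : simMove M kx kn wx wn q (T h) (DFTM.auxTape n p) s.ρ.head = (q', y, none, d, d'))
    (hu : simUse M q (T h) = false) (hw : simDeg M q (T h) = 1) :
    (simChoice M kx kn wx wn).step n (simCfg M kx kn wx wn q T h p s) =
      some (simCfg M kx kn wx wn q' (Function.update T h y) (h + (d : ℤ)) (p + (d' : ℤ)) s) := by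
  have h1 : min s.wt 1 = s.wt := min_eq_left le_top
  rw [sim_step M kx kn wx wn hq n T h p s hm, hu, hw, h1]
  simp only [cond_false, Option.toList_none, List.append_nil]

/-- The head travels back to cell `0`, where the next instruction is executed. -/
theorem sim_home (n : ℕ) (x : List Δ) (q : M.Q) (p : ℤ) (s : MState K Γ G) (j : ℕ) :
    Steps ((simChoice M kx kn wx wn).step n) j
      (simCfg M kx kn wx wn (.run (some q)) (encTape x s.stk) j p s)
      (simCfg M kx kn wx wn (.run (some q)) (encTape x s.stk) 0 p s) := by
  induction j with
  | zero => rfl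
  | succ j ih =>
    have hc : (encTape x s.stk ((j + 1 : ℕ) : ℤ)).1.isCent = false := by
      simp only [encTape, isCent_mark]; simp; omega
    refine ⟨_, sim_plain M kx kn wx wn (by simp)
      (by simp only [simMove, hc, Bool.false_eq_true, if_false]; rfl) (by simp only [simUse, hc]; rfl)
      (by simp only [simDeg, hc]; rfl), ?_⟩
    simpa using ih

/-- The head travels along the track of a stack to the cell above the top symbol. -/
theorem sim_seek (n : ℕ) (x : List Δ) (q : M.Q) (p : ℤ) (s : MState K Γ G) (k : K)
    (hmove : ∀ y τ b, y.2 k ≠ none →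
      simMove M kx kn wx wn (.seek q) y τ b = (.seek q, y, none, 1, 0)) (d i : ℕ)
    (hi : i + d = (s.stk k).length) :
    Steps ((simChoice M kx kn wx wn).step n) d
      (simCfg M kx kn wx wn (.seek q) (encTape x s.stk) (i + 1) p s)
      (simCfg M kx kn wx wn (.seek q) (encTape x s.stk) ((s.stk k).length + 1) p s) := by
  induction d generalizing i with
  | zero => subst hi; rfl
  | succ d ih =>
    refine ⟨_, sim_plain M kx kn wx wn (by simp) (hmove _ _ _ ?_) rfl rfl, ?_⟩
    · have : (0 : ℤ) < i + 1 := by positivity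
      simp [encTape, this]; omega
    · have := ih (i + 1) (by omega)
      simpa using this

/-- The simulation of one instruction when all stacks have height at most `B`: the head returns to cell
`0`, and then goes to the top of the stack that is concerned. -/
theorem sim_exec (n : ℕ) (x : List Δ) (q : M.Q) (p : ℤ) (s : MState K Γ G) (j B : ℕ)
    (hj : j ≤ B) (hB : ∀ k, (s.stk k).length ≤ B) :
    ∃ t ≤ 2 * B + 4, ∃ j' ≤ B + 1, Steps ((simChoice M kx kn wx wn).step n) t
      (simCfg M kx kn wx wn (.run (some q)) (encTape x s.stk) j p s)
      (simCfg M kx kn wx wn (.run ((M.op q).exec s).1) (encTape x ((M.op q).exec s).2.stk) j' p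
        ((M.op q).exec s).2) := by
  have home := sim_home M kx kn wx wn n x q p s j
  have hc : (encTape x s.stk 0).1.isCent = true := by
    simp only [encTape, isCent_mark]; simp
  cases ho : M.op q with
  | push k a q' =>
    have h₁ := sim_plain (q := .run (some q)) (T := encTape x s.stk) (h := 0) (p := p) (n := n)
      (s := s) M kx kn wx wn (by simp)
      (by simp only [simMove, hc, if_true, ho]; rfl)
      (by simp only [simUse, hc, if_true, ho])
      (by simp only [simDeg, hc, if_true, ho])
    have h₂ := sim_seek M kx kn wx wn n x q p s k (by
      intro y τ b hy
      obtain ⟨v, hv⟩ := Option.ne_none_iff_exists'.1 hy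
      simp only [simMove, ho, hv, Option.elim]) _ 0 (Nat.zero_add _)
    have h₃ := sim_plain (q := .seek q) (T := encTape x s.stk)
      (h := (s.stk k).length + 1) (p := p) (n := n) (s := s) M kx kn wx wn (by simp)
      (by
        have : (0 : ℤ) < (s.stk k).length + 1 := by positivity
        have : (encTape x s.stk ((s.stk k).length + 1)).2 k = none := by simp [encTape, this]
        simp only [simMove, ho, this, Option.elim]; rfl) rfl rfl
    refine ⟨j + (1 + ((s.stk k).length + 1)), by have := hB k; omega, (s.stk k).length,
      (hB k).trans (Nat.le_succ B), home.trans (Steps.trans (Steps.one h₁) ?_)⟩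
    rw [Function.update_eq_self]
    simp only [SignType.coe_one, SignType.coe_zero, add_zero, SignType.coe_neg_one] at h₃ ⊢
    refine Steps.trans (by simpa using h₂) (Steps.one (h₃.trans ?_))
    simp only [Op.exec, encTape_push, add_neg_cancel_right]
    rfl
  | read k e f =>
    have h₁ := sim_plain (q := .run (some q)) (T := encTape x s.stk) (h := 0) (p := p) (n := n)
      (s := s) M kx kn wx wn (by simp)
      (by simp only [simMove, hc, if_true, ho]; rfl)
      (by simp only [simUse, hc, if_true, ho])
      (by simp only [simDeg, hc, if_true, ho])
    have h₂ := sim_seek M kx kn wx wn n x q p s k (by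
      intro y τ b hy
      obtain ⟨v, hv⟩ := Option.ne_none_iff_exists'.1 hy
      simp only [simMove, ho, hv, Option.elim]) _ 0 (Nat.zero_add _)
    have h₃ := sim_plain (q := .seek q) (T := encTape x s.stk)
      (h := (s.stk k).length + 1) (p := p) (n := n) (s := s) M kx kn wx wn (by simp)
      (by
        have : (0 : ℤ) < (s.stk k).length + 1 := by positivity
        have : (encTape x s.stk ((s.stk k).length + 1)).2 k = none := by simp [encTape, this]
        simp only [simMove, ho, this, Option.elim]; rfl) rfl rfl
    have h₄ := sim_plain (q := .top q) (T := encTape x s.stk)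
      (h := (s.stk k).length) (p := p) (n := n) (s := s) M kx kn wx wn (by simp)
      (by simp only [simMove, ho]; rfl) rfl rfl
    refine ⟨j + (1 + ((s.stk k).length + (1 + 1))), by have := hB k; omega,
      (s.stk k).length - 1, by have := hB k; omega,
      home.trans (Steps.trans (Steps.one h₁) ?_)⟩
    rw [Function.update_eq_self] at h₃ ⊢
    simp only [SignType.coe_one, SignType.coe_zero, add_zero, SignType.coe_neg_one,
      add_neg_cancel_right] at h₃ ⊢
    refine Steps.trans (by simpa using h₂) (Steps.trans (Steps.one h₃) (Steps.one (h₄.trans ?_)))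
    have hm : (encTape x s.stk (s.stk k).length).1.isCent = decide ((s.stk k).length = 0) := by
      simp only [encTape, isCent_mark]; simp
    rw [encTape_top, hm]
    cases hs : s.stk k with
    | nil =>
      have hu : Function.update (s.stk) k [] = s.stk := by rw [← hs, Function.update_eq_self]
      have hu' : Function.update (encTape x s.stk 0).2 k none = (encTape x s.stk 0).2 := by
        rw [Function.update_eq_self_iff]; simp [encTape]
      cases e <;> simp [Op.exec, hs, hu, hu']
    | cons a l =>
      have h0 : decide ((a :: l).length = 0) = false := by simp
      rw [h0]
      cases e with
      | false => simp [Op.exec, hs, Function.update_eq_self]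
      | true =>
        simp [Op.exec, hs, encTape_pop x s.stk k hs]
        rfl
  | eff w o q' =>
    refine ⟨j + 1, by omega, 0, by omega, home.trans (Steps.one ?_)⟩
    rw [sim_step M kx kn wx wn (by simp) n _ _ _ _ (m := (.run q', encTape x s.stk 0, o, 0, 0))
      (by simp only [simMove, hc, if_true, ho])]
    simp [Op.exec, simUse, simDeg, hc, ho]
  | guess f =>
    refine ⟨j + 1, by omega, 0, by omega, home.trans (Steps.one ?_)⟩
    rw [sim_step M kx kn wx wn (by simp) n _ _ _ _
      (m := (.run (f s.ρ.head), encTape x s.stk 0, none, 0, 0))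
      (by simp only [simMove, hc, if_true, ho])]
    have h1 : min s.wt 1 = s.wt := min_eq_left le_top
    simp [Op.exec, simUse, simDeg, hc, ho, h1]

/-- The stacks grow by at most one symbol with each instruction, so that `t` instructions take
`O(t (B + t))` moves. -/
theorem sim_steps (n : ℕ) (x : List Δ) (p : ℤ) (t : ℕ) : ∀ (q : Option M.Q)
    (s s' : MState K Γ G) (j B : ℕ), j ≤ B → (∀ k, (s.stk k).length ≤ B) →
    Steps M.step t (q, s) (none, s') →
    ∃ u ≤ t * (2 * (B + t) + 4), ∃ j' : ℕ, Steps ((simChoice M kx kn wx wn).step n) u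
      (simCfg M kx kn wx wn (.run q) (encTape x s.stk) j p s)
      (simCfg M kx kn wx wn (.run none) (encTape x s'.stk) j' p s') := by
  induction t with
  | zero =>
    rintro q s s' j B - - h
    simp only [Steps, Prod.mk.injEq] at h
    obtain ⟨rfl, rfl⟩ := h
    exact ⟨0, by simp, j, rfl⟩
  | succ t ih =>
    rintro (_ | q) s s' j B hj hB ⟨⟨q₁, s₁⟩, h₁, h₂⟩
    · simp [step] at h₁
    · simp only [step, Option.some.injEq] at h₁
      obtain ⟨u, hu, j', hj', hs⟩ := sim_exec M kx kn wx wn n x q p s j B hj hB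
      rw [h₁] at hs
      obtain ⟨u', hu', j'', hs'⟩ := ih q₁ s₁ s' j' (B + 1) hj'
        (fun k => by
          have := length_exec_le (M.op q) s k
          rw [h₁] at this
          exact this.trans (Nat.succ_le_succ (hB k))) h₂
      refine ⟨u + u', ?_, j'', hs.trans hs'⟩
      have : B + 1 + t = B + (t + 1) := by ring
      rw [this] at hu'
      rw [Nat.succ_mul]
      omega

theorem initTape_toDFTM (x : List Δ) :
    (toDFTM M kx kn wx wn).initTape x = encTape x (loadStk kx kn wx wn x 0) := by
  funext i
  refine Prod.ext ?_ ?_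
  · simp only [DFTM.initTape, encTape, mark, toDFTM]
    split_ifs <;> try rfl
    cases x[(i - 1).toNat]? <;> rfl
  · funext k
    simp only [DFTM.initTape, encTape, toDFTM, loadStk]
    have : (if 0 < i then ([] : List (Γ k)).reverse[(i - 1).toNat]? else none) = none := by simp
    rw [this]
    split_ifs <;> try rfl
    cases x[(i - 1).toNat]? <;> rfl

/-- Both heads run to the right together, and in each cell that is marked with a `1` on the auxiliary
tape the entry `x[i]?` of the input is put on the stack `kx`, and a unary digit on the stack `kn`. -/
theorem sim_load (hk : kx ≠ kn) (n : ℕ) (x : List Δ) (ρ : Stream' Bool) (j : ℕ) (hj : j ≤ n) :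
    Steps ((simChoice M kx kn wx wn).step n) (j + 1)
      ((toDFTM M kx kn wx wn).initConfig x, ρ, 1)
      (simCfg M kx kn wx wn .load (encTape x (loadStk kx kn wx wn x j)) (j + 1) (j + 1)
        ⟨loadStk kx kn wx wn x j, ρ, [], 1⟩) := by
  have hinit : ((toDFTM M kx kn wx wn).initConfig x, ρ, (1 : I)) =
      simCfg M kx kn wx wn .load (encTape x (loadStk kx kn wx wn x 0)) 0 0
        ⟨loadStk kx kn wx wn x 0, ρ, [], 1⟩ := by
    simp only [DFTM.initConfig, simCfg, initTape_toDFTM]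
    rfl
  rw [hinit]
  induction j with
  | zero =>
    refine Steps.one ?_
    rw [sim_plain M kx kn wx wn (q := .load)
      (q' := .load) (y := encTape x (loadStk kx kn wx wn x 0) 0) (d := 1) (d' := 1)
      (by simp) rfl rfl rfl]
    simp
  | succ j ih =>
    refine Steps.succ_iff.2 ⟨_, ih (by omega), ?_⟩
    have h1 : DFTM.auxTape n ((j : ℤ) + 1) = .one := by
      unfold DFTM.auxTape
      rw [if_neg (by omega), if_pos (by omega)]
    obtain ⟨h₁, h₂⟩ := length_loadStk kx kn wx wn hk x j
    rw [sim_plain M kx kn wx wn (q := .load) (by simp) (by rw [h1]; rfl) rfl rfl]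
    have : encTape x (loadStk kx kn wx wn x (j + 1)) = Function.update
        (encTape x (loadStk kx kn wx wn x j)) (j + 1)
        ((mark x (j + 1), Function.update (Function.update
          (encTape x (loadStk kx kn wx wn x j) (j + 1)).2 kx
            (some (wx (mark x (j + 1)).sym?))) kn (some wn)) : SimSym Δ Γ) := by
      simp only [loadStk]
      rw [encTape_push, encTape_push]
      simp only [Function.update_of_ne hk.symm, h₁, h₂, Function.update_idem,
        Function.update_self, ← sym?_mark]
    rw [this]
    simp [simCfg]
    rfl

/-- The simulation of a stack machine that, started with the input loaded, exits within time `T`.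
The time of the simulation is quadratic, since each instruction requires a tour to the end of a
track. -/
theorem sim_runs (hk : kx ≠ kn) (n : ℕ) (x : List Δ) (ρ : Stream' Bool) {s' : MState K Γ G}
    {T : ℕ} (h : M.Runs ⟨loadStk kx kn wx wn x n, ρ, [], 1⟩ s' T) :
    ∃ u ≤ n + 2 + T * (2 * (n + T) + 4), ∃ ρ' c, c.state ∈ (toDFTM M kx kn wx wn).F ∧
      c.out = s'.out ∧
      Steps ((simChoice M kx kn wx wn).step n) u ((toDFTM M kx kn wx wn).initConfig x, ρ, 1)
        (c, ρ', s'.wt) := by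
  obtain ⟨t, ht, hs⟩ := h
  obtain ⟨u, hu, j', hs'⟩ := sim_steps M kx kn wx wn n x (n + 1) t _ _ _ n n le_rfl
    (fun k => length_loadStk_le kx kn wx wn x n k hk) hs
  have h1 : DFTM.auxTape n ((n : ℤ) + 1) = .dollar := by
    unfold DFTM.auxTape
    rw [if_neg (by omega), if_neg (by omega), if_pos rfl]
  refine ⟨n + 1 + 1 + u, ?_, s'.ρ, ⟨.run none, encTape x s'.stk, j', n + 1, s'.out⟩, rfl, rfl,
    (sim_load M kx kn wx wn hk n x ρ n le_rfl).trans
      (Steps.one ?_) |>.trans hs'⟩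
  · have : t * (2 * (n + t) + 4) ≤ T * (2 * (n + T) + 4) := by gcongr
    omega
  · rw [sim_plain M kx kn wx wn (q := .load) (by simp) (by rw [h1]; rfl) rfl rfl]
    simp

end Mach

/-! ### Crisp Turing machines as stack machines -/

open Turing

theorem iterate_bind_eq_some {α : Type} {f : α → Option α} : ∀ {n : ℕ} {a b : α},
    (flip bind f)^[n] (some a) = some b ↔ Steps f n a b
  | 0, a, b => by simp [Steps]
  | n + 1, a, b => by
      rw [Function.iterate_succ_apply]
      change (flip bind f)^[n] (f a) = some b ↔ ∃ c, f a = some c ∧ Steps f n c b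
      cases h : f a with
      | none =>
        have : (flip bind f)^[n] none = none := Function.iterate_fixed rfl n
        rw [this]
        simp
      | some c =>
        rw [iterate_bind_eq_some]
        simp

/-- The symbols that can occur on stack `k` of a machine. The stack alphabets of a `FinTM2` need not
be finite, but only finitely many symbols can ever be pushed. -/
def Pushable (tm : FinTM2) (k : tm.K) (a : tm.Γ k) : Prop :=
  k = tm.k₀ ∨ ∃ l f q v, TM2.Stmt.push k f q ∈ TM2.stmts₁ (tm.m l) ∧ a = f v

instance (tm : FinTM2) (k : tm.K) : Finite {a : tm.Γ k // Pushable tm k a} := by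
  have := tm.Γk₀Fin
  have := tm.ΛFin
  have := tm.σFin
  have h₁ : {a : tm.Γ k | k = tm.k₀}.Finite := by
    by_cases h : k = tm.k₀
    · subst h; exact Set.toFinite _
    · simp [h]
  have h₂ : (⋃ l : tm.Λ, ⋃ s ∈ TM2.stmts₁ (tm.m l),
      {a : tm.Γ k | ∃ f q v, s = TM2.Stmt.push k f q ∧ a = f v}).Finite := by
    refine Set.finite_iUnion fun l => (TM2.stmts₁ (tm.m l)).finite_toSet.biUnion fun s _ => ?_
    cases s with
    | push k' f q =>
      by_cases hk : k' = k
      · subst hk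
        refine (Set.finite_range f).subset ?_
        rintro a ⟨f', q', v, h, rfl⟩
        simp only [TM2.Stmt.push.injEq, heq_eq_eq, true_and] at h
        exact ⟨v, by rw [h.1]⟩
      · refine Set.Finite.subset Set.finite_empty ?_
        rintro a ⟨f', q', v, h, rfl⟩
        simp only [TM2.Stmt.push.injEq] at h
        exact hk h.1
    | _ => simp
  refine Set.Finite.subset (h₁.union h₂) ?_
  rintro a (h | ⟨l, f, q, v, h, rfl⟩)
  · exact Or.inl h
  · refine Or.inr ?_
    simp only [Set.mem_iUnion]
    exact ⟨l, _, h, f, q, v, rfl, rfl⟩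

/-- Two families of stacks side by side. -/
def joinStk {K P : Type} {Γ : K → Type} {Γ' : P → Type} (A : ∀ k, List (Γ k))
    (B : ∀ p, List (Γ' p)) : ∀ k : K ⊕ P, List (Sum.elim Γ Γ' k)
  | .inl k => A k
  | .inr p => B p

section joinStk

variable {K P : Type} [DecidableEq K] [DecidableEq P] {Γ : K → Type} {Γ' : P → Type}
  (A : ∀ k, List (Γ k)) (B : ∀ p, List (Γ' p))

theorem update_joinStk_inl (k : K) (l : List (Γ k)) :
    Function.update (joinStk A B) (.inl k) l = joinStk (Function.update A k l) B := by
  funext x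
  rcases x with x | x
  · by_cases h : x = k
    · subst h
      exact (Function.update_self _ _ _).trans (Function.update_self x l A).symm
    · exact (Function.update_of_ne (fun h' => h (Sum.inl.inj h')) _ _).trans
        (show A x = Function.update A k l x from (Function.update_of_ne h l A).symm)
  · exact Function.update_of_ne (fun h' => Sum.inr_ne_inl h') _ _

theorem update_joinStk_inr (p : P) (l : List (Γ' p)) :
    Function.update (joinStk A B) (.inr p) l = joinStk A (Function.update B p l) := by
  funext x
  rcases x with x | x
  · exact Function.update_of_ne (fun h' => Sum.inl_ne_inr h') _ _
  · by_cases h : x = p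
    · subst h
      exact (Function.update_self _ _ _).trans (Function.update_self x l B).symm
    · exact (Function.update_of_ne (fun h' => h (Sum.inr.inj h')) _ _).trans
        (show B x = Function.update B p l x from (Function.update_of_ne h l B).symm)

end joinStk

namespace Mach

/-- The statements of a machine. -/
abbrev TMStmt (tm : FinTM2) : Type :=
  {p : TM2.Stmt tm.Γ tm.Λ tm.σ // ∃ l, p ∈ TM2.stmts₁ (tm.m l)}

instance (tm : FinTM2) : Finite (TMStmt tm) := by
  have := tm.ΛFin
  have : (⋃ l : tm.Λ, (TM2.stmts₁ (tm.m l) : Set (TM2.Stmt tm.Γ tm.Λ tm.σ))).Finite :=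
    Set.finite_iUnion fun l => Finset.finite_toSet _
  refine this.subset ?_
  rintro p ⟨l, h⟩
  exact Set.mem_iUnion.2 ⟨l, h⟩

theorem mem_stmts_main (tm : FinTM2) (l : tm.Λ) :
    ∃ l', tm.m l ∈ TM2.stmts₁ (tm.m l') := ⟨l, TM2.stmts₁_self⟩

theorem mem_stmts_of_mem {tm : FinTM2} {p q : TM2.Stmt tm.Γ tm.Λ tm.σ}
    (h : ∃ l, p ∈ TM2.stmts₁ (tm.m l)) (hq : q ∈ TM2.stmts₁ p) :
    ∃ l, q ∈ TM2.stmts₁ (tm.m l) := by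
  obtain ⟨l, hl⟩ := h
  exact ⟨l, TM2.stmts₁_trans hl hq⟩

variable {P : Type} [DecidableEq P] {Γ' : P → Type} {G : Type}

/-- The alphabets of the stacks of a machine, restricted to the symbols that can occur, together
with those of further stacks. -/
abbrev TMΓ (tm : FinTM2) (Γ' : P → Type) : tm.K ⊕ P → Type :=
  Sum.elim (fun k => {a : tm.Γ k // Pushable tm k a}) Γ'

/-- The instruction that corresponds to a statement executed in the internal state `v`. -/
def tmOp (tm : FinTM2) : (p : TM2.Stmt tm.Γ tm.Λ tm.σ) → (∃ l, p ∈ TM2.stmts₁ (tm.m l)) →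
    tm.σ → Op (tm.K ⊕ P) (TMΓ tm Γ') G (Option (TMStmt tm × tm.σ))
  | .push k f q, h, v =>
      .push (.inl k) ⟨f v, Or.inr (by obtain ⟨l, hl⟩ := h; exact ⟨l, f, q, v, hl, rfl⟩)⟩
        (some (⟨q, mem_stmts_of_mem h (by simp [TM2.stmts₁, TM2.stmts₁_self])⟩, v))
  | .peek k f q, h, v =>
      .read (.inl k) false fun a => some
        (⟨q, mem_stmts_of_mem h (by simp [TM2.stmts₁, TM2.stmts₁_self])⟩,
          f v (a.map Subtype.val))
  | .pop k f q, h, v =>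
      .read (.inl k) true fun a => some
        (⟨q, mem_stmts_of_mem h (by simp [TM2.stmts₁, TM2.stmts₁_self])⟩,
          f v (a.map Subtype.val))
  | .load f q, h, v =>
      .eff 1 none (some
        (⟨q, mem_stmts_of_mem h (by simp [TM2.stmts₁, TM2.stmts₁_self])⟩, f v))
  | .branch f q₁ q₂, h, v =>
      .eff 1 none (some
        (if f v then ⟨q₁, mem_stmts_of_mem h (by simp [TM2.stmts₁, TM2.stmts₁_self])⟩
          else ⟨q₂, mem_stmts_of_mem h (by simp [TM2.stmts₁, TM2.stmts₁_self])⟩, v))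
  | .goto l, _, v => .eff 1 none (some (⟨tm.m (l v), mem_stmts_main tm _⟩, v))
  | .halt, _, _ => .eff 1 none none

/-- A crisp Turing machine as a stack machine. -/
def ofTM2 (tm : FinTM2) : Mach (tm.K ⊕ P) (TMΓ tm Γ') G where
  Q := TMStmt tm × tm.σ
  finite_Q := by have := tm.σFin; infer_instance
  start := some (⟨tm.m tm.main, mem_stmts_main tm _⟩, tm.initialState)
  op q := tmOp tm q.1.1 q.1.2 q.2

/-- The number of elementary steps of a statement. -/
def stmtSize {K : Type} {Γ : K → Type} {Λ V : Type} : TM2.Stmt Γ Λ V → ℕ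
  | .push _ _ q => stmtSize q + 1
  | .peek _ _ q => stmtSize q + 1
  | .pop _ _ q => stmtSize q + 1
  | .load _ q => stmtSize q + 1
  | .branch _ q₁ q₂ => max (stmtSize q₁) (stmtSize q₂) + 1
  | .goto _ => 1
  | .halt => 1

/-- The state of the stack machine before the statement with label `l` is executed. -/
def tmState (tm : FinTM2) (l : Option tm.Λ) (v : tm.σ) : Option (TMStmt tm × tm.σ) :=
  l.map fun l => (⟨tm.m l, mem_stmts_main tm l⟩, v)

variable (G) in
/-- The elementary steps of a statement are carried out one by one. The stacks of the list `B` that do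
not belong to the crisp machine, the stream of bits, the output and the degree do not change. -/
theorem ofTM2_stmt (tm : FinTM2) (B : ∀ p, List (Γ' p)) (ρ : Stream' Bool) (o : List G) (w : I)
    (p : TM2.Stmt tm.Γ tm.Λ tm.σ) (h : ∃ l, p ∈ TM2.stmts₁ (tm.m l)) (v : tm.σ)
    (A : ∀ k, List {a : tm.Γ k // Pushable tm k a}) {c : TM2.Cfg tm.Γ tm.Λ tm.σ}
    (hc : TM2.stepAux p v (fun k => (A k).map Subtype.val) = c) :
    ∃ t ≤ stmtSize p, ∃ A' : ∀ k, List {a : tm.Γ k // Pushable tm k a},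
      (∀ k, (A' k).map Subtype.val = c.stk k) ∧
      Steps (ofTM2 (Γ' := Γ') (G := G) tm).step t (some (⟨p, h⟩, v), ⟨joinStk A B, ρ, o, w⟩)
        (tmState tm c.l c.var, ⟨joinStk A' B, ρ, o, w⟩) := by
  have h1 : min w 1 = w := min_eq_left le_top
  induction p generalizing v A with
  | push k f q ih =>
    obtain ⟨l, hl⟩ := h
    obtain ⟨t, ht, A', hA, hs⟩ := ih
      (mem_stmts_of_mem ⟨l, hl⟩ (by simp [TM2.stmts₁, TM2.stmts₁_self])) v
      (Function.update A k (⟨f v, Or.inr ⟨l, f, q, v, hl, rfl⟩⟩ :: A k)) (by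
        rw [← hc, TM2.stepAux]; congr 1; funext k'
        by_cases hk : k' = k
        · subst hk; simp
        · simp [hk])
    refine ⟨t + 1, Nat.succ_le_succ ht, A', hA, _, rfl, ?_⟩
    convert hs using 1
    exact congrArg (fun S => (_, MState.mk S ρ o w)) (update_joinStk_inl A B k _)
  | peek k f q ih =>
    obtain ⟨t, ht, A', hA, hs⟩ := ih
      (mem_stmts_of_mem h (by simp [TM2.stmts₁, TM2.stmts₁_self]))
      (f v ((A k).map Subtype.val).head?) A hc
    refine ⟨t + 1, Nat.succ_le_succ ht, A', hA, _, rfl, ?_⟩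
    rw [List.head?_map] at hs
    exact hs
  | pop k f q ih =>
    obtain ⟨t, ht, A', hA, hs⟩ := ih
      (mem_stmts_of_mem h (by simp [TM2.stmts₁, TM2.stmts₁_self]))
      (f v ((A k).map Subtype.val).head?) (Function.update A k (A k).tail) (by
        rw [← hc, TM2.stepAux]; congr 1; funext k'
        by_cases hk : k' = k
        · subst hk; simp
        · simp [hk])
    refine ⟨t + 1, Nat.succ_le_succ ht, A', hA, _, rfl, ?_⟩
    rw [List.head?_map] at hs
    convert hs using 1
    exact congrArg (fun S => (_, MState.mk S ρ o w)) (update_joinStk_inl A B k _)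
  | load f q ih =>
    obtain ⟨t, ht, A', hA, hs⟩ := ih
      (mem_stmts_of_mem h (by simp [TM2.stmts₁, TM2.stmts₁_self])) (f v) A hc
    refine ⟨t + 1, Nat.succ_le_succ ht, A', hA, _, rfl, ?_⟩
    convert hs using 1
    simp only [ofTM2, tmOp, Op.exec, h1, Option.toList_none, List.append_nil]
  | branch f q₁ q₂ ih₁ ih₂ =>
    rw [TM2.stepAux] at hc
    cases hf : f v with
    | true =>
      obtain ⟨t, ht, A', hA, hs⟩ := ih₁
        (mem_stmts_of_mem h (by simp [TM2.stmts₁, TM2.stmts₁_self])) v A (by simpa [hf] using hc)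
      refine ⟨t + 1, Nat.succ_le_succ (ht.trans (le_max_left _ _)), A', hA, _, rfl, ?_⟩
      convert hs using 1
      simp only [ofTM2, tmOp, Op.exec, h1, Option.toList_none, List.append_nil, hf, if_true]
    | false =>
      obtain ⟨t, ht, A', hA, hs⟩ := ih₂
        (mem_stmts_of_mem h (by simp [TM2.stmts₁, TM2.stmts₁_self])) v A (by simpa [hf] using hc)
      refine ⟨t + 1, Nat.succ_le_succ (ht.trans (le_max_right _ _)), A', hA, _, rfl, ?_⟩
      convert hs using 1
      simp only [ofTM2, tmOp, Op.exec, h1, Option.toList_none, List.append_nil, hf]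
      rfl
  | goto l =>
    subst hc
    refine ⟨1, le_rfl, A, fun _ => rfl, Steps.one ?_⟩
    simp [ofTM2, step, tmOp, Op.exec, h1, TM2.stepAux, tmState]
  | halt =>
    subst hc
    refine ⟨1, le_rfl, A, fun _ => rfl, Steps.one ?_⟩
    simp [ofTM2, step, tmOp, Op.exec, h1, TM2.stepAux, tmState]

variable (G) in
/-- A step of a crisp machine, which executes a whole statement, takes a bounded number of
instructions. -/
theorem ofTM2_steps (tm : FinTM2) (B : ∀ p, List (Γ' p)) (ρ : Stream' Bool) (o : List G) (w : I)
    {C : ℕ} (hC : ∀ l, stmtSize (tm.m l) ≤ C) (n : ℕ) : ∀ (c c' : TM2.Cfg tm.Γ tm.Λ tm.σ)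
    (A : ∀ k, List {a : tm.Γ k // Pushable tm k a}), (∀ k, (A k).map Subtype.val = c.stk k) →
    Steps (TM2.step tm.m) n c c' →
    ∃ t ≤ C * n, ∃ A' : ∀ k, List {a : tm.Γ k // Pushable tm k a},
      (∀ k, (A' k).map Subtype.val = c'.stk k) ∧
      Steps (ofTM2 (Γ' := Γ') (G := G) tm).step t (tmState tm c.l c.var, ⟨joinStk A B, ρ, o, w⟩)
        (tmState tm c'.l c'.var, ⟨joinStk A' B, ρ, o, w⟩) := by
  induction n with
  | zero =>
    rintro c c' A hA rfl
    exact ⟨0, le_rfl, A, hA, rfl⟩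
  | succ n ih =>
    rintro ⟨_ | l, v, S⟩ c' A hA ⟨c₁, h₁, h₂⟩
    · simp [TM2.step] at h₁
    · obtain rfl : (fun k => (A k).map Subtype.val) = S := funext hA
      simp only [TM2.step, Option.some.injEq] at h₁
      obtain ⟨t, ht, A', hA', hs⟩ := ofTM2_stmt G tm B ρ o w (tm.m l) (mem_stmts_main tm l) v A h₁
      obtain ⟨t', ht', A'', hA'', hs'⟩ := ih c₁ c' A' hA' h₂
      refine ⟨t + t', ?_, A'', hA'', hs.trans hs'⟩
      have := hC l
      rw [Nat.mul_succ]
      omega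

variable (G) in
/-- The simulation of a run of a crisp Turing machine that writes the string `y`. -/
theorem ofTM2_runs (tm : FinTM2) : ∃ C : ℕ, ∀ (B : ∀ p, List (Γ' p)) (ρ : Stream' Bool)
    (o : List G) (w : I) (A : ∀ k, List {a : tm.Γ k // Pushable tm k a})
    (x : List (tm.Γ tm.k₀)) (y : List (tm.Γ tm.k₁)) (m : ℕ),
    Nonempty (TM2OutputsInTime tm x (some y) m) →
    (A tm.k₀).map Subtype.val = x → (∀ k, k ≠ tm.k₀ → A k = []) →
    ∃ A' : ∀ k, List {a : tm.Γ k // Pushable tm k a}, (A' tm.k₁).map Subtype.val = y ∧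
      (ofTM2 (Γ' := Γ') (G := G) tm).Runs ⟨joinStk A B, ρ, o, w⟩ ⟨joinStk A' B, ρ, o, w⟩
        (C * m) := by
  have := tm.ΛFin
  refine ⟨Finset.univ.sup fun l => stmtSize (tm.m l), ?_⟩
  rintro B ρ o w A x y m ⟨h⟩ hx hA
  have hs := iterate_bind_eq_some.1 h.evals_in_steps
  obtain ⟨t, ht, A', hA', hs'⟩ := ofTM2_steps G tm B ρ o w (C := Finset.univ.sup fun l => stmtSize (tm.m l))
    (fun l => Finset.le_sup (f := fun l => stmtSize (tm.m l)) (Finset.mem_univ l)) _ _ _ A (by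
      intro k
      by_cases hk : k = tm.k₀
      · subst hk; simp [initList, hx]
      · simp [initList, hk, hA k hk]) hs
  refine ⟨A', ?_, t, ht.trans (Nat.mul_le_mul_left _ h.steps_le_m), hs'⟩
  rw [hA']
  simp [haltList]

/-! ### Enlarging the set of stacks -/

section lift

variable {K P : Type} [DecidableEq K] [DecidableEq P] {Γ : K → Type} {Γ' : P → Type} {G : Type}

/-- An instruction on some of the stacks. -/
def liftOp {Q : Type} : Op P Γ' G Q → Op (K ⊕ P) (Sum.elim Γ Γ') G Q
  | .push p a q => .push (.inr p) a q
  | .read p e f => .read (.inr p) e f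
  | .eff w o q => .eff w o q
  | .guess f => .guess f

/-- A machine that works on some of the stacks. -/
def lift (M : Mach P Γ' G) : Mach (K ⊕ P) (Sum.elim Γ Γ') G where
  Q := M.Q
  finite_Q := inferInstance
  start := M.start
  op q := liftOp (M.op q)

/-- Adjoining stacks to the data of a machine. -/
def liftState (A : ∀ k, List (Γ k)) (s : MState P Γ' G) : MState (K ⊕ P) (Sum.elim Γ Γ') G :=
  ⟨joinStk A s.stk, s.ρ, s.out, s.wt⟩

theorem Runs.lift {M : Mach P Γ' G} (A : ∀ k, List (Γ k)) {s s' : MState P Γ' G} {T : ℕ}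
    (h : M.Runs s s' T) : (M.lift (Γ := Γ)).Runs (liftState A s) (liftState A s') T := by
  obtain ⟨t, ht, hs⟩ := h
  refine ⟨t, ht, Steps.map (fun X : Option M.Q × MState P Γ' G => (X.1, liftState A X.2)) ?_ hs⟩
  rintro ⟨_ | q, s⟩ Y hY
  · simp [step] at hY
  · simp only [step, Option.some.injEq] at hY
    subst hY
    have : step (Mach.lift M) (some q, liftState A s) =
      some ((liftOp (M.op q)).exec (liftState A s)) := rfl
    refine this.trans (congrArg some ?_)
    cases M.op q with
    | push p a q =>
      exact congrArg (fun S => (_, MState.mk S s.ρ s.out s.wt)) (update_joinStk_inr A s.stk p _)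
    | read p e f =>
      cases e
      · rfl
      · exact congrArg (fun S => (_, MState.mk S s.ρ s.out s.wt))
          (update_joinStk_inr A s.stk p _)
    | eff w o q => rfl
    | guess f => rfl

end lift

end Mach

/-! ### Auxiliary machines -/

namespace Mach

section

variable {K : Type} [DecidableEq K] {Γ : K → Type} {G : Type}

/-- Push a symbol. -/
def push (k : K) (a : Γ k) : Mach K Γ G := prim (.push k a ())

/-- Erase the top symbol of a stack. -/
def pop (k : K) : Mach K Γ G := prim (.read k true fun _ => ())

theorem runs_push {k : K} {a : Γ k} {s s' : MState K Γ G}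
    (h : s' = { s with stk := Function.update s.stk k (a :: s.stk k) }) :
    (push k a).Runs s s' 1 := by
  subst h; exact runs_prim _ s

theorem runs_pop {k : K} {s s' : MState K Γ G}
    (h : s' = { s with stk := Function.update s.stk k (s.stk k).tail }) :
    (pop k).Runs s s' 1 := by
  subst h; exact runs_prim _ s

/-- Empty a stack. -/
def clear (k : K) [Finite (Γ k)] : Mach K Γ G := loop k (fun _ => true) fun _ => pop k

/-- Move the content of a stack to another one, symbol by symbol, replacing the symbols by `g`. -/
def move (k k' : K) [Finite (Γ k)] (g : Γ k → Γ k') : Mach K Γ G :=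
  loop k (fun _ => true) fun a => seq (pop k) (push k' (g a))

theorem runs_clear (k : K) [Finite (Γ k)] (s : MState K Γ G) :
    (clear k).Runs s { s with stk := Function.update s.stk k [] } (2 * (s.stk k).length + 1) := by
  generalize hl : s.stk k = l
  induction l generalizing s with
  | nil =>
    have : { s with stk := Function.update s.stk k [] } = s := by
      rw [← hl, Function.update_eq_self]
    rw [this]
    exact runs_loop_exit (by simp [hl])
  | cons a l ih =>
    have h := ih { s with stk := Function.update s.stk k l } (by simp)
    simp only [Function.update_idem] at h
    refine (Runs.loop (a := a) (by simp [hl]) rfl (runs_pop ?_) h).mono (by simp; omega)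
    simp [hl]

theorem runs_move {k k' : K} [Finite (Γ k)] (hk : k ≠ k') (g : Γ k → Γ k') (s : MState K Γ G) :
    (move k k' g).Runs s
      ⟨Function.update (Function.update s.stk k' (((s.stk k).map g).reverse ++ s.stk k')) k [],
        s.ρ, s.out, s.wt⟩
      (3 * (s.stk k).length + 1) := by
  generalize hl : s.stk k = l
  induction l generalizing s with
  | nil =>
    have h : Function.update s.stk k [] = s.stk := by rw [← hl, Function.update_eq_self]
    simp only [List.map_nil, List.reverse_nil, List.nil_append, Function.update_eq_self, h]
    exact runs_loop_exit (by simp [hl])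
  | cons a l ih =>
    have h := ih { s with stk := Function.update (Function.update s.stk k l) k' (g a :: s.stk k') }
      (by simp [hk])
    refine (Runs.loop (a := a) (by simp [hl]) rfl
      ((runs_pop rfl).seq (runs_push rfl)) (?_ : Runs _ _ _ (3 * l.length + 1))).mono
      (by simp; omega)
    convert h using 2
    · rfl
    · dsimp only
      rw [Function.update_of_ne hk.symm, hl, List.tail_cons]
    · dsimp only
      rw [Function.update_self, Function.update_idem, List.map_cons, List.reverse_cons,
        List.append_assoc, Function.update_comm hk, Function.update_idem]
      rfl

/-- Push the symbols of a list, the first one first. -/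
def pushList (k : K) : List (Γ k) → Mach K Γ G
  | [] => skip
  | a :: l => seq (push k a) (pushList k l)

theorem runs_pushList (k : K) (l : List (Γ k)) (s : MState K Γ G) :
    (pushList k l).Runs s { s with stk := Function.update s.stk k (l.reverse ++ s.stk k) }
      l.length := by
  induction l generalizing s with
  | nil => simpa [pushList] using runs_skip s
  | cons a l ih =>
    have h := (runs_push (k := k) (a := a) (s := s) rfl).seq (ih _)
    refine Runs.mono (T := 1 + l.length) ?_ (by simp; omega)
    simpa [pushList] using h

end

end Mach

/-! ### The stack machine that evaluates circuits -/

/-- The stacks of the circuit evaluator: the input string; the values of the variables of the last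
two levels (`arr false` for the preceding level and `arr true` for the new level); the values of the
input and output variables of the current gate (`bits false` and `bits true`); an auxiliary array;
two unary counters; and the description of the circuit, first in reverse order. -/
inductive EvStk where
  | inp
  | arr (c : Bool)
  | bits (c : Bool)
  | side
  | idx
  | tmp
  | rev
  | desc
  deriving DecidableEq

instance : Finite EvStk := by
  refine Finite.of_surjective
    (fun o : Option Bool ⊕ Option Bool ⊕ Fin 4 => match o with
      | .inl none => EvStk.inp
      | .inl (some c) => .arr c
      | .inr (.inl none) => .side
      | .inr (.inl (some c)) => .bits c
      | .inr (.inr 0) => .idx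
      | .inr (.inr 1) => .tmp
      | .inr (.inr 2) => .rev
      | .inr (.inr 3) => .desc) ?_
  rintro (_ | c | c | _ | _ | _ | _ | _)
  exacts [⟨.inl none, rfl⟩, ⟨.inl (some c), rfl⟩, ⟨.inr (.inl (some c)), rfl⟩,
    ⟨.inr (.inl none), rfl⟩, ⟨.inr (.inr 0), rfl⟩, ⟨.inr (.inr 1), rfl⟩, ⟨.inr (.inr 2), rfl⟩,
    ⟨.inr (.inr 3), rfl⟩]

/-- The common alphabet of the stacks of the circuit evaluator. -/
inductive EvSym (Δ : Type) (r : ℕ) where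
  | inp (o : Option Δ)
  | bit (b : Bool)
  | one
  | desc (d : DescSym r)

instance (r : ℕ) : Finite (DescSym r) := by
  refine Finite.of_surjective
    (fun o : Fin r ⊕ Fin 5 => match o with
      | .inl i => DescSym.deg i
      | .inr 0 => .one
      | .inr 1 => .comma
      | .inr 2 => .semicolon
      | .inr 3 => .endGate
      | .inr 4 => .endLevel) ?_
  rintro (_ | _ | _ | _ | _ | i)
  exacts [⟨.inr 0, rfl⟩, ⟨.inr 1, rfl⟩, ⟨.inr 2, rfl⟩, ⟨.inr 3, rfl⟩, ⟨.inr 4, rfl⟩, ⟨.inl i, rfl⟩]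

instance (Δ : Type) [Finite Δ] (r : ℕ) : Finite (EvSym Δ r) := by
  refine Finite.of_surjective
    (fun o : Option Δ ⊕ Option Bool ⊕ DescSym r => match o with
      | .inl i => EvSym.inp i
      | .inr (.inl none) => .one
      | .inr (.inl (some b)) => .bit b
      | .inr (.inr d) => .desc d) ?_
  rintro (o | b | _ | d)
  exacts [⟨.inl o, rfl⟩, ⟨.inr (.inl (some b)), rfl⟩, ⟨.inr (.inl none), rfl⟩,
    ⟨.inr (.inr d), rfl⟩]

/-- The data of the circuit evaluator. -/
structure EvData (Δ : Type) (r : ℕ) (G : Type) where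
  inp : List (Option Δ)
  arr : Bool → List Bool
  bits : Bool → List Bool
  side : List Bool
  idx : ℕ
  tmp : ℕ
  rev : List (DescSym r)
  desc : List (DescSym r)
  ρ : Stream' Bool
  out : List G
  wt : I

namespace EvData

variable {Δ : Type} {r : ℕ} {G : Type}

/-- The stacks. -/
def stk (s : EvData Δ r G) : EvStk → List (EvSym Δ r)
  | .inp => s.inp.map .inp
  | .arr c => (s.arr c).map .bit
  | .bits c => (s.bits c).map .bit
  | .side => s.side.map .bit
  | .idx => List.replicate s.idx .one
  | .tmp => List.replicate s.tmp .one
  | .rev => s.rev.map .desc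
  | .desc => s.desc.map .desc

/-- The data as data of a stack machine. -/
def toState (s : EvData Δ r G) : MState EvStk (fun _ => EvSym Δ r) G :=
  ⟨s.stk, s.ρ, s.out, s.wt⟩

theorem update_inp (s : EvData Δ r G) (l : List (Option Δ)) :
    Function.update s.stk .inp (l.map .inp) = { s with inp := l }.stk := by
  funext k; cases k <;> simp [stk]

theorem update_arr (s : EvData Δ r G) (c : Bool) (l : List Bool) :
    Function.update s.stk (.arr c) (l.map .bit) =
      { s with arr := Function.update s.arr c l }.stk := by
  funext k
  cases k with
  | arr c' =>
    by_cases h : c' = c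
    · subst h; simp [stk]
    · simp [stk, h]
  | _ => simp [stk]

theorem update_bits (s : EvData Δ r G) (c : Bool) (l : List Bool) :
    Function.update s.stk (.bits c) (l.map .bit) =
      { s with bits := Function.update s.bits c l }.stk := by
  funext k
  cases k with
  | bits c' =>
    by_cases h : c' = c
    · subst h; simp [stk]
    · simp [stk, h]
  | _ => simp [stk]

theorem update_side (s : EvData Δ r G) (l : List Bool) :
    Function.update s.stk .side (l.map .bit) = { s with side := l }.stk := by
  funext k; cases k <;> simp [stk]

theorem update_idx (s : EvData Δ r G) (n : ℕ) :
    Function.update s.stk .idx (List.replicate n .one) = { s with idx := n }.stk := by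
  funext k; cases k <;> simp [stk]

theorem update_tmp (s : EvData Δ r G) (n : ℕ) :
    Function.update s.stk .tmp (List.replicate n .one) = { s with tmp := n }.stk := by
  funext k; cases k <;> simp [stk]

theorem update_rev (s : EvData Δ r G) (l : List (DescSym r)) :
    Function.update s.stk .rev (l.map .desc) = { s with rev := l }.stk := by
  funext k; cases k <;> simp [stk]

theorem update_desc (s : EvData Δ r G) (l : List (DescSym r)) :
    Function.update s.stk .desc (l.map .desc) = { s with desc := l }.stk := by
  funext k; cases k <;> simp [stk]

end EvData


open Mach

/-- The bits `i, …, L - 1` of a stream. -/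
def seg (w : Stream' Bool) (i L : ℕ) : List Bool := (List.range' i (L - i)).map w.get

theorem seg_of_le (w : Stream' Bool) {i L : ℕ} (h : L ≤ i) : seg w i L = [] := by
  simp [seg, Nat.sub_eq_zero_of_le h]

theorem seg_of_lt (w : Stream' Bool) {i L : ℕ} (h : i < L) :
    seg w i L = w.get i :: seg w (i + 1) L := by
  obtain ⟨d, rfl⟩ : ∃ d, L = i + (d + 1) := ⟨L - i - 1, by omega⟩
  have h₁ : i + (d + 1) - i = d + 1 := by omega
  have h₂ : i + (d + 1) - (i + 1) = d := by omega
  simp [seg, h₁, h₂, List.range'_succ]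

theorem seg_append (w : Stream' Bool) {i j L : ℕ} (h : i ≤ j) (h' : j ≤ L) :
    seg w i j ++ seg w j L = seg w i L := by
  obtain ⟨a, rfl⟩ := Nat.exists_eq_add_of_le h
  obtain ⟨b, rfl⟩ := Nat.exists_eq_add_of_le h'
  have h₁ : i + a + b - (i + a) = b := by omega
  have h₂ : i + a + b - i = a + b := by omega
  have h₃ : i + a - i = a := by omega
  rw [seg, seg, seg, h₁, h₂, h₃, ← List.map_append, List.range'_append_1]

theorem seg_succ (w : Stream' Bool) (i : ℕ) : seg w 0 (i + 1) = seg w 0 i ++ [w.get i] := by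
  rw [← seg_append w (Nat.zero_le i) (Nat.le_succ i), seg_of_lt w (Nat.lt_succ_self i),
    seg_of_le w (le_refl (i + 1))]

theorem length_seg (w : Stream' Bool) (i L : ℕ) : (seg w i L).length = L - i := by simp [seg]

theorem Mach.Runs.congr {K : Type} [DecidableEq K] {Γ : K → Type} {G : Type} {M : Mach K Γ G}
    {s s₁ s₂ : MState K Γ G} {T T' : ℕ} (h : M.Runs s s₁ T) (e : s₁ = s₂) (hT : T ≤ T') :
    M.Runs s s₂ T' :=
  e ▸ h.mono hT

namespace EvData

variable {Δ : Type} {r : ℕ} {G : Type}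

section ops

variable (s : EvData Δ r G)

theorem runs_push_arr (c b : Bool) : (push (.arr c) (.bit b)).Runs s.toState
    { s with arr := Function.update s.arr c (b :: s.arr c) }.toState 1 :=
  runs_push (congrArg (fun S => MState.mk S s.ρ s.out s.wt) (s.update_arr c (b :: s.arr c)).symm)

theorem runs_push_bits (c b : Bool) : (push (.bits c) (.bit b)).Runs s.toState
    { s with bits := Function.update s.bits c (b :: s.bits c) }.toState 1 :=
  runs_push (congrArg (fun S => MState.mk S s.ρ s.out s.wt) (s.update_bits c (b :: s.bits c)).symm)

theorem runs_push_side (b : Bool) : (push .side (.bit b)).Runs s.toState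
    { s with side := b :: s.side }.toState 1 :=
  runs_push (congrArg (fun S => MState.mk S s.ρ s.out s.wt) (s.update_side (b :: s.side)).symm)

theorem runs_push_idx : (push .idx .one).Runs s.toState { s with idx := s.idx + 1 }.toState 1 :=
  runs_push (congrArg (fun S => MState.mk S s.ρ s.out s.wt) (s.update_idx (s.idx + 1)).symm)

theorem runs_push_tmp : (push .tmp .one).Runs s.toState { s with tmp := s.tmp + 1 }.toState 1 :=
  runs_push (congrArg (fun S => MState.mk S s.ρ s.out s.wt) (s.update_tmp (s.tmp + 1)).symm)

theorem tail_desc : Function.update s.stk .desc (s.stk .desc).tail =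
    { s with desc := s.desc.tail }.stk := by
  have h := s.update_desc (s.desc).tail
  rw [List.map_tail] at h
  exact h

theorem tail_arr (c : Bool) : Function.update s.stk (.arr c) (s.stk (.arr c)).tail =
    { s with arr := Function.update s.arr c (s.arr c).tail }.stk := by
  have h := s.update_arr c (s.arr c).tail
  rw [List.map_tail] at h
  exact h

theorem tail_bits (c : Bool) : Function.update s.stk (.bits c) (s.stk (.bits c)).tail =
    { s with bits := Function.update s.bits c (s.bits c).tail }.stk := by
  have h := s.update_bits c (s.bits c).tail
  rw [List.map_tail] at h
  exact h

theorem tail_inp : Function.update s.stk .inp (s.stk .inp).tail =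
    { s with inp := s.inp.tail }.stk := by
  have h := s.update_inp (s.inp).tail
  rw [List.map_tail] at h
  exact h

theorem runs_pop_desc : (pop .desc).Runs s.toState { s with desc := s.desc.tail }.toState 1 :=
  runs_pop (congrArg (fun S => MState.mk S s.ρ s.out s.wt) s.tail_desc.symm)

theorem runs_pop_inp : (pop .inp).Runs s.toState { s with inp := s.inp.tail }.toState 1 :=
  runs_pop (congrArg (fun S => MState.mk S s.ρ s.out s.wt) s.tail_inp.symm)

theorem runs_pop_bits (c : Bool) : (pop (.bits c)).Runs s.toState
    { s with bits := Function.update s.bits c (s.bits c).tail }.toState 1 :=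
  runs_pop (congrArg (fun S => MState.mk S s.ρ s.out s.wt) (s.tail_bits c).symm)

theorem runs_pop_idx : (pop .idx).Runs s.toState { s with idx := s.idx - 1 }.toState 1 := by
  refine runs_pop (congrArg (fun S => MState.mk S s.ρ s.out s.wt) ?_)
  rw [← update_idx]
  simp [stk, toState]

theorem runs_guess {B : Bool → Mach EvStk (fun _ => EvSym Δ r) G} {s' T}
    (hB : (B s.ρ.head).Runs { s with ρ := s.ρ.tail }.toState s' T) :
    (guess B).Runs s.toState s' (T + 1) := Runs.guess hB

theorem head?_desc {a : DescSym r} {l : List (DescSym r)} (h : s.desc = a :: l) :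
    (s.toState.stk .desc).head? = some (.desc a) := by
  simp [toState, stk, h]

variable [Finite Δ]

/-- Move the auxiliary array on top of an array. -/
theorem runs_move_side (c : Bool) : (move .side (.arr c) id).Runs s.toState
    { s with arr := Function.update s.arr c (s.side.reverse ++ s.arr c), side := [] }.toState
    (3 * s.side.length + 1) := by
  have h := runs_move (k := EvStk.side) (k' := EvStk.arr c) (by simp) id s.toState
  have e : (s.stk .side).length = s.side.length := by simp [stk]
  convert h using 1
  · refine congrArg (fun S => MState.mk S s.ρ s.out s.wt) ?_
    have h₁ : ((s.stk .side).map id).reverse ++ s.stk (.arr c) =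
        (s.side.reverse ++ s.arr c).map .bit := by simp [stk]
    have h₂ := update_side
      { s with arr := Function.update s.arr c (s.side.reverse ++ s.arr c) } []
    rw [← h₂, ← update_arr, ← h₁]
    rfl
  · simp only [toState, e]

/-- Move an array on top of the auxiliary array. -/
theorem runs_move_arr (c : Bool) : (move (.arr c) .side id).Runs s.toState
    { s with side := (s.arr c).reverse ++ s.side, arr := Function.update s.arr c [] }.toState
    (3 * (s.arr c).length + 1) := by
  have h := runs_move (k := EvStk.arr c) (k' := EvStk.side) (by simp) id s.toState
  have e : (s.stk (.arr c)).length = (s.arr c).length := by simp [stk]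
  convert h using 1
  · refine congrArg (fun S => MState.mk S s.ρ s.out s.wt) ?_
    have h₁ : ((s.stk (.arr c)).map id).reverse ++ s.stk .side =
        ((s.arr c).reverse ++ s.side).map .bit := by simp [stk]
    have h₂ := update_arr { s with side := (s.arr c).reverse ++ s.side } c []
    rw [← h₂, ← update_side, ← h₁]
    rfl
  · simp only [toState, e]

theorem runs_clear_arr (c : Bool) : (clear (.arr c)).Runs s.toState
    { s with arr := Function.update s.arr c [] }.toState (2 * (s.arr c).length + 1) := by
  have h := runs_clear (k := EvStk.arr c) s.toState
  have e : (s.stk (.arr c)).length = (s.arr c).length := by simp [stk]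
  convert h using 1
  · exact congrArg (fun S => MState.mk S s.ρ s.out s.wt) (s.update_arr c []).symm
  · simp only [toState, e]

theorem runs_move_tmp : (move .tmp .idx id).Runs s.toState
    { s with idx := s.idx + s.tmp, tmp := 0 }.toState (3 * s.tmp + 1) := by
  have h := runs_move (k := EvStk.tmp) (k' := EvStk.idx) (by simp) id s.toState
  have e : (s.stk .tmp).length = s.tmp := by simp [stk]
  convert h using 1
  · refine congrArg (fun S => MState.mk S s.ρ s.out s.wt) ?_
    have h₁ : ((s.stk .tmp).map id).reverse ++ s.stk .idx =
        List.replicate (s.idx + s.tmp) .one := by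
      simp [stk, Nat.add_comm s.idx]
    have h₂ := update_tmp { s with idx := s.idx + s.tmp } 0
    rw [← h₂, ← update_idx, ← h₁]
    rfl
  · simp only [toState, e]

theorem runs_move_rev : (move .rev .desc id).Runs s.toState
    { s with desc := s.rev.reverse ++ s.desc, rev := [] }.toState (3 * s.rev.length + 1) := by
  have h := runs_move (k := EvStk.rev) (k' := EvStk.desc) (by simp) id s.toState
  have e : (s.stk .rev).length = s.rev.length := by simp [stk]
  convert h using 1
  · refine congrArg (fun S => MState.mk S s.ρ s.out s.wt) ?_
    have h₁ : ((s.stk .rev).map id).reverse ++ s.stk .desc =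
        (s.rev.reverse ++ s.desc).map .desc := by simp [stk]
    have h₂ := update_rev { s with desc := s.rev.reverse ++ s.desc } []
    rw [← h₂, ← update_desc, ← h₁]
    rfl
  · simp only [toState, e]

theorem runs_case_arr_nil {c e : Bool} (h : s.arr c = [])
    {B : Option (EvSym Δ r) → Mach EvStk (fun _ => EvSym Δ r) G} {s' T}
    (hB : (B none).Runs s.toState s' T) : (case (.arr c) e B).Runs s.toState s' (T + 1) := by
  have hh : s.stk (.arr c) = [] := by simp [stk, h]
  refine Runs.case ?_
  have e₁ : { s.toState with stk := Function.update s.stk (.arr c) [] } = s.toState := by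
    rw [← hh, Function.update_eq_self]; rfl
  cases e
  · simpa [toState, hh] using hB
  · simp only [toState, hh, List.head?_nil, List.tail_nil, if_true]
    exact e₁ ▸ hB

theorem runs_case_arr_cons {c b : Bool} {l : List Bool} (h : s.arr c = b :: l)
    {B : Option (EvSym Δ r) → Mach EvStk (fun _ => EvSym Δ r) G} {s' T}
    (hB : (B (some (.bit b))).Runs { s with arr := Function.update s.arr c l }.toState s' T) :
    (case (.arr c) true B).Runs s.toState s' (T + 1) := by
  refine Runs.case ?_
  have hh : (s.toState.stk (.arr c)).head? = some (.bit b) := by simp [toState, stk, h]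
  rw [hh, if_pos rfl]
  have e := s.tail_arr c
  rw [h, List.tail_cons] at e
  simp only [toState, e]
  exact hB

theorem runs_case_arr_peek {c b : Bool} {l : List Bool} (h : s.arr c = b :: l)
    {B : Option (EvSym Δ r) → Mach EvStk (fun _ => EvSym Δ r) G} {s' T}
    (hB : (B (some (.bit b))).Runs s.toState s' T) :
    (case (.arr c) false B).Runs s.toState s' (T + 1) := by
  refine Runs.case ?_
  have hh : (s.toState.stk (.arr c)).head? = some (.bit b) := by simp [toState, stk, h]
  rw [hh]
  exact hB

end ops

end EvData

/-! ### Reading the labels of a gate -/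

section labels

variable {Δ : Type} [Finite Δ] {r : ℕ} {G : Type}

/-- The symbols of lists of labels. -/
def isLabel : EvSym Δ r → Bool
  | .desc .one => true
  | .desc .comma => true
  | _ => false

/-- Take the next symbol of an array, or an arbitrary bit if the array is exhausted, and put it
aside. -/
def shiftArr (c : Bool) : Mach EvStk (fun _ => EvSym Δ r) G :=
  case (.arr c) true fun o => o.elim (guess fun b => push .side (.bit b)) fun a => push .side a

/-- Record the next symbol of an array, or, if the array is exhausted, an arbitrary bit, which is then
added to the array. -/
def recordArr (c : Bool) : Mach EvStk (fun _ => EvSym Δ r) G :=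
  case (.arr c) false fun o => o.elim
    (guess fun b => seq (push (.arr c) (.bit b)) (push (.bits c) (.bit b)))
    fun a => push (.bits c) a

/-- Process a symbol of a list of labels. -/
def labelBody (c : Bool) : EvSym Δ r → Mach EvStk (fun _ => EvSym Δ r) G
  | .desc .one => seq (pop .desc) (shiftArr c)
  | _ => seq (pop .desc) (seq (recordArr c) (move .side (.arr c) id))

/-- Read a list of labels, and record the values of the variables with these labels. The array
`arr c` is prolonged by arbitrary bits where needed. -/
def readLabels (c : Bool) : Mach EvStk (fun _ => EvSym Δ r) G :=
  loop .desc isLabel (labelBody c)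

/-- The data when the array `arr c`, viewed as the beginning of the stream `w`, has length
`L`. -/
def EvData.withArr (s : EvData Δ r G) (c : Bool) (w : Stream' Bool) (L : ℕ) : EvData Δ r G :=
  { s with arr := Function.update s.arr c (seg w 0 L), side := [], ρ := w.drop L }

/-- The data when moreover the first `i` bits of the array have been put aside. -/
def EvData.shifted (s : EvData Δ r G) (c : Bool) (w : Stream' Bool) (L i : ℕ) : EvData Δ r G :=
  { s with
    arr := Function.update s.arr c (seg w i (max L i))
    side := (seg w 0 i).reverse
    ρ := w.drop (max L i) }

theorem runs_shiftArr (s : EvData Δ r G) (c : Bool) (w : Stream' Bool) (L i : ℕ) :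
    (shiftArr c).Runs (s.shifted c w L i).toState (s.shifted c w L (i + 1)).toState 3 := by
  by_cases h : i < L
  · have h₁ : max L i = L := by omega
    have h₂ : max L (i + 1) = L := by omega
    refine (EvData.runs_case_arr_cons _ (b := w.get i) (l := seg w (i + 1) L)
      (by simp [EvData.shifted, h₁, seg_of_lt w h]) (EvData.runs_push_side _ _)).congr
      (congrArg EvData.toState ?_) (by omega)
    simp [EvData.shifted, h₁, h₂, seg_succ]
  · have h₁ : max L i = i := by omega
    have h₂ : max L (i + 1) = i + 1 := by omega
    have hb : (s.shifted c w L i).ρ.head = w.get i := by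
      simp [EvData.shifted, h₁]
    refine (EvData.runs_case_arr_nil _ (by simp [EvData.shifted, h₁, seg_of_le w le_rfl])
      (EvData.runs_guess _ (EvData.runs_push_side _ _))).congr
      (congrArg EvData.toState ?_) le_rfl
    rw [hb]
    simp [EvData.shifted, h₁, h₂, seg_of_le w le_rfl, seg_succ]

theorem runs_recordArr (s : EvData Δ r G) (c : Bool) (w : Stream' Bool) (L i : ℕ) :
    (recordArr c).Runs (s.shifted c w L i).toState
      { s with
        arr := Function.update s.arr c (seg w i (max L (i + 1)))
        side := (seg w 0 i).reverse
        ρ := w.drop (max L (i + 1))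
        bits := Function.update s.bits c (w.get i :: s.bits c) }.toState 4 := by
  by_cases h : i < L
  · have h₁ : max L i = L := by omega
    have h₂ : max L (i + 1) = L := by omega
    refine (EvData.runs_case_arr_peek _ (b := w.get i) (l := seg w (i + 1) L)
      (by simp [EvData.shifted, h₁, seg_of_lt w h]) (EvData.runs_push_bits _ _ _)).congr
      (congrArg EvData.toState ?_) (by omega)
    simp [EvData.shifted, h₁, h₂]
  · have h₁ : max L i = i := by omega
    have h₂ : max L (i + 1) = i + 1 := by omega
    have hb : (s.shifted c w L i).ρ.head = w.get i := by
      simp [EvData.shifted, h₁]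
    refine (EvData.runs_case_arr_nil _ (by simp [EvData.shifted, h₁, seg_of_le w le_rfl])
      (EvData.runs_guess _ ((EvData.runs_push_arr _ _ _).seq (EvData.runs_push_bits _ _ _)))).congr
      (congrArg EvData.toState ?_) le_rfl
    rw [hb]
    simp [EvData.shifted, h₁, h₂, seg_of_le w le_rfl,
      seg_of_lt w (Nat.lt_succ_self i)]

/-- Reading one label. -/
theorem runs_readLabels_cons (s : EvData Δ r G) (c : Bool) (w : Stream' Bool) (L j : ℕ)
    (l : List (DescSym r)) {s' : MState EvStk (fun _ => EvSym Δ r) G} {T : ℕ}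
    (h : (readLabels c).Runs ({ s with
      desc := l
      bits := Function.update s.bits c (w.get j :: s.bits c) }.withArr c w (max L (j + 1))).toState
      s' T) :
    (readLabels c).Runs ({ s with desc := unary j ++ l }.withArr c w L).toState s'
      (T + 8 * (unary j : List (DescSym r)).length) := by
  suffices H : ∀ d i, i + d = j → (readLabels c).Runs
      ({ s with desc := unary d ++ l }.shifted c w L i).toState s' (T + 5 * d + 3 * j + 8) by
    have := H j 0 (Nat.zero_add j)
    simp only [EvData.shifted, seg_of_le w (le_refl 0), Nat.max_zero, List.reverse_nil] at this
    exact this.mono (by simp [unary]; omega)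
  intro d
  induction d with
  | zero =>
    rintro i rfl
    have h₀ := EvData.runs_pop_desc (({ s with desc := unary 0 ++ l }).shifted c w L i)
    have h₁ := runs_recordArr { s with desc := l } c w L i
    have h₂ := EvData.runs_move_side (G := G) { s with
        arr := Function.update s.arr c (seg w i (max L (i + 1)))
        side := (seg w 0 i).reverse
        ρ := w.drop (max L (i + 1))
        bits := Function.update s.bits c (w.get i :: s.bits c)
        desc := l } c
    refine (Runs.loop (EvData.head?_desc _ rfl) rfl (h₀.seq (h₁.seq h₂))
      (Eq.mp (congrArg (fun x : EvData Δ r G => (readLabels c).Runs x.toState _ _) ?_) h)).mono ?_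
    · simp [EvData.withArr, seg_append w (Nat.zero_le i) (show i ≤ max L (i + 1) by omega)]
    · simp [length_seg]; omega
  | succ d ih =>
    intro i hi
    have h₀ := EvData.runs_pop_desc (({ s with desc := unary (d + 1) ++ l }).shifted c w L i)
    have h₁ := runs_shiftArr { s with desc := unary d ++ l } c w L i
    refine (Runs.loop (EvData.head?_desc _ rfl) rfl (h₀.seq h₁) (ih (i + 1) (by omega))).mono ?_
    omega

/-- Reading a list of labels `js`: the bits of the stream at these positions are recorded, and the
array is prolonged just as far as needed. -/
theorem runs_readLabels (c : Bool) (w : Stream' Bool) (js : List ℕ) (l : List (DescSym r)) :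
    ∀ (s : EvData Δ r G) (L : ℕ), ∃ L', L ≤ L' ∧ (∀ j ∈ js, j < L') ∧
      (∀ d, L ≤ d → (∀ j ∈ js, j < d) → L' ≤ d) ∧
      (readLabels c).Runs
        ({ s with desc := js.flatMap unary ++ DescSym.semicolon :: l }.withArr c w L).toState
        ({ s with
          desc := DescSym.semicolon :: l
          bits := Function.update s.bits c ((js.map w.get).reverse ++ s.bits c) }.withArr c w
            L').toState
        (8 * (js.flatMap unary : List (DescSym r)).length + 1) := by
  induction js with
  | nil =>
    intro s L
    refine ⟨L, le_rfl, by simp, fun d h _ => h, ?_⟩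
    have := runs_loop_exit (G := G) (c := isLabel) (B := labelBody c)
      (s := ({ s with desc := DescSym.semicolon :: l }.withArr c w L).toState) (k := EvStk.desc)
      (by rw [EvData.head?_desc _ rfl]; rintro a ⟨⟩; rfl)
    simpa [readLabels] using this
  | cons j js ih =>
    intro s L
    obtain ⟨L', h₁, h₂, h₃, h₄⟩ := ih
      { s with bits := Function.update s.bits c (w.get j :: s.bits c) } (max L (j + 1))
    refine ⟨L', by omega, ?_, ?_, ?_⟩
    · intro i hi
      rcases List.mem_cons.1 hi with rfl | hi
      · omega
      · exact h₂ i hi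
    · intro d hd hj
      have := hj j (by simp)
      exact h₃ d (by omega) fun i hi => hj i (by simp [hi])
    · have := runs_readLabels_cons s c w L j _ h₄
      simp only [List.flatMap_cons, List.append_assoc]
      refine this.congr (congrArg EvData.toState ?_) ?_
      · simp
      · simp; omega

end labels


open Mach

/-! ### Looking up truth tables -/

/-- The number with the given binary digits, least significant first. -/
def bitsVal : List Bool → ℕ
  | [] => 0
  | b :: l => b.toNat + 2 * bitsVal l

theorem bitsVal_lt (l : List Bool) : bitsVal l < 2 ^ l.length := by
  induction l with
  | nil => simp [bitsVal]
  | cons b l ih =>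
    have : b.toNat ≤ 1 := Bool.toNat_le b
    simp only [bitsVal, List.length_cons, pow_succ]
    omega

theorem testBit_bitsVal (l : List Bool) (i : ℕ) (h : i < l.length) :
    (bitsVal l).testBit i = l[i] := by
  induction l generalizing i with
  | nil => simp at h
  | cons b l ih =>
    have hb : (b.toNat + 2 * bitsVal l) / 2 = bitsVal l := by cases b <;> simp; omega
    cases i with
    | zero => cases b <;> simp [bitsVal, Nat.testBit_zero]
    | succ i =>
      rw [bitsVal, Nat.testBit_succ, hb, ih i (by simpa using h)]
      rfl

theorem bits_bitsVal {a : ℕ} (x : Fin a → Bool) : bits a (bitsVal (List.ofFn x)) = x := by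
  funext i
  rw [bits, testBit_bitsVal _ _ (by simp)]
  simp

theorem foldl_reverse_bits (l : List Bool) (v : ℕ) :
    l.reverse.foldl (fun (v : ℕ) (b : Bool) => 2 * v + b.toNat) v = v * 2 ^ l.length + bitsVal l := by
  induction l with
  | nil => simp [bitsVal]
  | cons b l ih =>
    rw [List.reverse_cons, List.foldl_append, ih]
    simp only [List.foldl_cons, List.foldl_nil, bitsVal, List.length_cons, pow_succ]
    ring

theorem getElem?_flatMap_range {α : Type} (f : ℕ → ℕ → α) (B : ℕ) (l : List ℕ) (X Y : ℕ)
    (hX : X < l.length) (hY : Y < B) :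
    (l.flatMap fun x => (List.range B).map (f x))[X * B + Y]? = some (f l[X] Y) := by
  induction l generalizing X with
  | nil => simp at hX
  | cons x l ih =>
    cases X with
    | zero =>
      rw [List.flatMap_cons, List.getElem?_append_left (by simpa using hY)]
      simp [hY]
    | succ X =>
      have e : (X + 1) * B + Y - B = X * B + Y := by
        rw [Nat.succ_mul]; omega
      rw [List.flatMap_cons, List.getElem?_append_right (by simp [Nat.succ_mul]; omega)]
      rw [List.length_map, List.length_range, e, ih X (by simpa using hX)]
      rfl

section lookup

variable {Δ : Type} {r : ℕ} {G : Type}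

theorem EvData.head?_idx_succ (s : EvData Δ r G) (n : ℕ) (h : s.idx = n + 1) :
    (s.toState.stk .idx).head? = some .one := by
  simp [EvData.toState, EvData.stk, h, List.replicate_succ]

theorem EvData.head?_idx_zero (s : EvData Δ r G) (h : s.idx = 0) :
    (s.toState.stk .idx).head? = none := by
  simp [EvData.toState, EvData.stk, h]

variable [Finite Δ]

/-- Double the counter `idx`. -/
def double : Mach EvStk (fun _ => EvSym Δ r) G :=
  seq (loop .idx (fun _ => true) fun _ => seq (pop .idx) (seq (push .tmp .one) (push .tmp .one)))
    (move .tmp .idx id)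

theorem runs_double (s : EvData Δ r G) (h : s.tmp = 0) :
    double.Runs s.toState { s with idx := 2 * s.idx }.toState (10 * s.idx + 2) := by
  have H : ∀ n (s : EvData Δ r G), s.idx = n →
      (loop (Γ := fun _ => EvSym Δ r) (G := G) EvStk.idx (fun _ => true) fun _ =>
        seq (pop .idx) (seq (push .tmp .one) (push .tmp .one))).Runs s.toState
        { s with idx := 0, tmp := s.tmp + 2 * n }.toState (4 * n + 1) := by
    intro n
    induction n with
    | zero =>
      intro s hs
      have e : { s with idx := 0, tmp := s.tmp + 2 * 0 } = s := by
        cases s; simp at hs; simp [hs]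
      rw [e]
      exact runs_loop_exit (by simp [s.head?_idx_zero hs])
    | succ n ih =>
      intro s hs
      have h₁ := s.runs_pop_idx
      have h₂ := ({ s with idx := s.idx - 1 } : EvData Δ r G).runs_push_tmp
      have h₃ := ({ s with idx := s.idx - 1, tmp := s.tmp + 1 } : EvData Δ r G).runs_push_tmp
      have h₄ := ih { s with idx := s.idx - 1, tmp := s.tmp + 1 + 1 } (by simp [hs])
      refine (Runs.loop (s.head?_idx_succ n hs) rfl (h₁.seq (h₂.seq h₃)) h₄).congr
        (congrArg EvData.toState ?_) (by omega)
      have : s.tmp + 1 + 1 + 2 * n = s.tmp + 2 * (n + 1) := by ring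
      simp [this]
  refine ((H s.idx s rfl).seq (EvData.runs_move_tmp _)).congr (congrArg EvData.toState ?_) ?_
  · simp [h]
  · simp [h]; omega

/-- Add a binary digit to the counter. -/
def addBit : EvSym Δ r → Mach EvStk (fun _ => EvSym Δ r) G
  | .bit true => push .idx .one
  | _ => skip

/-- Append recorded bits to the binary expansion of the counter. -/
def readIdx (c : Bool) : Mach EvStk (fun _ => EvSym Δ r) G :=
  loop (.bits c) (fun _ => true) fun a => seq (pop (.bits c)) (seq double (addBit a))

/-- A digit is appended by doubling the counter, which takes time proportional to its value. As the
value at least doubles whenever it is positive, the sum of these times is geometric; the summand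
`10 * s.idx` makes this an induction. -/
theorem runs_readIdx (c : Bool) (l : List Bool) : ∀ (s : EvData Δ r G), s.tmp = 0 →
    s.bits c = l → ∃ T, T + 10 * s.idx ≤ 16 * ((s.idx + 1) * 2 ^ l.length) ∧
      (readIdx c).Runs s.toState
        { s with
          bits := Function.update s.bits c []
          idx := l.foldl (fun (v : ℕ) (b : Bool) => 2 * v + b.toNat) s.idx }.toState T := by
  induction l with
  | nil =>
    intro s _ hb
    refine ⟨1, by simp; omega, ?_⟩
    have e : { s with
        bits := Function.update s.bits c []
        idx := ([] : List Bool).foldl (fun (v : ℕ) (b : Bool) => 2 * v + b.toNat) s.idx } = s := by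
      have : Function.update s.bits c [] = s.bits := by rw [← hb, Function.update_eq_self]
      rw [this]; rfl
    rw [e]
    exact runs_loop_exit (by simp [EvData.toState, EvData.stk, hb])
  | cons b l ih =>
    intro s ht hb
    have h₁ := s.runs_pop_bits c
    rw [hb, List.tail_cons] at h₁
    have h₂ := runs_double { s with bits := Function.update s.bits c l } ht
    obtain ⟨T, hT, h₄⟩ := ih
      { s with bits := Function.update s.bits c l, idx := 2 * s.idx + b.toNat } ht (by simp)
    have hhd : (s.toState.stk (.bits c)).head? = some (.bit b) := by
      simp [EvData.toState, EvData.stk, hb]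
    have hpow : 16 * ((s.idx + 1) * 2 ^ (b :: l).length) =
        32 * (s.idx * 2 ^ l.length) + 32 * 2 ^ l.length := by
      rw [List.length_cons, pow_succ]; ring
    have hpos : 1 ≤ 2 ^ l.length := Nat.one_le_two_pow
    have h₃ : (addBit (.bit b)).Runs
        { s with bits := Function.update s.bits c l, idx := 2 * s.idx }.toState
        { s with bits := Function.update s.bits c l, idx := 2 * s.idx + b.toNat }.toState
        b.toNat := by
      cases b
      · exact runs_skip _
      · exact EvData.runs_push_idx _
    have hT' : 16 * ((2 * s.idx + b.toNat + 1) * 2 ^ l.length) =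
        32 * (s.idx * 2 ^ l.length) + 16 * b.toNat * 2 ^ l.length + 16 * 2 ^ l.length := by ring
    simp only at hT
    refine ⟨1 + (10 * s.idx + 2 + b.toNat) + T + 1, ?_,
      (Runs.loop hhd rfl (h₁.seq (h₂.seq h₃)) h₄).congr (congrArg EvData.toState ?_) le_rfl⟩
    · rw [hpow]
      rw [hT'] at hT
      cases b <;> simp at hT ⊢ <;> omega
    · simp

/-- Impose the degree with the given name. -/
noncomputable def weigh (D : Fin r → I) : Option (EvSym Δ r) → Mach EvStk (fun _ => EvSym Δ r) G
  | some (.desc (.deg i)) => prim (.eff (D i) none ())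
  | _ => skip

/-- The names of degrees. -/
def isDeg : EvSym Δ r → Bool
  | .desc (.deg _) => true
  | _ => false

/-- Impose the degree found in the truth table, and go to the end of the description of the gate. -/
noncomputable def lookup (D : Fin r → I) : Mach EvStk (fun _ => EvSym Δ r) G :=
  seq (readIdx false) (seq (readIdx true)
    (seq (loop .idx (fun _ => true) fun _ => seq (pop .idx) (pop .desc))
      (seq (case .desc true (weigh D)) (seq (loop .desc isDeg fun _ => pop .desc) (pop .desc)))))

theorem runs_skipTable (n : ℕ) : ∀ s : EvData Δ r G, s.idx = n →
    (loop (Γ := fun _ => EvSym Δ r) (G := G) EvStk.idx (fun _ => true) fun _ =>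
      seq (pop .idx) (pop .desc)).Runs s.toState
      { s with idx := 0, desc := s.desc.drop n }.toState (3 * n + 1) := by
  induction n with
  | zero =>
    intro s hs
    have e : { s with idx := 0, desc := s.desc.drop 0 } = s := by
      cases s; simp at hs; simp [hs]
    rw [e]
    exact runs_loop_exit (by simp [s.head?_idx_zero hs])
  | succ n ih =>
    intro s hs
    have h₁ := s.runs_pop_idx
    have h₂ := ({ s with idx := s.idx - 1 } : EvData Δ r G).runs_pop_desc
    have h₄ := ih { s with idx := s.idx - 1, desc := s.desc.tail } (by simp [hs])
    refine (Runs.loop (s.head?_idx_succ n hs) rfl (h₁.seq h₂) h₄).congr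
      (congrArg EvData.toState ?_) (by omega)
    simp

theorem runs_skipDegs (t : List (Fin r)) (a : DescSym r) (l : List (DescSym r))
    (ha : isDeg (.desc a : EvSym Δ r) = false) : ∀ s : EvData Δ r G,
    s.desc = t.map .deg ++ a :: l →
    (loop (Γ := fun _ => EvSym Δ r) (G := G) EvStk.desc isDeg fun _ => pop .desc).Runs s.toState
      { s with desc := a :: l }.toState (2 * t.length + 1) := by
  induction t with
  | nil =>
    intro s hs
    have e : { s with desc := a :: l } = s := by
      have : s.desc = a :: l := hs
      rw [← this]
    rw [e]
    refine runs_loop_exit fun b hb => ?_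
    rw [s.head?_desc hs] at hb
    cases hb
    exact ha
  | cons i t ih =>
    intro s hs
    have h₁ := s.runs_pop_desc
    have h₂ := ih { s with desc := s.desc.tail } (by simp [hs])
    exact (Runs.loop (s.head?_desc hs) rfl h₁ h₂).mono (by simp; omega)

theorem EvData.runs_case_desc (s : EvData Δ r G) {a : DescSym r} {l : List (DescSym r)}
    (h : s.desc = a :: l) {B : Option (EvSym Δ r) → Mach EvStk (fun _ => EvSym Δ r) G} {s' T}
    (hB : (B (some (.desc a))).Runs { s with desc := l }.toState s' T) :
    (case .desc true B).Runs s.toState s' (T + 1) := by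
  refine Runs.case ?_
  rw [s.head?_desc h, if_pos rfl]
  have e := s.tail_desc
  rw [h, List.tail_cons] at e
  simp only [EvData.toState, e]
  exact hB

/-- The table entry with index `N` is looked up, where `N` has as binary digits the recorded
bits, the values `ys` of the output variables being the less significant ones. -/
theorem runs_lookup (D : Fin r → I) (s : EvData Δ r G) (xs ys : List Bool) (t : List (Fin r))
    (l : List (DescSym r)) (i : Fin r) (ht : t.length = 2 ^ xs.length * 2 ^ ys.length)
    (hi : t[bitsVal xs * 2 ^ ys.length + bitsVal ys]? = some i)
    (htmp : s.tmp = 0) (hidx : s.idx = 0)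
    (hx : s.bits false = xs.reverse) (hy : s.bits true = ys.reverse)
    (hd : s.desc = t.map DescSym.deg ++ DescSym.endGate :: l) :
    (lookup D).Runs s.toState
      { s with bits := fun _ => [], desc := l, wt := min s.wt (D i) }.toState
      (40 * t.length + 10) := by
  obtain ⟨T₁, hT₁, h₁⟩ := runs_readIdx false _ s htmp hx
  obtain ⟨T₂, hT₂, h₂⟩ := runs_readIdx true ys.reverse
    { s with bits := Function.update s.bits false [], idx := bitsVal xs } htmp (by simpa using hy)
  rw [hidx, foldl_reverse_bits, zero_mul, zero_add] at h₁
  simp only [foldl_reverse_bits] at h₂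
  generalize hN : bitsVal xs * 2 ^ ys.length + bitsVal ys = N at h₂ hi
  obtain ⟨hNt, hi'⟩ := List.getElem?_eq_some_iff.1 hi
  have hu : Function.update (Function.update s.bits false []) true [] = fun _ => [] := by
    funext b; cases b <;> simp
  rw [hu] at h₂
  have h₃ := runs_skipTable N { s with bits := fun _ => [], idx := N } rfl
  have hdrop : s.desc.drop N =
      .deg i :: ((t.drop (N + 1)).map DescSym.deg ++ DescSym.endGate :: l) := by
    rw [hd, List.drop_append_of_le_length (by simp; omega), ← List.map_drop,
      List.drop_eq_getElem_cons hNt, hi']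
    rfl
  simp only [hdrop] at h₃
  have h₄ : (weigh D (some (EvSym.desc (.deg i)))).Runs (G := G)
      ({ s with bits := fun _ => [], idx := 0,
                desc := (t.drop (N + 1)).map DescSym.deg ++ DescSym.endGate :: l } :
        EvData Δ r G).toState
      ({ s with bits := fun _ => [], idx := 0, wt := min s.wt (D i),
                desc := (t.drop (N + 1)).map DescSym.deg ++ DescSym.endGate :: l } :
        EvData Δ r G).toState 1 := by
    refine (runs_prim _ _).congr ?_ le_rfl
    simp [Op.exec, EvData.toState]
    rfl
  have h₅ := runs_skipDegs (G := G) (Δ := Δ) (t.drop (N + 1)) .endGate l rfl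
    { s with bits := fun _ => [], idx := 0, wt := min s.wt (D i),
             desc := (t.drop (N + 1)).map DescSym.deg ++ DescSym.endGate :: l } rfl
  have h₆ := EvData.runs_pop_desc (G := G) (Δ := Δ)
    { s with bits := fun _ => [], idx := 0, wt := min s.wt (D i),
             desc := DescSym.endGate :: l }
  refine (h₁.seq (h₂.seq (h₃.seq ((EvData.runs_case_desc _ rfl h₄).seq (h₅.seq h₆))))).congr
    (congrArg EvData.toState ?_) ?_
  · simp [hidx]
  · have hX := bitsVal_lt xs
    have hl : (t.drop (N + 1)).length ≤ t.length := by simp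
    have hb : (bitsVal xs + 1) * 2 ^ ys.length ≤ t.length := by
      rw [ht]; exact Nat.mul_le_mul_right _ hX
    have hp : 2 ^ xs.length ≤ t.length := by
      rw [ht]; exact Nat.le_mul_of_pos_right _ (by positivity)
    simp only [List.length_reverse] at hT₁ hT₂
    rw [hidx] at hT₁
    omega

end lookup


open Mach

/-! ### Evaluating circuits along a sequence of bits -/

section evaluate

variable {Δ : Type} [Finite Δ] {r : ℕ} {G : Type}

theorem getElem?_append_stream (l : List Bool) (w : Stream' Bool) {j : ℕ} (h : j < l.length) :
    (l ++ₛ w).get j = l[j] := by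
  induction l generalizing j with
  | nil => simp at h
  | cons b l ih =>
    cases j with
    | zero => rfl
    | succ j => exact ih (by simpa using h)

theorem seg_append_stream (l : List Bool) (w : Stream' Bool) :
    seg (l ++ₛ w) 0 l.length = l := by
  refine List.ext_getElem (by simp [seg]) fun i h h' => ?_
  simp [seg, getElem?_append_stream l w h']

theorem seg_eq_ofFn (w : Stream' Bool) (d : ℕ) : seg w 0 d = List.ofFn fun j : Fin d => w.get j := by
  refine List.ext_getElem (by simp [seg]) fun i h h' => ?_
  simp [seg]

/-- The data of the evaluator between two gates: the values `v` of the variables of the preceding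
level, and the first `L` values of the variables of the new level, the values being taken from the
stream `w`. -/
def EvData.level (s : EvData Δ r G) (v : List Bool) (w : Stream' Bool) (L : ℕ)
    (l : List (DescSym r)) : EvData Δ r G :=
  { s with
    arr := fun c => cond c (seg w 0 L) v
    bits := fun _ => []
    side := []
    idx := 0
    tmp := 0
    desc := l
    ρ := w.drop L }

/-- Process the description of a gate. -/
noncomputable def evalGate (D : Fin r → I) : Mach EvStk (fun _ => EvSym Δ r) G :=
  seq (readLabels false) (seq (pop .desc) (seq (readLabels true) (seq (pop .desc) (lookup D))))

/-- The truth table of a gate. -/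
def Gate.table {c d : ℕ} (g : Gate (Fin r) c d) : List (Fin r) :=
  (List.range (2 ^ g.a)).flatMap fun x =>
    (List.range (2 ^ g.b)).map fun y => g.fn (bits g.a x) (bits g.b y)

theorem Gate.length_table {c d : ℕ} (g : Gate (Fin r) c d) :
    g.table.length = 2 ^ g.a * 2 ^ g.b := by
  simp [Gate.table, List.length_flatMap]

theorem Gate.describe_eq {c d : ℕ} (g : Gate (Fin r) c d) (l : List (DescSym r)) :
    g.describe ++ l = (List.ofFn fun i => (g.inVar i : ℕ)).flatMap unary ++ DescSym.semicolon ::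
      ((List.ofFn fun i => (g.outVar i : ℕ)).flatMap unary ++ DescSym.semicolon ::
        (g.table.map DescSym.deg ++ DescSym.endGate :: l)) := by
  simp [Gate.describe, Gate.table, List.flatMap_def, List.map_ofFn, List.map_flatten,
    Function.comp_def]

/-- The degree that a gate gives to the values `w` of the output variables. -/
def Gate.value {K : Type} {c d : ℕ} (g : Gate K c d) (v : Fin c → Bool) (w : ℕ → Bool) : K :=
  g.fn (fun i => v (g.inVar i)) fun j => w (g.outVar j)

/-- The values of the output variables are the next bits of the stream `w`. Those before position `L`
have already been taken from the stream by previous gates; the gate takes what is missing up to its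
last output variable, and imposes the degree found in its truth table. -/
theorem runs_evalGate (D : Fin r → I) {c d : ℕ} (g : Gate (Fin r) c d) (s : EvData Δ r G)
    (v : Fin c → Bool) (w : Stream' Bool) (L : ℕ) (hL : L ≤ d) (l : List (DescSym r)) :
    ∃ L', L ≤ L' ∧ L' ≤ d ∧ (∀ j, (g.outVar j : ℕ) < L') ∧
      (evalGate D).Runs (s.level (List.ofFn v) w L (g.describe ++ l)).toState
        ({ s with wt := min s.wt (D (g.value v w.get)) }.level (List.ofFn v) w L' l).toState
        (40 * g.describe.length) := by
  have hdl : g.describe.length = ((List.ofFn fun i => (g.inVar i : ℕ)).flatMap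
      (unary (r := r))).length + 1 + (((List.ofFn fun i => (g.outVar i : ℕ)).flatMap
      (unary (r := r))).length + 1 + (g.table.length + 1)) := by
    have := congrArg List.length (g.describe_eq [])
    simp only [List.append_nil] at this
    rw [this]
    simp only [List.length_append, List.length_cons, List.length_map, List.length_nil]
    omega
  rw [g.describe_eq l]
  generalize hlb : g.table.map DescSym.deg ++ DescSym.endGate :: l = lb
  generalize hla : (List.ofFn fun i => (g.outVar i : ℕ)).flatMap unary ++
    DescSym.semicolon :: lb = la
  -- the input labels
  obtain ⟨L₁, hL₁, -, hL₁', h₁⟩ := runs_readLabels (Δ := Δ) (G := G) false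
    (List.ofFn v ++ₛ w.drop L) (List.ofFn fun i => (g.inVar i : ℕ)) la
    (s.level (List.ofFn v) w L la) c
  obtain rfl : L₁ = c := le_antisymm (hL₁' c le_rfl (by simp)) hL₁
  have hseg : seg (List.ofFn v ++ₛ w.drop L) 0 L₁ = List.ofFn v := by
    have := seg_append_stream (List.ofFn v) (w.drop L)
    rwa [List.length_ofFn] at this
  have hdrop : (List.ofFn v ++ₛ w.drop L).drop L₁ = w.drop L := by
    have := Stream'.drop_append_stream (List.ofFn v) (w.drop L)
    rwa [List.length_ofFn] at this
  have hget : (List.ofFn fun i => (g.inVar i : ℕ)).map (List.ofFn v ++ₛ w.drop L).get =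
      List.ofFn fun i => v (g.inVar i) := by
    rw [List.map_ofFn]
    congr 1
    funext i
    simp [getElem?_append_stream]
  rw [hget] at h₁
  have e₁ : ∀ l', ({ s.level (List.ofFn v) w L la with desc := l' } : EvData Δ r G).withArr false
      (List.ofFn v ++ₛ w.drop L) L₁ = s.level (List.ofFn v) w L l' := by
    intro l'
    simp only [EvData.withArr, EvData.level, hseg, hdrop, EvData.mk.injEq, and_true, true_and]
    funext b; cases b <;> simp
  have e₁' : ∀ B l', ({ s.level (List.ofFn v) w L la with desc := l', bits := B } :
      EvData Δ r G).withArr false (List.ofFn v ++ₛ w.drop L) L₁ =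
        { s.level (List.ofFn v) w L l' with bits := B } := by
    intro B l'
    simp only [EvData.withArr, EvData.level, hseg, hdrop, EvData.mk.injEq, and_true, true_and]
    funext b; cases b <;> simp
  rw [e₁, e₁'] at h₁
  -- the output labels
  obtain ⟨L₂, hL₂, hL₂', hL₂'', h₂⟩ := runs_readLabels (Δ := Δ) (G := G) true w
    (List.ofFn fun i => (g.outVar i : ℕ)) lb
    { s.level (List.ofFn v) w L la with
      bits := Function.update (fun _ => []) false
        ((List.ofFn fun i => v (g.inVar i)).reverse ++ []) } L
  have e₂ : ∀ B L' l', ({ s.level (List.ofFn v) w L la with bits := B, desc := l' } :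
      EvData Δ r G).withArr true w L' = { s.level (List.ofFn v) w L' l' with bits := B } := by
    intro B L' l'
    simp only [EvData.withArr, EvData.level, EvData.mk.injEq, and_true, true_and]
    funext b; cases b <;> simp
  have hp₁ := EvData.runs_pop_desc
    { s.level (List.ofFn v) w L (DescSym.semicolon :: la) with
      bits := Function.update (fun _ => []) false
        ((List.ofFn fun i => v (g.inVar i)).reverse ++ []) }
  rw [e₂, e₂, hla] at h₂
  have hp₂ := EvData.runs_pop_desc
    { s.level (List.ofFn v) w L₂ (DescSym.semicolon :: lb) with
      bits := Function.update (Function.update (fun _ => []) false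
        ((List.ofFn fun i => v (g.inVar i)).reverse ++ [])) true
        (((List.ofFn fun i => (g.outVar i : ℕ)).map w.get).reverse ++ []) }
  have h₃ := runs_lookup D
    { s.level (List.ofFn v) w L₂ lb with
      bits := Function.update (Function.update (fun _ => []) false
        ((List.ofFn fun i => v (g.inVar i)).reverse ++ [])) true
        (((List.ofFn fun i => (g.outVar i : ℕ)).map w.get).reverse ++ []) }
    (List.ofFn fun i => v (g.inVar i)) (List.ofFn fun i => w.get (g.outVar i)) g.table l
    (g.value v w.get) (by simp [g.length_table]) (by
      rw [Gate.table, List.length_ofFn, getElem?_flatMap_range (fun x y => g.fn (bits g.a x) (bits g.b y))]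
      · simp only [Gate.value]
        rw [List.getElem_range, bits_bitsVal, bits_bitsVal]
      · have := bitsVal_lt (List.ofFn fun i => v (g.inVar i))
        simpa using this
      · have := bitsVal_lt (List.ofFn fun i => w.get (g.outVar i))
        simpa using this) rfl rfl (by simp) (by simp [List.map_ofFn, Function.comp_def])
    (by simp [EvData.level, hlb])
  refine ⟨L₂, hL₂, hL₂'' d hL (by simp), fun j => hL₂' _ (by simp), ?_⟩
  refine (h₁.seq (hp₁.seq (Runs.seq (Runs.congr h₂ rfl le_rfl) (hp₂.seq h₃)))).congr ?_ ?_
  · rfl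
  · omega

/-- Pass on to the next level. -/
def nextLevel : Mach EvStk (fun _ => EvSym Δ r) G :=
  seq (pop .desc) (seq (clear (.arr false))
    (seq (move (.arr true) .side id) (move .side (.arr false) id)))

theorem runs_nextLevel (s : EvData Δ r G) (v : List Bool) (w : Stream' Bool) (L : ℕ)
    (l : List (DescSym r)) :
    nextLevel.Runs (s.level v w L (DescSym.endLevel :: l)).toState
      (s.level (seg w 0 L) (w.drop L) 0 l).toState (2 * v.length + 6 * L + 4) := by
  have h₁ := (s.level v w L (DescSym.endLevel :: l)).runs_pop_desc
  have h₂ := (s.level v w L l).runs_clear_arr false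
  have h₃ := ({ s.level v w L l with
    arr := Function.update (s.level v w L l).arr false [] } : EvData Δ r G).runs_move_arr true
  have h₄ := ({ s.level v w L l with
    side := (seg w 0 L).reverse, arr := fun _ => [] } : EvData Δ r G).runs_move_side false
  refine (h₁.seq (h₂.seq (Runs.seq (h₃.congr (congrArg EvData.toState ?_) le_rfl) h₄))).congr
    (congrArg EvData.toState ?_) ?_
  · simp only [EvData.level, EvData.mk.injEq, and_true, true_and]
    refine ⟨?_, by simp⟩
    funext b; cases b <;> simp
  · simp only [EvData.level, EvData.mk.injEq, and_true, true_and]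
    refine ⟨?_, by simp [Stream'.drop_drop]⟩
    funext b; cases b <;> simp [seg_of_le]
  · simp [EvData.level, length_seg]; omega

/-- Process the description of a gate, or pass on to the next level, depending on the next symbol
of the description. -/
noncomputable def evalBody (D : Fin r → I) : EvSym Δ r → Mach EvStk (fun _ => EvSym Δ r) G
  | .desc .endLevel => nextLevel
  | _ => evalGate D

theorem evalBody_of_ne (D : Fin r → I) {a : DescSym r} (h : a ≠ .endLevel) :
    evalBody D (.desc a : EvSym Δ r) = evalGate (G := G) D := by
  cases a <;> first | rfl | exact absurd rfl h

/-- Evaluate a circuit, given by its description. -/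
noncomputable def evalLevels (D : Fin r → I) : Mach EvStk (fun _ => EvSym Δ r) G :=
  loop .desc (fun _ => true) (evalBody D)

theorem runs_evalLevels_cons (D : Fin r → I) (s : EvData Δ r G) {a : DescSym r}
    {l : List (DescSym r)} {s' s'' : MState EvStk (fun _ => EvSym Δ r) G} {T T' : ℕ}
    (h : s.desc = a :: l) (hB : (evalBody D (.desc a)).Runs s.toState s' T)
    (h' : (evalLevels D).Runs s' s'' T') : (evalLevels D).Runs s.toState s'' (T + T' + 1) :=
  Runs.loop (Γ := fun _ => EvSym Δ r) (s.head?_desc h) rfl hB h'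

theorem Gate.exists_describe_cons {c d : ℕ} (g : Gate (Fin r) c d) :
    ∃ a l, a ≠ DescSym.endLevel ∧ g.describe = a :: l := by
  have h := g.describe_eq []
  rw [List.append_nil] at h
  rw [h]
  cases (List.ofFn fun i => (g.inVar i : ℕ)) with
  | nil => exact ⟨_, _, by simp, rfl⟩
  | cons j js =>
    cases j with
    | zero => exact ⟨.comma, _, by simp, rfl⟩
    | succ j => exact ⟨.one, _, by simp, by simp [unary, List.replicate_succ]; rfl⟩

/-- The degrees of a list of gates are imposed one after the other. -/
def gatesValue (D : Fin r → I) {c d : ℕ} (gs : List (Gate (Fin r) c d)) (v : Fin c → Bool)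
    (w : ℕ → Bool) (u : I) : I :=
  gs.foldl (fun u g => min u (D (g.value v w))) u

theorem runs_evalLevels_gates (D : Fin r → I) {c d : ℕ} (v : Fin c → Bool) (w : Stream' Bool)
    (l : List (DescSym r)) {s' : MState EvStk (fun _ => EvSym Δ r) G} {T : ℕ}
    (gs : List (Gate (Fin r) c d)) : ∀ (s : EvData Δ r G) (L : ℕ), L ≤ d →
    (∀ L', L ≤ L' → L' ≤ d → (∀ g ∈ gs, ∀ j, (g.outVar j : ℕ) < L') → (evalLevels D).Runs
      ({ s with wt := gatesValue D gs v w.get s.wt }.level (List.ofFn v) w L' l).toState s' T) →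
    (evalLevels D).Runs (s.level (List.ofFn v) w L (gs.flatMap Gate.describe ++ l)).toState s'
      (T + 41 * (gs.flatMap Gate.describe).length) := by
  induction gs with
  | nil => intro s L hL h; simpa [gatesValue] using h L le_rfl hL (by simp)
  | cons g gs ih =>
    intro s L hL h
    obtain ⟨L₁, hL₁, hL₁', hg, h₁⟩ := runs_evalGate D g s v w L hL (gs.flatMap Gate.describe ++ l)
    have h₂ := ih { s with wt := min s.wt (D (g.value v w.get)) } L₁ hL₁' fun L' h' h'' hgs =>
      h L' (by omega) h'' (by
        intro g' hg' j
        rcases List.mem_cons.1 hg' with rfl | hg'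
        · exact (hg j).trans_le h'
        · exact hgs g' hg' j)
    obtain ⟨a, l', ha, e⟩ := g.exists_describe_cons
    rw [List.flatMap_cons, List.append_assoc]
    refine (runs_evalLevels_cons D _ (a := a) (l := l' ++ (gs.flatMap Gate.describe ++ l))
      (by simp [EvData.level, e]) ?_ h₂).mono ?_ (T := 40 * g.describe.length +
      (T + 41 * (gs.flatMap Gate.describe).length) + 1)
    · rw [evalBody_of_ne D ha]
      exact h₁
    · simp only [List.length_append, e, List.length_cons]; omega

/-- Each variable of a level is an output variable of some gate, hence its label occurs in the
description. -/
theorem Level.out_lt {c d : ℕ} (L : Level (Fin r) c d) :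
    d ≤ ((List.ofFn L.gate).flatMap Gate.describe).length := by
  have h₁ : d = ∑ k, (L.gate k).b := by
    have hb : Function.Bijective fun o : (Σ k, Fin (L.gate k).b) => (L.gate o.1).outVar o.2 := by
      refine ⟨fun o o' h => ?_, fun j => (L.existsUnique_out j).exists⟩
      exact (L.existsUnique_out _).unique h rfl
    have := Fintype.card_of_bijective hb
    simpa using this.symm
  rw [List.length_flatMap, List.map_ofFn, List.sum_ofFn]
  conv_lhs => rw [h₁]
  refine Finset.sum_le_sum fun k _ => ?_
  have := congrArg List.length ((L.gate k).describe_eq [])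
  simp only [List.append_nil] at this
  have h₃ : (L.gate k).b ≤ ((List.ofFn fun i => ((L.gate k).outVar i : ℕ)).flatMap
      (unary (r := r))).length := by
    rw [List.length_flatMap, List.map_ofFn, List.sum_ofFn]
    refine le_trans (by simp) (Finset.sum_le_sum (f := fun _ : Fin (L.gate k).b => 1)
      fun i _ => ?_)
    simp [unary]
  simp only [Function.comp_apply, this, List.length_append, List.length_cons]
  omega

/-- The values of the output variables of a circuit, the rest of the stream, and the degree, when
the values of the variables of the new levels are read off from a stream. -/
def Circuit.run {n : ℕ} (D : Fin r → I) : {d : ℕ} → Circuit (Fin r) n d → (Fin n → Bool) →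
    Stream' Bool → I → (Fin d → Bool) × Stream' Bool × I
  | _, .input, v, ρ, u => (v, ρ, u)
  | _, .layer (d := d) C L, v, ρ, u =>
    let x := C.run D v ρ u
    (fun j => x.2.1.get j, x.2.1.drop d, gatesValue D (List.ofFn L.gate) x.1 x.2.1.get x.2.2)

/-- The evaluation of the levels of `C` in front of the remaining description `l`. -/
theorem runs_evalLevels (D : Fin r → I) {n d : ℕ} (C : Circuit (Fin r) n d) (s : EvData Δ r G)
    (v : Fin n → Bool) (ρ : Stream' Bool) :
    ∀ (l : List (DescSym r)) {s' : MState EvStk (fun _ => EvSym Δ r) G} {T : ℕ},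
    (evalLevels D).Runs
      ({ s with wt := (C.run D v ρ s.wt).2.2 }.level (List.ofFn (C.run D v ρ s.wt).1)
        (C.run D v ρ s.wt).2.1 0 l).toState s' (T + 2 * d) →
    (evalLevels D).Runs (s.level (List.ofFn v) ρ 0 (C.describe ++ l)).toState s'
      (T + 60 * C.describe.length + 2 * n) := by
  induction C with
  | input =>
    intro l s' T h
    exact h.mono (by simp [Circuit.describe])
  | @layer c d C L ih =>
    intro l s' T h
    have hd := L.out_lt
    have e : (List.ofFn fun k => (L.gate k).describe).flatten =
        (List.ofFn L.gate).flatMap Gate.describe := by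
      simp [List.flatMap_def, List.map_ofFn, Function.comp_def]
    rw [Circuit.describe, e, List.append_assoc, List.append_assoc]
    refine (ih _ (T := T + 60 * (((List.ofFn L.gate).flatMap Gate.describe).length + 1))
      ?_).mono (by simp only [List.length_append, List.length_cons, List.length_nil]; omega)
    refine (runs_evalLevels_gates D (C.run D v ρ s.wt).1 (C.run D v ρ s.wt).2.1
      ([DescSym.endLevel] ++ l) (List.ofFn L.gate) (T := 2 * c + 6 * d + 4 + (T + 2 * d) + 1)
      { s with wt := (C.run D v ρ s.wt).2.2 } 0 (Nat.zero_le _) ?_).mono (by omega)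
    intro L' _ hL' hout
    obtain rfl : L' = d := by
      refine le_antisymm hL' (not_lt.1 fun hlt => ?_)
      obtain ⟨⟨k, i⟩, hk, -⟩ := L.existsUnique_out ⟨L', hlt⟩
      have := hout (L.gate k) (by simp) i
      rw [hk] at this
      exact lt_irrefl _ this
    have h₁ := runs_nextLevel { s with
        wt := gatesValue D (List.ofFn L.gate) (C.run D v ρ s.wt).1 (C.run D v ρ s.wt).2.1.get
          (C.run D v ρ s.wt).2.2 }
      (List.ofFn (C.run D v ρ s.wt).1) (C.run D v ρ s.wt).2.1 L' l
    rw [List.length_ofFn] at h₁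
    refine runs_evalLevels_cons D _ (a := .endLevel) (l := l) rfl h₁ ?_
    rw [seg_eq_ofFn]
    exact h

end evaluate


/-! ### Circuits as sets of evaluations -/

section circuits

variable {r : ℕ} (D : Fin r → I)

theorem gatesValue_eq {c d : ℕ} (gs : List (Gate (Fin r) c d)) (v : Fin c → Bool) (w : ℕ → Bool)
    (u : I) : gatesValue D gs v w u = min u (gatesValue D gs v w 1) := by
  induction gs generalizing u with
  | nil => simp [gatesValue, unitInterval.le_one']
  | cons g gs ih =>
    change gatesValue D gs v w _ = min u (gatesValue D gs v w _)
    rw [ih, ih (min 1 _), ← min_assoc, ← min_assoc, min_eq_left (unitInterval.le_one' : u ≤ 1)]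

theorem gatesValue_ofFn {N c d : ℕ} (g : Fin N → Gate (Fin r) c d) (v : Fin c → Bool)
    (w : ℕ → Bool) : gatesValue D (List.ofFn g) v w 1 = ⨅ k, D ((g k).value v w) := by
  induction N with
  | zero => simp [gatesValue, iInf_of_empty]; rfl
  | succ N ih =>
    rw [List.ofFn_succ]
    change gatesValue D _ v w (min 1 _) = _
    rw [gatesValue_eq, ih, min_eq_right unitInterval.le_one']
    refine le_antisymm (le_iInf fun k => ?_) (le_min (iInf_le _ 0) (le_iInf fun k => iInf_le _ k.succ))
    refine Fin.cases (min_le_left _ _) (fun k => (min_le_right _ _).trans (iInf_le _ k)) k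

theorem gatesValue_congr {c d : ℕ} (gs : List (Gate (Fin r) c d)) (v : Fin c → Bool)
    {w w' : ℕ → Bool} (h : ∀ j : Fin d, w j = w' j) (u : I) :
    gatesValue D gs v w u = gatesValue D gs v w' u := by
  unfold gatesValue
  congr 1
  funext u g
  simp only [Gate.value, h]

/-- The part of the stream that is not used by an evaluation is arbitrary. -/
theorem Circuit.run_stream {n d : ℕ} (C : Circuit (Fin r) n d) (v : Fin n → Bool)
    (ρ : Stream' Bool) (u : I) : ∀ ρ' : Stream' Bool,
    ∃ ρ₀, C.run D v ρ₀ u = ((C.run D v ρ u).1, ρ', (C.run D v ρ u).2.2) := by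
  induction C with
  | input => exact fun ρ' => ⟨ρ', rfl⟩
  | @layer c d C L ih =>
    intro ρ'
    set x := C.run D v ρ u with hx
    obtain ⟨ρ₀, h₀⟩ := ih ((List.ofFn fun j : Fin d => x.2.1.get j) ++ₛ ρ')
    have hget : ∀ j : Fin d, ((List.ofFn fun j : Fin d => x.2.1.get j) ++ₛ ρ').get j =
        x.2.1.get j := fun j => by
      rw [getElem?_append_stream _ _ (by simp)]; simp
    refine ⟨ρ₀, ?_⟩
    simp only [Circuit.run, h₀, ← hx, Prod.mk.injEq]
    refine ⟨funext hget, ?_, gatesValue_congr D _ _ hget _⟩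
    have := Stream'.drop_append_stream (List.ofFn fun j : Fin d => x.2.1.get j) ρ'
    rwa [List.length_ofFn] at this

/-- The outcome of a circuit is the supremum of the degrees of its evaluations. -/
theorem Circuit.eval_le_iff {n d : ℕ} (C : Circuit (Fin r) n d) (s : FuzzySet (Fin n → Bool)) :
    ∀ (w : Fin d → Bool) (u : I), (C.map D).eval s w ≤ u ↔
      ∀ v ρ, (C.run D v ρ 1).1 = w → min (s v) (C.run D v ρ 1).2.2 ≤ u := by
  induction C with
  | input =>
    intro w u
    simp only [Circuit.map, Circuit.eval, Circuit.run]
    refine ⟨fun h v ρ hv => ?_, fun h => ?_⟩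
    · subst hv; exact (min_le_left _ _).trans h
    · have := h w (Stream'.const true) rfl
      rwa [min_eq_left unitInterval.le_one'] at this
  | @layer c d C L ih =>
    intro w u
    let W : ℕ → Bool := fun j => if h : j < d then w ⟨j, h⟩ else true
    have hW : ∀ j : Fin d, W j = w j := fun j => by simp [W]
    have hval : ∀ v : Fin c → Bool, (⨅ k : Fin L.numGates, mu1 ((C.map D).eval s v)
        (D ((L.gate k).fn (fun i => v ((L.gate k).inVar i))
          (fun j => w ((L.gate k).outVar j))))) =
        min ((C.map D).eval s v) (gatesValue D (List.ofFn L.gate) v W 1) := by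
      intro v
      have : Nonempty (Fin L.numGates) := ⟨⟨0, L.numGates_pos⟩⟩
      simp only [gatesValue_ofFn, mu1, Gate.value, hW]
      exact inf_iInf.symm
    have key : ((C.layer L).map D).eval s w ≤ u ↔
        ∀ v, min ((C.map D).eval s v) (gatesValue D (List.ofFn L.gate) v W 1) ≤ u := by
      refine iSup_le_iff.trans ⟨fun h v => ?_, fun h v => (hval v.1).trans_le (h v.1)⟩
      by_cases hv : 0 < (C.map D).eval s v
      · exact (hval v).symm.trans_le (h ⟨v, hv⟩)
      · rw [le_antisymm (not_lt.1 hv) unitInterval.nonneg']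
        exact (min_le_left _ _).trans unitInterval.nonneg'
    rw [key]
    have h₂ : ∀ v, min ((C.map D).eval s v) (gatesValue D (List.ofFn L.gate) v W 1) ≤ u ↔
        ∀ v₀ ρ, (C.run D v₀ ρ 1).1 = v →
          min (min (s v₀) (C.run D v₀ ρ 1).2.2) (gatesValue D (List.ofFn L.gate) v W 1) ≤ u := by
      intro v
      refine (le_himp_iff (a := (C.map D).eval s v)).symm.trans ((ih v _).trans ?_)
      exact forall₃_congr fun v₀ ρ _ => le_himp_iff
    simp only [h₂]
    constructor
    · intro h v₀ ρ hw
      simp only [Circuit.run] at hw ⊢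
      have := h _ v₀ ρ rfl
      rw [gatesValue_eq, ← min_assoc]
      refine le_trans (le_of_eq ?_) this
      congr 1
      exact gatesValue_congr D _ _ (fun j => by rw [hW, ← hw]) _
    · rintro h v v₀ ρ rfl
      obtain ⟨ρ₀, hρ⟩ := C.run_stream D v₀ ρ 1 W
      have := h v₀ ρ₀ (by
        simp only [Circuit.run, hρ]
        funext j
        exact hW j)
      simp only [Circuit.run, hρ] at this
      rw [gatesValue_eq, ← min_assoc] at this
      exact this

end circuits

/-! ### Codes of strings -/

section codes

variable {A : Type} {k : ℕ} (e : A ≃ Fin k)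

/-- The bits of the code of a string that belong to one position. -/
def codeSym (o : Option A) : List Bool := List.ofFn fun j : Fin k => o.map e == some j

theorem ofFn_encode (n : ℕ) (x : List A) :
    List.ofFn (encode e n x) = (List.range n).flatMap fun i => codeSym e x[i]? := by
  rw [List.ofFn_mul, List.flatMap_def, ← List.map_coe_finRange_eq_range, List.map_map, ← List.ofFn_eq_map]
  congr 2
  funext i
  refine congrArg List.ofFn (funext fun j => ?_)
  have : finProdFinEquiv.symm (⟨i * k + j, by
      calc i * k + j < (i + 1) * k := by rw [Nat.add_mul]; omega
        _ ≤ n * k := Nat.mul_le_mul_right _ i.2⟩ : Fin (n * k)) = (i, j) := by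
    rw [Equiv.symm_apply_eq]
    ext; simp [finProdFinEquiv]; ring
  simp only [encode, this]

/-- The symbols of the positions of a block that are marked. -/
def decodeSym (l : List Bool) : List A :=
  ((List.ofFn e.symm).zip l).flatMap fun p => if p.2 then [p.1] else []

theorem zip_ofFn {α β : Type} {n : ℕ} (f : Fin n → α) (g : Fin n → β) :
    (List.ofFn f).zip (List.ofFn g) = List.ofFn fun j => (f j, g j) := by
  refine List.ext_getElem (by simp) fun i h h' => by simp

theorem flatten_ofFn_eq {α : Type} {n : ℕ} (f : Fin n → α) (i : Fin n) :
    (List.ofFn fun j => if i = j then [f j] else []).flatten = [f i] := by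
  induction n with
  | zero => exact i.elim0
  | succ n ih =>
    rw [List.ofFn_succ, List.flatten_cons]
    refine Fin.cases ?_ (fun i => ?_) i
    · simp [(Fin.succ_ne_zero _).symm]
    · have := ih (fun j => f j.succ) i
      simp [Fin.succ_ne_zero, this]

theorem decodeSym_codeSym (o : Option A) : decodeSym e (codeSym e o) = o.toList := by
  rw [decodeSym, codeSym, zip_ofFn, List.flatMap_def, List.map_ofFn]
  cases o with
  | none => simp [Function.comp_def]
  | some a =>
    have := flatten_ofFn_eq e.symm (e a)
    simpa [Function.comp_def] using this

/-- Reading off a string from a bit vector. -/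
def readOff {m : ℕ} (v : Fin (m * k) → Bool) : List A :=
  (List.ofFn fun i : Fin m => decodeSym e (List.ofFn fun j : Fin k => v (finProdFinEquiv (i, j)))).flatten

theorem flatten_ofFn_getElem? {α : Type} (m : ℕ) (y : List α) (hy : y.length ≤ m) :
    (List.ofFn fun i : Fin m => y[(i : ℕ)]?.toList).flatten = y := by
  induction m generalizing y with
  | zero => simpa using (List.length_eq_zero_iff.1 (Nat.le_zero.1 hy)).symm
  | succ m ih =>
    rw [List.ofFn_succ, List.flatten_cons]
    cases y with
    | nil => simp
    | cons a y =>
      have := ih y (by simpa using hy)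
      simp [this]

theorem readOff_encode {m : ℕ} (y : List A) (hy : y.length ≤ m) :
    readOff e (encode e m y) = y := by
  conv_rhs => rw [← flatten_ofFn_getElem? m y hy]
  unfold readOff
  congr 2
  funext i
  rw [← decodeSym_codeSym e]
  refine congrArg (decodeSym e) (congrArg List.ofFn (funext fun j => ?_))
  simp [encode]

end codes


open Mach

/-! ### The fuzzy Turing machine that evaluates a uniform family of circuits -/

section whole

variable {Δ Γ : Type} {k l r : ℕ}

/-- Load the block of the code that belongs to one position of the input string. -/
def loadBody [Finite Δ] (eΔ : Δ ≃ Fin k) : EvSym Δ r → Mach EvStk (fun _ => EvSym Δ r) Γ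
  | .inp o => seq (pop .inp) (pushList (.arr false) ((codeSym eΔ o).reverse.map .bit))
  | _ => skip

/-- Load the code of the input string into the array of values of variables. -/
def load [Finite Δ] (eΔ : Δ ≃ Fin k) : Mach EvStk (fun _ => EvSym Δ r) Γ :=
  loop .inp (fun _ => true) (loadBody eΔ)

theorem runs_load [Finite Δ] (eΔ : Δ ≃ Fin k) (L : List (Option Δ)) : ∀ s : EvData Δ r Γ,
    s.inp = L → (load eΔ).Runs s.toState { s with
      inp := []
      arr := Function.update s.arr false (L.reverse.flatMap (codeSym eΔ) ++ s.arr false) }.toState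
      ((k + 2) * L.length + 1) := by
  induction L with
  | nil =>
    intro s hs
    have e : { s with
        inp := []
        arr := Function.update s.arr false (([] : List (Option Δ)).reverse.flatMap (codeSym eΔ) ++
          s.arr false) } = s := by
      simp only [List.reverse_nil, List.flatMap_nil, List.nil_append, Function.update_eq_self]
      rw [← hs]
    rw [e]
    exact runs_loop_exit (by simp [EvData.toState, EvData.stk, hs])
  | cons o L ih =>
    intro s hs
    have h₁ := s.runs_pop_inp
    rw [hs, List.tail_cons] at h₁
    have h₂ : (pushList (Γ := fun _ => EvSym Δ r) (G := Γ) (EvStk.arr false) ((codeSym eΔ o).reverse.map EvSym.bit)).Runs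
        ({ s with inp := L } : EvData Δ r Γ).toState
        ({ s with
          inp := L
          arr := Function.update s.arr false (codeSym eΔ o ++ s.arr false) } :
          EvData Δ r Γ).toState k := by
      refine (runs_pushList (Γ := fun _ => EvSym Δ r) (EvStk.arr false) _ _).congr ?_ (by simp [codeSym])
      rw [EvData.toState, EvData.toState]
      refine congrArg (fun S => MState.mk S s.ρ s.out s.wt) ?_
      rw [← EvData.update_arr { s with inp := L } false]
      simp [EvData.stk]
    have h₃ := ih { s with
      inp := L
      arr := Function.update s.arr false (codeSym eΔ o ++ s.arr false) } rfl
    have hh : (s.toState.stk .inp).head? = some (.inp o) := by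
      simp [EvData.toState, EvData.stk, hs]
    refine (Runs.loop (Γ := fun _ => EvSym Δ r) (B := loadBody eΔ) hh rfl (h₁.seq h₂) h₃).congr
      (congrArg EvData.toState ?_) ?_
    · simp
    · simp only [List.length_cons]; ring_nf; omega

/-- Write a symbol if a bit is set. -/
noncomputable def emitIf (g : Γ) : Option (EvSym Δ r) → Mach EvStk (fun _ => EvSym Δ r) Γ
  | some (.bit true) => prim (.eff 1 (some g) ())
  | _ => skip

/-- Write the symbols that are marked in a block. -/
noncomputable def decodeBlock [Finite Δ] : List Γ → Mach EvStk (fun _ => EvSym Δ r) Γ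
  | [] => skip
  | g :: gs => seq (case (.arr false) true (emitIf g)) (decodeBlock gs)

theorem runs_decodeBlock [Finite Δ] (gs : List Γ) (B R : List Bool) : ∀ s : EvData Δ r Γ,
    B.length = gs.length → s.arr false = B ++ R → (decodeBlock gs).Runs s.toState { s with
      arr := Function.update s.arr false R
      out := s.out ++ (gs.zip B).flatMap fun (p : Γ × Bool) => if p.2 then [p.1] else [] }.toState
      (2 * B.length) := by
  induction B generalizing gs with
  | nil =>
    intro s hl hs
    obtain rfl : gs = [] := List.length_eq_zero_iff.1 hl.symm
    refine (runs_skip _).congr (congrArg EvData.toState ?_) (Nat.zero_le _)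
    rw [List.nil_append] at hs
    simp [← hs]
  | cons b B ih =>
    intro s hl hs
    obtain ⟨g, gs, rfl⟩ := List.exists_cons_of_length_pos (l := gs) (by simp at hl; omega)
    have h₁ : (emitIf g (some (EvSym.bit b : EvSym Δ r))).Runs
        ({ s with arr := Function.update s.arr false (B ++ R) } : EvData Δ r Γ).toState
        ({ s with
          arr := Function.update s.arr false (B ++ R)
          out := s.out ++ if b then [g] else [] } : EvData Δ r Γ).toState 1 := by
      cases b
      · refine (runs_skip _).congr (congrArg EvData.toState ?_) (Nat.zero_le _)
        simp
      · refine (runs_prim _ _).congr ?_ le_rfl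
        simp only [Op.exec, EvData.toState]
        rw [min_eq_left unitInterval.le_one']
        rfl
    have h₂ := ih gs { s with
      arr := Function.update s.arr false (B ++ R)
      out := s.out ++ if b then [g] else [] } (by simpa using hl) (by simp)
    refine ((s.runs_case_arr_cons hs h₁).seq h₂).congr (congrArg EvData.toState ?_)
      (by simp; omega)
    simp

/-- Write the string that is coded by an array. -/
noncomputable def decode [Finite Δ] (eΓ : Γ ≃ Fin l) : Mach EvStk (fun _ => EvSym Δ r) Γ :=
  loop (.arr false) (fun _ => true) fun _ => decodeBlock (List.ofFn eΓ.symm)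

theorem runs_decode [Finite Δ] (eΓ : Γ ≃ Fin l) (hl : 0 < l) (Bs : List (List Bool)) :
    ∀ s : EvData Δ r Γ, (∀ B ∈ Bs, B.length = l) → s.arr false = Bs.flatten →
    (decode eΓ).Runs s.toState { s with
      arr := Function.update s.arr false []
      out := s.out ++ (Bs.map (decodeSym eΓ)).flatten }.toState ((2 * l + 1) * Bs.length + 1) := by
  induction Bs with
  | nil =>
    intro s _ hs
    rw [List.flatten_nil] at hs
    have e : { s with
        arr := Function.update s.arr false []
        out := s.out ++ (([] : List (List Bool)).map (decodeSym eΓ)).flatten } = s := by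
      have : Function.update s.arr false [] = s.arr := by rw [← hs, Function.update_eq_self]
      simp [this]
    rw [e]
    exact runs_loop_exit (by simp [EvData.toState, EvData.stk, hs])
  | cons B Bs ih =>
    intro s hB hs
    have hB₁ : B.length = l := hB B (by simp)
    obtain ⟨b, B', rfl⟩ := List.exists_cons_of_length_pos (l := B) (by omega)
    rw [List.flatten_cons] at hs
    have h₁ := runs_decodeBlock (List.ofFn eΓ.symm) (b :: B') Bs.flatten s (by simpa using hB₁) hs
    have h₂ := ih { s with
      arr := Function.update s.arr false Bs.flatten
      out := s.out ++ decodeSym eΓ (b :: B') } (fun B h => hB B (by simp [h])) (by simp)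
    have hh : (s.toState.stk (.arr false)).head? = some (.bit b) := by
      simp [EvData.toState, EvData.stk, hs]
    refine (Runs.loop (Γ := fun _ => EvSym Δ r) (B := fun _ => decodeBlock (List.ofFn eΓ.symm))
      hh rfl h₁ h₂).congr (congrArg (EvData.toState (Δ := Δ) (r := r)) ?_) ?_
    · simp [decodeSym]
    · rw [hB₁, List.length_cons]; ring_nf; omega

theorem ofFn_eq_flatten {α : Type} {m k : ℕ} (v : Fin (m * k) → α) :
    List.ofFn v = (List.ofFn fun i : Fin m =>
      List.ofFn fun j : Fin k => v (finProdFinEquiv (i, j))).flatten := by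
  rw [List.ofFn_mul]
  congr 2
  funext i
  refine congrArg List.ofFn (funext fun j => congrArg v ?_)
  ext; simp [finProdFinEquiv]; ring

/-- The evaluator of circuits: restore the order of the description, load the code of the input,
evaluate the levels, and write the string that is coded by the values of the output variables. -/
noncomputable def evaluator [Finite Δ] (eΔ : Δ ≃ Fin k) (eΓ : Γ ≃ Fin l) (D : Fin r → I) :
    Mach EvStk (fun _ => EvSym Δ r) Γ :=
  seq (move .rev .desc id) (seq (load eΔ) (seq (evalLevels D) (decode eΓ)))

/-- The initial data of the evaluator. -/
def EvData.init (Γ : Type) (L : List (Option Δ)) (R : List (DescSym r)) (ρ : Stream' Bool) :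
    EvData Δ r Γ :=
  ⟨L, fun _ => [], fun _ => [], [], 0, 0, R, [], ρ, [], 1⟩

theorem runs_evalLevels_nil [Finite Δ] (D : Fin r → I) (s : EvData Δ r Γ) (h : s.desc = []) :
    (evalLevels D).Runs s.toState s.toState 1 :=
  runs_loop_exit (by simp [EvData.toState, EvData.stk, h])

/-- Along each stream of bits, the evaluator accumulates the degree with which the circuit leads from
the code of `x` to the values read off from the stream. -/
theorem runs_evaluator [Finite Δ] (eΔ : Δ ≃ Fin k) (eΓ : Γ ≃ Fin l) (hl : 0 < l) (D : Fin r → I)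
    {n m : ℕ} (C : Circuit (Fin r) (n * k) (m * l)) (x : List Δ) (ρ : Stream' Bool) :
    ∃ s' : EvData Δ r Γ, s'.out = readOff eΓ (C.run D (encode eΔ n x) ρ 1).1 ∧
      s'.wt = (C.run D (encode eΔ n x) ρ 1).2.2 ∧
      (evaluator eΔ eΓ D).Runs
        (EvData.init Γ ((List.range n).reverse.map fun i => x[i]?) C.describe.reverse ρ).toState
        s'.toState (63 * C.describe.length + (3 * k + 2) * n + (4 * l + 1) * m + 5) := by
  have h₁ := EvData.runs_move_rev (G := Γ)
    (EvData.init Γ ((List.range n).reverse.map fun i => x[i]?) C.describe.reverse ρ)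
  have h₂ := runs_load (Γ := Γ) (r := r) eΔ ((List.range n).reverse.map fun i => x[i]?)
    { EvData.init Γ ((List.range n).reverse.map fun i => x[i]?) [] ρ with desc := C.describe } rfl
  have hload : ((List.range n).reverse.map fun i => x[i]?).reverse.flatMap (codeSym eΔ) ++ [] =
      List.ofFn (encode eΔ n x) := by
    rw [ofFn_encode, ← List.map_reverse, List.reverse_reverse, List.flatMap_map, List.append_nil]
  set v := encode eΔ n x with hv
  have h₃ := runs_evalLevels D C (EvData.init (Δ := Δ) Γ [] [] ρ) v ρ [] (T := 1)
    (s' := ({ EvData.init (Δ := Δ) Γ [] [] ρ with wt := (C.run D v ρ 1).2.2 }.level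
      (List.ofFn (C.run D v ρ 1).1) (C.run D v ρ 1).2.1 0 []).toState)
    ((runs_evalLevels_nil D _ rfl).mono (Nat.le_add_right _ _))
  have h₄ := runs_decode (Δ := Δ) (r := r) eΓ hl (List.ofFn fun i : Fin m =>
      List.ofFn fun j : Fin l => (C.run D v ρ 1).1 (finProdFinEquiv (i, j)))
    ({ EvData.init (Δ := Δ) Γ [] [] ρ with wt := (C.run D v ρ 1).2.2 }.level
      (List.ofFn (C.run D v ρ 1).1) (C.run D v ρ 1).2.1 0 [])
    (by simp [List.mem_ofFn]) (ofFn_eq_flatten _)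
  have h₁' := h₁.congr (s₂ := ({ EvData.init Γ ((List.range n).reverse.map fun i => x[i]?) [] ρ with
    desc := C.describe } : EvData Δ r Γ).toState) (by simp [EvData.init]) le_rfl
  have h₂' := h₂.congr (s₂ := ((EvData.init (Δ := Δ) Γ [] [] ρ).level (List.ofFn v) ρ 0
    (C.describe ++ [])).toState) (congrArg EvData.toState (by
      simp only [EvData.init, hload, EvData.level, List.append_nil, EvData.mk.injEq, and_true,
        true_and]
      refine ⟨?_, rfl⟩
      funext b; cases b <;> simp [seg_of_le])) le_rfl
  refine ⟨_, ?_, ?_, (h₁'.seq (h₂'.seq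
    (Runs.seq (Runs.congr h₃ rfl le_rfl) h₄))).mono ?_⟩
  · simp [EvData.level, EvData.init, readOff, List.map_ofFn, Function.comp_def]
  · rfl
  · simp only [EvData.init, List.length_reverse, List.length_map, List.length_range,
      List.length_ofFn]
    ring_nf
    omega

end whole


open Mach Turing

theorem Mach.Runs.length_le {K : Type} [DecidableEq K] {Γ : K → Type} {G : Type} {M : Mach K Γ G}
    {s s' : MState K Γ G} {T : ℕ} (h : M.Runs s s' T) (k : K) :
    (s'.stk k).length ≤ (s.stk k).length + T := by
  obtain ⟨t, ht, hs⟩ := h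
  have H : ∀ t (a b : Option M.Q × MState K Γ G), Steps M.step t a b →
      (b.2.stk k).length ≤ (a.2.stk k).length + t := by
    intro t
    induction t with
    | zero => rintro a b h; cases h; exact Nat.le_add_right _ _
    | succ t ih =>
      rintro ⟨_ | q, s⟩ b ⟨c, hc, h⟩
      · simp [Mach.step] at hc
      · have h₁ := ih _ _ h
        simp only [Mach.step, Option.some.injEq] at hc
        subst hc
        have h₂ := length_exec_le (M.op q) s k
        simp only at h₁ ⊢
        omega
  have := H t _ _ hs
  simp only at this
  omega

theorem Circuit.le_length_describe {r n d : ℕ} (C : Circuit (Fin r) n d) :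
    d ≤ n + C.describe.length := by
  cases C with
  | input => simp
  | layer C L =>
    have h := L.out_lt
    have e : (List.ofFn fun k => (L.gate k).describe).flatten =
        (List.ofFn L.gate).flatMap Gate.describe := by
      simp [List.flatMap_def, List.map_ofFn, Function.comp_def]
    rw [Circuit.describe, e]
    simp only [List.length_append]
    omega

theorem loadStk_eq_update {Δ K : Type} [DecidableEq K] {Γ : K → Type} {kx kn : K} (hk : kx ≠ kn)
    (wx : Option Δ → Γ kx) (wn : Γ kn) (x : List Δ) (n : ℕ) :
    loadStk kx kn wx wn x n = Function.update (Function.update (fun _ => []) kn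
      (List.replicate n wn)) kx ((List.range n).reverse.map fun i => wx x[i]?) := by
  induction n with
  | zero =>
    funext k
    by_cases h : k = kx
    · subst h; simp [loadStk]
    · by_cases h' : k = kn
      · subst h'; simp [loadStk, hk.symm]
      · simp [loadStk, h]
  | succ n ih =>
    have : loadStk kx kn wx wn x (n + 1) =
      let S' := Function.update (loadStk kx kn wx wn x n) kx
        (wx x[n]? :: loadStk kx kn wx wn x n kx)
      Function.update S' kn (wn :: S' kn) := rfl
    rw [this, ih]
    funext k
    by_cases h : k = kx
    · subst h; simp [hk, List.range_succ]
    · by_cases h' : k = kn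
      · subst h'; simp [hk.symm, List.replicate_succ]
      · simp [h, h']

instance (tm : FinTM2) {P : Type} (Γ' : P → Type) [∀ p, Finite (Γ' p)] (a : tm.K ⊕ P) :
    Finite (TMΓ tm Γ' a) := by
  rcases a with a | a
  · exact (inferInstance : Finite {b : tm.Γ a // Pushable tm a b})
  · exact (inferInstance : Finite (Γ' a))

section whole

variable {Δ Γ : Type} {k l r : ℕ}

theorem loadStk_eq (tm : FinTM2) (w : {a : tm.Γ tm.k₀ // Pushable tm tm.k₀ a}) (x : List Δ)
    (ρ : Stream' Bool) (n : ℕ) :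
    loadStk (Γ := TMΓ tm fun _ : EvStk => EvSym Δ r) (.inr .inp) (.inl tm.k₀) EvSym.inp w x n =
      joinStk (Function.update (fun _ => []) tm.k₀ (List.replicate n w))
        (EvData.init Γ ((List.range n).reverse.map fun i => x[i]?) [] ρ).stk := by
  have h₁ := loadStk_eq_update (Γ := TMΓ tm fun _ : EvStk => EvSym Δ r) (kx := .inr EvStk.inp)
    (kn := .inl tm.k₀) (by simp) EvSym.inp w x n
  have h₂ : (fun _ => [] : ∀ a, List (TMΓ tm (fun _ : EvStk => EvSym Δ r) a)) =
      joinStk (fun _ => []) (EvData.init Γ [] [] ρ).stk := by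
    funext a
    rcases a with a | a
    · rfl
    · cases a <;> rfl
  rw [h₂] at h₁
  refine h₁.trans ((congrArg (fun S : ∀ a, List (TMΓ tm (fun _ : EvStk => EvSym Δ r) a) =>
    Function.update S (Sum.inr EvStk.inp) ((List.range n).reverse.map fun i => EvSym.inp x[i]?))
    (update_joinStk_inl _ _ tm.k₀ (List.replicate n w))).trans
    ((update_joinStk_inr _ _ EvStk.inp _).trans (congrArg (joinStk _) ?_)))
  refine Eq.trans ?_ (EvData.update_inp (EvData.init Γ [] [] ρ) _)
  rw [List.map_map]
  rfl

/-- The machine that writes the description of a circuit and evaluates it. -/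
noncomputable def whole [Finite Δ] (eΔ : Δ ≃ Fin k) (eΓ : Γ ≃ Fin l) (D : Fin r → I) (tm : FinTM2)
    (g : tm.Γ tm.k₁ → DescSym r) :
    Mach (tm.K ⊕ EvStk) (TMΓ tm fun _ : EvStk => EvSym Δ r) Γ :=
  seq (ofTM2 tm) (seq
    (move (.inl tm.k₁) (.inr .rev) fun a : {a : tm.Γ tm.k₁ // Pushable tm tm.k₁ a} =>
      EvSym.desc (g a.1))
    (Mach.lift (evaluator eΔ eΓ D)))

/-- The running time is polynomial because the description of `C n`, written in polynomial time, has
polynomial length. -/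
theorem runs_whole [Finite Δ] (eΔ : Δ ≃ Fin k) (eΓ : Γ ≃ Fin l) (hl : 0 < l) (D : Fin r → I)
    {m : ℕ → ℕ} (C : ∀ n, Circuit (Fin r) (n * k) (m n * l))
    (h : TM2ComputableInPolyTime Computability.unaryEncodeNat
      (id : List (DescSym r) → List (DescSym r)) fun n => (C n).describe) :
    ∃ p : Polynomial ℕ, ∀ (n : ℕ) (x : List Δ) (ρ : Stream' Bool),
      ∃ s' : MState (h.tm.K ⊕ EvStk) (TMΓ h.tm fun _ : EvStk => EvSym Δ r) Γ,
        s'.out = readOff eΓ ((C n).run D (encode eΔ n x) ρ 1).1 ∧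
        s'.wt = ((C n).run D (encode eΔ n x) ρ 1).2.2 ∧
        (whole eΔ eΓ D h.tm h.outputAlphabet).Runs
          ⟨loadStk (Γ := TMΓ h.tm fun _ : EvStk => EvSym Δ r) (.inr .inp) (.inl h.tm.k₀) EvSym.inp
            ⟨h.inputAlphabet.symm true, Or.inl rfl⟩ x n, ρ, [], 1⟩ s' (p.eval n) := by
  obtain ⟨c, hc⟩ := ofTM2_runs (Γ' := fun _ : EvStk => EvSym Δ r) Γ h.tm
  let L : Polynomial ℕ := Polynomial.X + Polynomial.C c * h.time
  refine ⟨Polynomial.C c * h.time + (3 * L + 1) + (63 * L + Polynomial.C (3 * k + 2) * Polynomial.X +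
    Polynomial.C (4 * l + 1) * (Polynomial.C k * Polynomial.X + L) + 5), fun n x ρ => ?_⟩
  set w : {a : h.tm.Γ h.tm.k₀ // Pushable h.tm h.tm.k₀ a} :=
    ⟨h.inputAlphabet.symm true, Or.inl rfl⟩ with hw
  have hlen : (Computability.unaryEncodeNat n).length = n :=
    Computability.unary_decode_encode_nat n
  have hrep : Computability.unaryEncodeNat n = List.replicate n true := by
    clear hlen
    induction n with
    | zero => rfl
    | succ n ih => rw [Computability.unaryEncodeNat, ih, List.replicate_succ]
  obtain ⟨A', hA', h₁⟩ := hc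
    (EvData.init Γ ((List.range n).reverse.map fun i => x[i]?) [] ρ).stk ρ [] 1
    (Function.update (fun _ => []) h.tm.k₀ (List.replicate n w)) _ _ _ ⟨h.outputsFun n⟩
    (by simp [hrep, hw]) (fun a ha => Function.update_of_ne ha _ _)
  rw [hlen] at h₁
  have hA'len : (A' h.tm.k₁).length = (C n).describe.length := by
    have := congrArg List.length hA'
    simpa using this
  -- the description is not longer than the running time permits
  have hdesc : (C n).describe.length ≤ L.eval n := by
    have h₂ := h₁.length_le (.inl h.tm.k₁)
    have h₃ : (Function.update (fun _ => [] : ∀ a, List {b : h.tm.Γ a // Pushable h.tm a b}) h.tm.k₀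
        (List.replicate n w) h.tm.k₁).length ≤ n := by
      by_cases hk : h.tm.k₁ = h.tm.k₀
      · have : ∀ a, a = h.tm.k₀ → (Function.update
            (fun _ => [] : ∀ a, List {b : h.tm.Γ a // Pushable h.tm a b}) h.tm.k₀
            (List.replicate n w) a).length ≤ n := by
          rintro a rfl; simp
        exact this _ hk
      · simp [hk]
    replace h₂ : (A' h.tm.k₁).length ≤ (Function.update
      (fun _ => [] : ∀ a, List {b : h.tm.Γ a // Pushable h.tm a b}) h.tm.k₀
      (List.replicate n w) h.tm.k₁).length + c * h.time.eval n := h₂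
    rw [hA'len] at h₂
    simp only [L, Polynomial.eval_add, Polynomial.eval_mul, Polynomial.eval_X, Polynomial.eval_C]
    omega
  have h₂ := runs_move (Γ := TMΓ h.tm fun _ : EvStk => EvSym Δ r) (G := Γ)
    (k := .inl h.tm.k₁) (k' := .inr EvStk.rev) (by simp)
    (fun a : {a : h.tm.Γ h.tm.k₁ // Pushable h.tm h.tm.k₁ a} =>
      EvSym.desc (h.outputAlphabet a.1)) ⟨joinStk A'
        (EvData.init Γ ((List.range n).reverse.map fun i => x[i]?) [] ρ).stk, ρ, [], 1⟩
  obtain ⟨s', hs', hs'', h₃⟩ := runs_evaluator eΔ eΓ hl D (C n) x ρ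
  have hstk : (A' h.tm.k₁).map (fun a => (EvSym.desc (h.outputAlphabet a.1) : EvSym Δ r)) =
      (C n).describe.map EvSym.desc := by
    rw [show (fun a => (EvSym.desc (h.outputAlphabet a.1) : EvSym Δ r)) =
      fun a : {a : h.tm.Γ h.tm.k₁ // Pushable h.tm h.tm.k₁ a} =>
        EvSym.desc (h.outputAlphabet a.1) from rfl]
    have := congrArg (List.map fun a => (EvSym.desc (h.outputAlphabet a) : EvSym Δ r)) hA'
    rw [List.map_map] at this
    refine this.trans ?_
    simp
  refine ⟨liftState (Function.update A' h.tm.k₁ []) s'.toState, hs', hs'', ?_⟩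
  have hload := loadStk_eq (Γ := Γ) (r := r) h.tm w x ρ n
  have h₂' := h₂.congr (s₂ := liftState (Function.update A' h.tm.k₁ [])
    (EvData.init Γ ((List.range n).reverse.map fun i => x[i]?) (C n).describe.reverse ρ).toState)
    (T' := 3 * (C n).describe.length + 1) ?_ ?_
  · refine (congrArg (fun S => (whole eΔ eΓ D h.tm h.outputAlphabet).Runs
      ⟨S, ρ, [], 1⟩ _ _) hload).mpr ((h₁.seq (h₂'.seq (h₃.lift _))).mono ?_)
    have hm : m n ≤ k * n + L.eval n := by
      have := (C n).le_length_describe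
      have : m n ≤ m n * l := Nat.le_mul_of_pos_right _ hl
      have : n * k = k * n := Nat.mul_comm _ _
      omega
    have hm' := Nat.mul_le_mul_left (4 * l + 1) hm
    simp only [Polynomial.eval_add, Polynomial.eval_mul, Polynomial.eval_X, Polynomial.eval_C,
      Polynomial.eval_ofNat, Polynomial.eval_one] at hm' ⊢
    omega
  · refine congrArg (fun S => MState.mk S ρ [] 1) ?_
    refine (congrArg (fun S => Function.update S _ _) (update_joinStk_inr _ _ EvStk.rev _)).trans
      ((update_joinStk_inl _ _ h.tm.k₁ []).trans (congrArg (joinStk _) ?_))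
    refine Eq.trans (congrArg _ ?_) (EvData.update_rev (EvData.init Γ _ [] ρ) _)
    refine (congrArg (fun l => l.reverse ++ []) hstk).trans ?_
    simp
  · exact (congrArg (3 * · + 1) hA'len).le

/-- A fuzzy function that is computed by a uniform family of circuits is computed in polynomial time
by a fuzzy Turing machine. -/
theorem exists_DFTM_of_circuits [Finite Δ] (eΔ : Δ ≃ Fin k) (eΓ : Γ ≃ Fin l) (hl : 0 < l)
    {FΘ₁ : Set (FuzzySet (List Δ))} {FΘ₂ : Set (FuzzySet (List Γ))}
    (hΘ₁ : ∀ s ∈ FΘ₁, IsAdmissible s) (hΘ₂ : ∀ b ∈ FΘ₂, IsAdmissible b) (f : FΘ₁ → FΘ₂)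
    {m : ℕ → ℕ} (C : ∀ n, FuzzyCircuit (n * k) (m n * l)) (hC : IsUniform C)
    (hf : FamilyComputes eΔ eΓ C f) : ∃ M : DFTM Δ Γ, M.ComputesInPolyTime f := by
  obtain ⟨r, D, C', hCC', ⟨hTM⟩⟩ := hC
  obtain ⟨p, hp⟩ := runs_whole eΔ eΓ hl D C' hTM
  have := hTM.tm.kFin
  have hfin : ∀ a, Finite (TMΓ hTM.tm (fun _ : EvStk => EvSym Δ r) a) := inferInstance
  let M := whole eΔ eΓ D hTM.tm hTM.outputAlphabet
  let w : {a : hTM.tm.Γ hTM.tm.k₀ // Pushable hTM.tm hTM.tm.k₀ a} :=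
    ⟨hTM.inputAlphabet.symm true, Or.inl rfl⟩
  refine ⟨toDFTM M (.inr EvStk.inp) (.inl hTM.tm.k₀) EvSym.inp w,
    Polynomial.X + 2 + p * (2 * (Polynomial.X + p) + 4), fun s => ?_⟩
  set n := len s.1 with hn
  have hlen : ∀ x, 0 < s.1 x → x.length ≤ n := fun x hx =>
    le_csSup ((hΘ₁ s.1 s.2).1.image _).bddAbove ⟨x, hx, rfl⟩
  obtain ⟨hm, hev⟩ := hf s
  have key : ∀ v u, encodeFuzzy eΓ (m n) (f s).1 v ≤ u ↔ ∀ x ρ, 0 < s.1 x →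
      ((C' n).run D (encode eΔ n x) ρ 1).1 = v →
        min (s.1 x) ((C' n).run D (encode eΔ n x) ρ 1).2.2 ≤ u := by
    intro v u
    rw [← hev, hCC', Circuit.eval_le_iff]
    constructor
    · intro h x ρ hx hv
      refine le_trans (min_le_min_right _ ?_) (h _ ρ hv)
      exact le_iSup (fun y : {y : List Δ // y.length ≤ n ∧ encode eΔ n y = encode eΔ n x} => s.1 y)
        ⟨x, hlen x hx, rfl⟩
    · intro h v₀ ρ hv
      refine le_himp_iff.1 (iSup_le ?_)
      rintro ⟨x, hx, rfl⟩
      refine le_himp_iff.2 ?_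
      by_cases hs : 0 < s.1 x
      · exact h x ρ hs hv
      · rw [le_antisymm (not_lt.1 hs) unitInterval.nonneg']
        exact (min_le_left _ _).trans unitInterval.nonneg'
  have := DFTM.Choice.output_eq (simChoice M (.inr EvStk.inp) (.inl hTM.tm.k₀) EvSym.inp w)
    (s := s.1) (g := (f s).1)
    (T := (Polynomial.X + 2 + p * (2 * (Polynomial.X + p) + 4)).eval n)
    (fun x ρ => readOff eΓ ((C' n).run D (encode eΔ n x) ρ 1).1)
    (fun x ρ => ((C' n).run D (encode eΔ n x) ρ 1).2.2) ?_ ?_ (hΘ₂ _ (f s).2).2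
  · exact this
  · intro x hx ρ
    obtain ⟨s', h₁, h₂, h₃⟩ := hp n x ρ
    obtain ⟨u, hu, ρ', c, hc, ho, hs⟩ := sim_runs M (.inr EvStk.inp) (.inl hTM.tm.k₀) EvSym.inp w
      (by simp) n x ρ h₃
    refine ⟨u, ?_, ρ', c, hc, ho.trans h₁, h₂ ▸ hs⟩
    simpa using hu
  · intro y u
    constructor
    · intro h x ρ hx hy
      refine le_trans ((key _ _).1 le_rfl x ρ hx rfl) (iSup_le ?_)
      rintro ⟨y', hy', he⟩
      rw [← he, readOff_encode eΓ y' hy'] at hy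
      exact hy ▸ h
    · intro h
      by_cases hy : 0 < (f s).1 y
      · have hy' := hm y hy
        refine le_trans ?_ ((key (encode eΓ (m n) y) u).2 fun x ρ hx hv => h x ρ hx (by
          rw [hv, readOff_encode eΓ y hy']))
        exact le_iSup (fun z : {z : List Γ // z.length ≤ m n ∧
          encode eΓ (m n) z = encode eΓ (m n) y} => (f s).1 z) ⟨y, hy', rfl⟩
      · rw [le_antisymm (not_lt.1 hy) unitInterval.nonneg']
        exact unitInterval.nonneg'

end whole


open Mach Turing

/-! ### Uniform families have polynomial size -/

theorem Circuit.size_map {K K' : Type} {n d : ℕ} (D : K → K') (C : Circuit K n d) :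
    (C.map D).size = C.size := by
  induction C with
  | input => rfl
  | layer C L ih => simp only [Circuit.map, Circuit.size, ih]; rfl

theorem Circuit.size_le_length_describe {r n d : ℕ} (C : Circuit (Fin r) n d) :
    C.size ≤ C.describe.length := by
  induction C with
  | input => rfl
  | layer C L ih =>
    have h : ∑ k, (1 + (L.gate k).a + (L.gate k).b) ≤
        (List.ofFn fun k => (L.gate k).describe).flatten.length := by
      rw [List.length_flatten, List.map_ofFn, List.sum_ofFn]
      refine Finset.sum_le_sum fun k _ => ?_
      have H : ∀ {a c : ℕ} (v : Fin a → Fin c),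
          a ≤ ((List.ofFn fun i => (v i : ℕ)).flatMap (unary (r := r))).length := by
        intro a c v
        rw [List.length_flatMap, List.map_ofFn, List.sum_ofFn]
        refine le_trans (by simp) (Finset.sum_le_sum (f := fun _ : Fin a => 1) fun i _ => ?_)
        simp [unary]
      have h₁ := H (L.gate k).inVar
      have h₂ := H (L.gate k).outVar
      have := congrArg List.length ((L.gate k).describe_eq [])
      simp only [List.append_nil] at this
      simp only [Function.comp_apply, this, List.length_append, List.length_cons]
      omega
    rw [Circuit.size, Circuit.describe]
    simp only [List.length_append]
    omega

/-- A polynomial time machine writes an output of polynomial length. -/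
theorem IsUniform.hasPolySize {a b : ℕ → ℕ} {C : ∀ n, FuzzyCircuit (a n) (b n)}
    (hC : IsUniform C) : HasPolySize C := by
  obtain ⟨r, D, C', hCC', ⟨h⟩⟩ := hC
  obtain ⟨c, hc⟩ := ofTM2_runs (Γ' := fun _ : Empty => Empty) Empty h.tm
  refine ⟨Polynomial.X + Polynomial.C c * h.time, fun n => ?_⟩
  rw [hCC', Circuit.size_map]
  refine (Circuit.size_le_length_describe _).trans ?_
  set w : {a : h.tm.Γ h.tm.k₀ // Pushable h.tm h.tm.k₀ a} :=
    ⟨h.inputAlphabet.symm true, Or.inl rfl⟩ with hw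
  obtain ⟨A', hA', h₁⟩ := hc (fun _ => []) (Stream'.const true) [] 1
    (Function.update (fun _ => []) h.tm.k₀ ((Computability.unaryEncodeNat n).map fun b =>
      ⟨h.inputAlphabet.symm b, Or.inl rfl⟩)) _ _ _ ⟨h.outputsFun n⟩
    (by simp) (fun a ha => Function.update_of_ne ha _ _)
  have hlen : (Computability.unaryEncodeNat n).length = n :=
    Computability.unary_decode_encode_nat n
  rw [hlen] at h₁
  have hA'len : (A' h.tm.k₁).length = (C' n).describe.length := by
    have := congrArg List.length hA'
    simpa using this
  have h₂ := h₁.length_le (.inl h.tm.k₁)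
  have H : ∀ a, ((Function.update (fun _ => []) h.tm.k₀ ((Computability.unaryEncodeNat n).map fun b =>
      ⟨h.inputAlphabet.symm b, Or.inl rfl⟩) :
        ∀ a, List {b : h.tm.Γ a // Pushable h.tm a b}) a).length ≤ n := by
    intro a
    by_cases ha : a = h.tm.k₀
    · subst ha; simp [hlen]
    · simp [ha]
  replace h₂ : (A' h.tm.k₁).length ≤ ((Function.update (fun _ => []) h.tm.k₀
    ((Computability.unaryEncodeNat n).map fun b => ⟨h.inputAlphabet.symm b, Or.inl rfl⟩) :
      ∀ a, List {b : h.tm.Γ a // Pushable h.tm a b}) h.tm.k₁).length + c * h.time.eval n := h₂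
  have h₃ := H h.tm.k₁
  simp only [Polynomial.eval_add, Polynomial.eval_mul, Polynomial.eval_X, Polynomial.eval_C]
  omega

/-! ### Stack machines as crisp Turing machines -/

section toTM2

variable {K : Type} [DecidableEq K] {Γ : K → Type} {G : Type}

/-- The statement for an instruction. The next state is kept in the internal memory; bits that the
stack machine guesses are taken to be `false`, and degrees and output are disregarded. -/
def Op.toStmt {Q : Type} : Op K Γ G (Option Q) → TM2.Stmt Γ (Option Q) (Option Q)
  | .push k a q => .push k (fun _ => a) (.goto fun _ => q)
  | .read k true f => .pop k (fun _ o => f o) (.goto fun v => v)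
  | .read k false f => .peek k (fun _ o => f o) (.goto fun v => v)
  | .eff _ _ q => .goto fun _ => q
  | .guess f => .goto fun _ => f false

/-- The program of the crisp Turing machine that corresponds to a stack machine. -/
def Mach.program (M : Mach K Γ G) : Option M.Q → TM2.Stmt Γ (Option M.Q) (Option M.Q)
  | none => .load (fun _ => none) .halt
  | some q => (M.op q).toStmt

/-- A stack machine as a crisp Turing machine. -/
noncomputable abbrev Mach.toTM2 (M : Mach K Γ G) [Fintype K] (k₀ k₁ : K) [Fintype (Γ k₀)] :
    FinTM2 :=
  letI := Fintype.ofFinite M.Q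
  @FinTM2.mk K _ _ k₀ k₁ Γ (Option M.Q) M.start _ (Option M.Q) none _ _ M.program

theorem initList_stk (tm : FinTM2) (x : List (tm.Γ tm.k₀)) :
    (initList tm x).stk = Function.update (fun _ => []) tm.k₀ x := by
  funext k
  by_cases h : k = tm.k₀
  · subst h; simp [initList]
  · simp [initList, h]

theorem haltList_stk (tm : FinTM2) (x : List (tm.Γ tm.k₁)) :
    (haltList tm x).stk = Function.update (fun _ => []) tm.k₁ x := by
  funext k
  by_cases h : k = tm.k₁
  · subst h; simp [haltList]
  · simp [haltList, h]

/-- A crisp Turing machine follows the runs of a stack machine in which all bits are `false`. -/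
theorem toTM2_outputs (M : Mach K Γ G) [Fintype K] (k₀ k₁ : K) [Fintype (Γ k₀)]
    {s s' : MState K Γ G} {T : ℕ} {x : List (Γ k₀)} {y : List (Γ k₁)} (h : M.Runs s s' T)
    (hρ : s.ρ = Stream'.const false)
    (hx : s.stk = Function.update (fun _ => []) k₀ x)
    (hy : s'.stk = Function.update (fun _ => []) k₁ y) :
    Nonempty (TM2OutputsInTime (M.toTM2 k₀ k₁) x (some y) (T + 1)) := by
  obtain ⟨t, ht, hs⟩ := h
  have H : ∀ t (a b : Option M.Q × MState K Γ G), Steps M.step t a b →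
      a.2.ρ = Stream'.const false → ∀ v, ∃ v',
      Steps (TM2.step M.program) t (⟨some a.1, v, a.2.stk⟩ : TM2.Cfg Γ (Option M.Q) (Option M.Q))
        (⟨some b.1, v', b.2.stk⟩ : TM2.Cfg Γ (Option M.Q) (Option M.Q)) := by
    intro t
    induction t with
    | zero => rintro a b h _ v; cases h; exact ⟨v, rfl⟩
    | succ t ih =>
      rintro ⟨_ | q, s⟩ b ⟨c, hc, h⟩ hρ v
      · simp [Mach.step] at hc
      · simp only [Mach.step, Option.some.injEq] at hc
        subst hc
        have key : ∃ v', TM2.step M.program ⟨some (some q), v, s.stk⟩ =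
            some ⟨some ((M.op q).exec s).1, v', ((M.op q).exec s).2.stk⟩ ∧
            ((M.op q).exec s).2.ρ = Stream'.const false := by
          have e : M.program (some q) = (M.op q).toStmt := rfl
          simp only at hρ
          cases ho : M.op q with
          | push k a q' => exact ⟨_, by rw [TM2.step, e, ho]; rfl, hρ⟩
          | read k er f =>
            cases er
            · exact ⟨_, by rw [TM2.step, e, ho]; rfl, hρ⟩
            · exact ⟨_, by rw [TM2.step, e, ho]; rfl, hρ⟩
          | eff w o q' => exact ⟨_, by rw [TM2.step, e, ho]; rfl, hρ⟩
          | guess f =>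
            refine ⟨v, ?_, ?_⟩
            · rw [TM2.step, e, ho]
              simp only [Op.exec, hρ]
              rfl
            · simp only [Op.exec, hρ]
              rfl
        obtain ⟨v', h₁, h₂⟩ := key
        obtain ⟨v'', h₃⟩ := ih _ _ h h₂ v'
        exact ⟨v'', _, h₁, h₃⟩
  obtain ⟨v', h₁⟩ := H t _ _ hs hρ none
  have h₂ : Steps (TM2.step M.program) (t + 1)
      (⟨some M.start, none, s.stk⟩ : TM2.Cfg Γ (Option M.Q) (Option M.Q))
      (⟨none, none, s'.stk⟩ : TM2.Cfg Γ (Option M.Q) (Option M.Q)) := h₁.trans (Steps.one rfl)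
  have e₁ : initList (M.toTM2 k₀ k₁) x = ⟨some M.start, none, s.stk⟩ := by
    exact congrArg (TM2.Cfg.mk (some M.start) none) ((initList_stk (M.toTM2 k₀ k₁) x).trans hx.symm)
  have e₂ : haltList (M.toTM2 k₀ k₁) y = ⟨none, none, s'.stk⟩ := by
    exact congrArg (TM2.Cfg.mk none none) ((haltList_stk (M.toTM2 k₀ k₁) y).trans hy.symm)
  have h₃ : (flip bind (M.toTM2 k₀ k₁).step)^[t + 1] (some (initList (M.toTM2 k₀ k₁) x)) =
      some (haltList (M.toTM2 k₀ k₁) y) := by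
    rw [e₁, e₂]
    exact iterate_bind_eq_some.2 h₂
  exact ⟨⟨⟨t + 1, h₃⟩, Nat.succ_le_succ ht⟩⟩

end toTM2


open Mach Turing

/-! ### Writing texts with loops -/

/-- The unary variables of a program that writes a text: the parameter `n`, three numbers computed
from it, and three loop counters. -/
inductive DsVar where
  | n
  | N
  | T
  | W
  | i
  | j
  | t
  deriving DecidableEq

/-- The stacks of a program that writes a text: the input, the text in reverse order, the result,
and the variables. -/
inductive DsStk where
  | inp
  | out
  | res
  | var (x : DsVar)
  deriving DecidableEq

instance : Finite DsVar := by
  refine Finite.of_surjective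
    (fun i : Fin 7 => match i with
      | 0 => DsVar.n
      | 1 => .N
      | 2 => .T
      | 3 => .W
      | 4 => .i
      | 5 => .j
      | 6 => .t) ?_
  rintro (_ | _ | _ | _ | _ | _ | _)
  exacts [⟨0, rfl⟩, ⟨1, rfl⟩, ⟨2, rfl⟩, ⟨3, rfl⟩, ⟨4, rfl⟩, ⟨5, rfl⟩, ⟨6, rfl⟩]

instance : Finite DsStk := by
  refine Finite.of_surjective
    (fun o : DsVar ⊕ Fin 3 => match o with
      | .inl x => DsStk.var x
      | .inr 0 => .inp
      | .inr 1 => .out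
      | .inr 2 => .res) ?_
  rintro (_ | _ | _ | x)
  exacts [⟨.inr 0, rfl⟩, ⟨.inr 1, rfl⟩, ⟨.inr 2, rfl⟩, ⟨.inl x, rfl⟩]

/-- The alphabets of these stacks. -/
def DsΓ (r : ℕ) : DsStk → Type
  | .inp => Bool
  | .out => DescSym r
  | .res => DescSym r
  | .var _ => Unit

instance (r : ℕ) (k : DsStk) : Finite (DsΓ r k) := by
  cases k
  · exact (inferInstance : Finite Bool)
  · exact (inferInstance : Finite (DescSym r))
  · exact (inferInstance : Finite (DescSym r))
  · exact (inferInstance : Finite Unit)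

section ds

variable {r : ℕ}

/-- The contents of the stacks, given the values of the variables and the text written. -/
def dsStk (r : ℕ) (env : DsVar → ℕ) (o : List (DescSym r)) : ∀ k, List (DsΓ r k)
  | .inp => []
  | .out => o
  | .res => []
  | .var x => List.replicate (env x) ()

/-- The data of the program. -/
def dsState (r : ℕ) (env : DsVar → ℕ) (o : List (DescSym r)) : MState DsStk (DsΓ r) Unit :=
  ⟨dsStk r env o, Stream'.const false, [], 1⟩

theorem update_dsStk_var (env : DsVar → ℕ) (o : List (DescSym r)) (x : DsVar) (a : ℕ) :
    Function.update (dsStk r env o) (.var x) (List.replicate a ()) =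
      dsStk r (Function.update env x a) o := by
  funext k
  cases k with
  | var y =>
    by_cases h : y = x
    · subst h; simp [dsStk]
    · simp [dsStk, h]
  | _ => exact Function.update_of_ne (by simp) _ _

theorem update_dsStk_out (env : DsVar → ℕ) (o o' : List (DescSym r)) :
    Function.update (dsStk r env o) .out o' = dsStk r env o' := by
  funext k
  cases k with
  | out => exact Function.update_self _ _ _
  | _ => exact Function.update_of_ne (by simp) _ _

theorem runs_push_var (env : DsVar → ℕ) (o : List (DescSym r)) (x : DsVar) :
    (push (.var x) ()).Runs (dsState r env o) (dsState r (Function.update env x (env x + 1)) o) 1 :=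
  runs_push (congrArg (fun S => MState.mk S _ _ _) (update_dsStk_var env o x (env x + 1)).symm)

theorem runs_pop_var (env : DsVar → ℕ) (o : List (DescSym r)) (x : DsVar) :
    (pop (.var x)).Runs (dsState r env o) (dsState r (Function.update env x (env x - 1)) o) 1 := by
  refine runs_pop (congrArg (fun S => MState.mk S _ _ _) ?_)
  rw [← update_dsStk_var]
  refine congrArg (Function.update (dsStk r env o) (.var x)) ?_
  change _ = (List.replicate (env x) ()).tail
  exact (List.tail_replicate).symm

theorem runs_emit (env : DsVar → ℕ) (o L : List (DescSym r)) :
    (pushList .out L).Runs (dsState r env o) (dsState r env (L.reverse ++ o)) L.length :=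
  (runs_pushList .out L (dsState r env o)).congr
    (congrArg (fun S => MState.mk S _ _ _) (update_dsStk_out env o (L.reverse ++ o))) le_rfl

/-- Count a variable down to zero, performing a task each time. -/
def countDown (x : DsVar) (A : Mach DsStk (DsΓ r) Unit) : Mach DsStk (DsΓ r) Unit :=
  loop (.var x) (fun _ => true) fun _ => seq (pop (.var x)) A

/-- `env i` and `o i` are the values of the variables and the text after `i` rounds. -/
theorem runs_countDown (x : DsVar) {A : Mach DsStk (DsΓ r) Unit} {T : ℕ} (V : ℕ)
    (env : ℕ → DsVar → ℕ) (o : ℕ → List (DescSym r)) (hx : ∀ i ≤ V, env i x = V - i)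
    (h : ∀ i < V, A.Runs (dsState r (Function.update (env i) x (V - i - 1)) (o i))
      (dsState r (env (i + 1)) (o (i + 1))) T) :
    (countDown x A).Runs (dsState r (env 0) (o 0)) (dsState r (env V) (o V)) (V * (T + 2) + 1) := by
  induction V generalizing env o with
  | zero =>
    refine (runs_loop_exit (Γ := DsΓ r) (k := .var x) fun a ha => ?_).mono (by omega)
    replace ha : (List.replicate (env 0 x) ()).head? = some a := ha
    rw [hx 0 le_rfl] at ha
    simp at ha
  | succ V ih =>
    have hh : ((dsState r (env 0) (o 0)).stk (.var x)).head? = some () := by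
      change (List.replicate (env 0 x) ()).head? = some ()
      rw [hx 0 (Nat.zero_le _)]
      rfl
    have h₁ := runs_pop_var (env 0) (o 0) x
    rw [hx 0 (Nat.zero_le _)] at h₁
    have h₂ := h 0 (Nat.succ_pos _)
    have h₃ := ih (fun i => env (i + 1)) (fun i => o (i + 1))
      (fun i hi => by rw [hx (i + 1) (by omega)]; omega) fun i hi => by
        have := h (i + 1) (by omega)
        rwa [show V + 1 - (i + 1) - 1 = V - i - 1 by omega] at this
    exact (Runs.loop (Γ := DsΓ r) (k := .var x) (c := fun _ => true)
      (B := fun _ => seq (pop (.var x)) A) hh rfl (h₁.seq h₂) h₃).mono (by ring_nf; omega)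

/-- Add a variable to another one, and set it to zero. -/
def moveVar (x y : DsVar) : Mach DsStk (DsΓ r) Unit := countDown x (push (.var y) ())

theorem runs_moveVar {x y : DsVar} (hxy : x ≠ y) (env : DsVar → ℕ) (o : List (DescSym r)) :
    (moveVar x y).Runs (dsState r env o)
      (dsState r (Function.update (Function.update env y (env y + env x)) x 0) o)
      (3 * env x + 1) := by
  have h := runs_countDown (r := r) x (A := push (.var y) ()) (T := 1) (env x)
    (fun i => Function.update (Function.update env y (env y + i)) x (env x - i)) (fun _ => o)
    (by simp) (fun i hi => by
      refine (runs_push_var _ o y).congr (congrArg (dsState r · o) ?_) le_rfl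
      funext z
      by_cases hz : z = x
      · subst hz; simp [hxy, Nat.sub_sub]
      · by_cases hz' : z = y
        · subst hz'; simp [hz, Nat.add_assoc]
        · simp [hz, hz'])
  simp only [Nat.add_zero, Nat.sub_zero, Function.update_eq_self, Nat.sub_self] at h
  exact h.mono (by omega)

/-- The text `g`, which depends on the variables, can be written in polynomial time without
changing the variables, if the variables in `Z` are zero. -/
def Emits (Z : Set DsVar) (g : (DsVar → ℕ) → List (DescSym r)) : Prop :=
  ∃ (A : Mach DsStk (DsΓ r) Unit) (P : Polynomial ℕ), ∀ env o M, (∀ z ∈ Z, env z = 0) →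
    (∀ x, env x ≤ M) →
      A.Runs (dsState r env o) (dsState r env ((g env).reverse ++ o)) (P.eval M)

namespace Emits

variable {Z Z' : Set DsVar} {g g' : (DsVar → ℕ) → List (DescSym r)}

theorem const (Z : Set DsVar) (L : List (DescSym r)) : Emits Z fun _ => L :=
  ⟨pushList .out L, Polynomial.C L.length, fun env o M _ _ => by
    simpa using runs_emit env o L⟩

theorem congr (h : Emits Z g) (hg : ∀ env, (∀ z ∈ Z, env z = 0) → g env = g' env) :
    Emits Z g' := by
  obtain ⟨A, P, h⟩ := h
  exact ⟨A, P, fun env o M hz hM => hg env hz ▸ h env o M hz hM⟩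

theorem mono (h : Emits Z g) (hZ : Z ⊆ Z') : Emits Z' g := by
  obtain ⟨A, P, h⟩ := h
  exact ⟨A, P, fun env o M hz hM => h env o M (fun z hz' => hz z (hZ hz')) hM⟩

theorem append (h : Emits Z g) (h' : Emits Z g') : Emits Z fun env => g env ++ g' env := by
  obtain ⟨A, P, h⟩ := h
  obtain ⟨A', P', h'⟩ := h'
  refine ⟨seq A A', P + P', fun env o M hz hM => ?_⟩
  have := (h env o M hz hM).seq (h' env _ M hz hM)
  simpa using this

theorem flatMap {ι : Type} (l : List ι) {g : ι → (DsVar → ℕ) → List (DescSym r)}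
    (h : ∀ b, Emits Z (g b)) : Emits Z fun env => l.flatMap fun b => g b env := by
  induction l with
  | nil => exact const Z []
  | cons b l ih => simpa using (h b).append ih

/-- A text can be written repeatedly, a variable being counted down and a counter being counted
up. -/
theorem loop (h : Emits Z g) {v w : DsVar} (hvw : v ≠ w) (hv : v ∉ Z) (hw : w ∉ Z)
    (hg : ∀ env a, g (Function.update env v a) = g env) :
    Emits (insert w Z) fun env =>
      (List.range (env v)).flatMap fun i => g (Function.update env w i) := by
  obtain ⟨A, P, h⟩ := h
  refine ⟨seq (countDown v (seq A (push (.var w) ()))) (moveVar w v),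
    Polynomial.X * (P + 3) + 1 + (3 * Polynomial.X + 1), fun env o M hz hM => ?_⟩
  have hw0 : env w = 0 := hz w (by simp)
  have h₁ := runs_countDown (r := r) v (A := seq A (push (.var w) ())) (T := P.eval M + 1) (env v)
    (fun i => Function.update (Function.update env w i) v (env v - i))
    (fun i => ((List.range i).flatMap fun i => g (Function.update env w i)).reverse ++ o)
    (by simp) (fun i hi => by
      have h₂ := h (Function.update (Function.update env w i) v (env v - i - 1))
        (((List.range i).flatMap fun i => g (Function.update env w i)).reverse ++ o) M
        (fun z hzZ => by
          have h₁ : z ≠ v := fun e => hv (e ▸ hzZ)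
          have h₂ : z ≠ w := fun e => hw (e ▸ hzZ)
          simp [h₁, h₂, hz z (by simp [hzZ])])
        (fun x => by
          have := hM v
          by_cases h₁ : x = v
          · subst h₁; simp; omega
          · by_cases h₂ : x = w
            · subst h₂; simp [h₁]; omega
            · simpa [h₁, h₂] using hM x)
      rw [hg] at h₂
      simp only [Function.update_idem]
      refine (h₂.seq (runs_push_var _ _ w)).congr ?_ le_rfl
      congr 1
      · funext z
        by_cases h₁ : z = v
        · subst h₁; simp [hvw, Nat.sub_sub]
        · by_cases h₂ : z = w
          · subst h₂; simp [h₁]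
          · simp [h₁, h₂]
      · simp [List.range_succ])
  have e₀ : Function.update (Function.update env w 0) v (env v - 0) = env := by
    rw [Nat.sub_zero]
    nth_rw 1 [← hw0]
    rw [Function.update_eq_self, Function.update_eq_self]
  rw [e₀] at h₁
  have h₂ := runs_moveVar hvw.symm (Function.update (Function.update env w (env v)) v
    (env v - env v)) (((List.range (env v)).flatMap fun i =>
      g (Function.update env w i)).reverse ++ o)
  refine (h₁.seq h₂).congr ?_ ?_
  · congr 1
    funext z
    by_cases h₁ : z = w
    · subst h₁; simp [hw0]
    · by_cases h₂ : z = v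
      · subst h₂; simp [hvw, hvw.symm]
      · simp [h₁, h₂]
  · have h₃ := hM v
    have h₄ : env v * (P.eval M + 3) ≤ M * (P.eval M + 3) := Nat.mul_le_mul_right _ h₃
    have e : (Polynomial.X * (P + 3) + 1 + (3 * Polynomial.X + 1)).eval M =
        M * (P.eval M + 3) + 1 + (3 * M + 1) := by simp
    rw [e, Function.update_of_ne hvw.symm, Function.update_self]
    rw [show P.eval M + 1 + 2 = P.eval M + 3 from rfl]
    omega

end Emits

end ds


open Mach Turing

/-! ### Texts of gates that connect blocks of variables -/

section gateText

variable {r : ℕ}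

/-- The labels of the variables in block `i`, where each block consists of `B` variables. -/
def blockLabels (r B i : ℕ) : List (DescSym r) := (List.range B).flatMap fun b => unary (i * B + b)

/-- The description of a gate with given input blocks, output block and truth table. -/
def gateText (B B' : ℕ) (ins : List ℕ) (j : ℕ) (table : List (DescSym r)) : List (DescSym r) :=
  ins.flatMap (blockLabels r B) ++ [.semicolon] ++ blockLabels r B' j ++ [.semicolon] ++ table ++
    [.endGate]

/-- The value of a linear form, given by its constant term and a list of variables. -/
def linear (p : ℕ × List DsVar) (env : DsVar → ℕ) : ℕ := p.1 + (p.2.map env).sum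

theorem Emits.replicate_linear (p : ℕ × List DsVar) (B : ℕ) (hp : DsVar.j ∉ p.2) :
    Emits {.j} fun env => List.replicate (linear p env * B) (DescSym.one : DescSym r) := by
  obtain ⟨c, vs⟩ := p
  induction vs with
  | nil => simpa [linear] using Emits.const {.j} (List.replicate (c * B) (DescSym.one : DescSym r))
  | cons v vs ih =>
    have hv : v ≠ .j := fun h => hp (by simp [h])
    have h₁ := (Emits.const ∅ (List.replicate B (DescSym.one : DescSym r))).loop hv
      (Set.notMem_empty _) (Set.notMem_empty _) fun _ _ => rfl
    refine ((h₁.mono (by simp)).append (ih fun h => hp (by simp [h]))).congr fun env _ => ?_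
    rw [List.eq_replicate_iff]
    constructor
    · simp only [linear, List.length_append, List.length_flatMap, List.length_replicate,
        List.map_const', List.sum_replicate, List.length_range, smul_eq_mul, List.map_cons,
        List.sum_cons]
      ring
    · intro b hb
      simp only [List.mem_append, List.mem_flatMap, List.mem_replicate] at hb
      rcases hb with ⟨_, _, _, h⟩ | ⟨_, h⟩ <;> exact h

theorem Emits.labels (p : ℕ × List DsVar) (B : ℕ) (hp : DsVar.j ∉ p.2) :
    Emits {.j} fun env => blockLabels r B (linear p env) := by
  refine Emits.flatMap _ fun b => ?_
  refine (((Emits.replicate_linear p B hp).append (Emits.const {.j} (List.replicate b .one))).append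
    (Emits.const {.j} [.comma])).congr fun env _ => ?_
  rw [unary, List.replicate_add]

theorem Emits.gate (B B' : ℕ) (ins : List (ℕ × List DsVar)) (out : ℕ × List DsVar)
    (table : List (DescSym r)) (hi : ∀ p ∈ ins, DsVar.j ∉ p.2) (ho : DsVar.j ∉ out.2) :
    Emits {.j} fun env => gateText B B' (ins.map (linear · env)) (linear out env) table := by
  have h₁ : Emits {.j} fun env => (ins.map (linear · env)).flatMap (blockLabels r B) := by
    induction ins with
    | nil => exact Emits.const _ []
    | cons p ins ih =>
      simpa using (Emits.labels p B (hi p (by simp))).append (ih fun q hq => hi q (by simp [hq]))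
  exact ((((h₁.append (Emits.const _ [.semicolon])).append (Emits.labels out B' ho)).append
    (Emits.const _ [.semicolon])).append (Emits.const _ table)).append (Emits.const _ [.endGate])

end gateText

/-! ### Writing the text for each parameter -/

section arithmetic

variable {r : ℕ}

/-- Add a multiple of a variable to other variables. The variable is preserved with the help of the
counter `j`. -/
def addVar (x : DsVar) (ys : List DsVar) : Mach DsStk (DsΓ r) Unit :=
  seq (countDown x (ys.foldr (fun y A => seq (push (.var y) ()) A) (push (.var .j) ())))
    (moveVar .j x)

theorem runs_pushes (env : DsVar → ℕ) (o : List (DescSym r)) (ys : List DsVar) :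
    (ys.foldr (fun y A => seq (push (.var y) ()) A) (push (.var .j) ())).Runs (dsState r env o)
      (dsState r (fun z => env z + (ys ++ [DsVar.j]).count z) o) (ys.length + 1) := by
  induction ys generalizing env with
  | nil =>
    refine (runs_push_var env o .j).congr (congrArg (dsState r · o) ?_) (by simp)
    funext z
    by_cases h : z = .j
    · subst h; simp
    · simp [h, Ne.symm h]
  | cons y ys ih =>
    refine ((runs_push_var env o y).seq (ih _)).congr (congrArg (dsState r · o) ?_)
      (by simp; omega)
    funext z
    by_cases h : z = y
    · subst h; simp; omega
    · simp [h, Ne.symm h, List.count_cons]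

/-- A variable that occurs several times in the list `ys` receives the corresponding multiple. -/
theorem runs_addVar (env : DsVar → ℕ) (o : List (DescSym r)) (x : DsVar) (ys : List DsVar)
    (hx : x ≠ .j) (hxy : x ∉ ys) (hj : .j ∉ ys) (hj0 : env .j = 0) :
    (addVar x ys).Runs (dsState r env o)
      (dsState r (fun z => env z + ys.count z * env x) o)
      (env x * (ys.length + 6) + 2) := by
  have h₁ := runs_countDown (r := r) x
    (A := ys.foldr (fun y A => seq (push (.var y) ()) A) (push (.var .j) ()))
    (T := ys.length + 1) (env x)
    (fun i => Function.update (fun z => env z + (ys ++ [DsVar.j]).count z * i) x (env x - i))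
    (fun _ => o) (by simp) (fun i hi => by
      refine (runs_pushes _ o ys).congr (congrArg (dsState r · o) ?_) le_rfl
      funext z
      by_cases hz : z = x
      · subst hz
        simp [List.count_eq_zero_of_not_mem hxy, Ne.symm hx, Nat.sub_sub]
      · simp [hz]; ring)
  have h₂ := runs_moveVar (r := r) hx.symm
    (Function.update (fun z => env z + (ys ++ [DsVar.j]).count z * env x) x (env x - env x)) o
  have e : Function.update (fun z => env z + (ys ++ [DsVar.j]).count z * 0) x (env x - 0) = env := by
    simp
  rw [e] at h₁
  refine (h₁.seq h₂).congr (congrArg (dsState r · o) ?_) ?_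
  · funext z
    by_cases hz : z = .j
    · subst hz; simp [List.count_eq_zero_of_not_mem hj, hj0]
    · by_cases hz' : z = x
      · subst hz'
        simp [hz, hx.symm, List.count_eq_zero_of_not_mem hj, hj0,
          List.count_eq_zero_of_not_mem hxy]
      · simp [hz, hz', Ne.symm hz]
  · simp [hx.symm, List.count_eq_zero_of_not_mem hj, hj0]
    ring_nf
    omega

/-- The values of the variables when a text is written. -/
def dsEnv (n N T W : ℕ) : DsVar → ℕ
  | .n => n
  | .N => N
  | .T => T
  | .W => W
  | _ => 0

/-- Multiply `N` by `n + 1`. -/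
def multiply : Mach DsStk (DsΓ r) Unit :=
  seq (countDown .N (seq (addVar .n [.T]) (push (.var .T) ()))) (moveVar .T .N)

theorem runs_multiply (n N : ℕ) (o : List (DescSym r)) :
    multiply.Runs (dsState r (dsEnv n N 0 0) o) (dsState r (dsEnv n (N * (n + 1)) 0 0) o)
      (N * (n * 7 + 5) + 3 * (N * (n + 1)) + 2) := by
  have h₁ := runs_countDown (r := r) .N (A := seq (addVar .n [.T]) (push (.var .T) ()))
    (T := n * 7 + 3) N (fun i => dsEnv n (N - i) (i * (n + 1)) 0) (fun _ => o)
    (fun i _ => rfl) (fun i hi => by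
      refine (Runs.seq (runs_addVar _ o .n [.T] (by simp) (by simp) (by simp) rfl)
        (runs_push_var _ o .T)).congr (congrArg (dsState r · o) ?_) le_rfl
      funext z
      cases z <;> simp [dsEnv] <;> first | omega | ring)
  have h₂ := runs_moveVar (r := r) (x := .T) (y := .N) (by simp)
    (dsEnv n (N - N) (N * (n + 1)) 0) o
  simp only [Nat.sub_zero, Nat.zero_mul] at h₁
  refine (h₁.seq h₂).congr (congrArg (dsState r · o) ?_) ?_
  · funext z
    cases z <;> simp [dsEnv]
  · simp only [dsEnv]
    rw [show n * 7 + 3 + 2 = n * 7 + 5 from rfl]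
    omega

/-- The number `c * (n + 1) ^ d` can be written on the stack `N` in polynomial time. -/
theorem exists_power (c d : ℕ) : ∃ (A : Mach DsStk (DsΓ r) Unit) (P : Polynomial ℕ), ∀ n o,
    A.Runs (dsState r (dsEnv n 0 0 0) o) (dsState r (dsEnv n (c * (n + 1) ^ d) 0 0) o)
      (P.eval n) := by
  induction d with
  | zero =>
    refine ⟨pushList (.var .N) (List.replicate c ()), Polynomial.C c, fun n o => ?_⟩
    refine (runs_pushList (.var .N) (List.replicate c ()) (dsState r (dsEnv n 0 0 0) o)).congr ?_
      (List.length_replicate.trans Polynomial.eval_C.symm).le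
    refine congrArg (fun S => MState.mk S _ _ _) ?_
    refine Eq.trans (congrArg _ ?_) ((update_dsStk_var (dsEnv n 0 0 0) o .N c).trans ?_)
    · exact (List.append_nil _).trans List.reverse_replicate
    · refine congrArg (dsStk r · o) ?_
      funext z
      cases z <;> simp [dsEnv]
  | succ d ih =>
    obtain ⟨A, P, h⟩ := ih
    let Q : Polynomial ℕ := Polynomial.C c * (Polynomial.X + 1) ^ d
    refine ⟨seq A multiply, P + (Q * (Polynomial.X * 7 + 5) + 3 * (Q * (Polynomial.X + 1)) + 2),
      fun n o => ?_⟩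
    refine ((h n o).seq (runs_multiply n _ o)).congr (congrArg (dsState r · o) ?_) ?_
    · rw [pow_succ, Nat.mul_assoc]
    · simp [Q]

/-- Set `T` to `N` and `W` to `2 N + n + 2`. -/
def setWidth : Mach DsStk (DsΓ r) Unit :=
  seq (addVar .N [.T, .W, .W]) (seq (addVar .n [.W]) (seq (push (.var .W) ()) (push (.var .W) ())))

theorem runs_setWidth (n N : ℕ) (o : List (DescSym r)) :
    setWidth.Runs (dsState r (dsEnv n N 0 0) o) (dsState r (dsEnv n N N (2 * N + n + 2)) o)
      (9 * N + 7 * n + 6) := by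
  have h₁ := runs_addVar (r := r) (dsEnv n N 0 0) o .N [.T, .W, .W] (by simp) (by simp) (by simp) rfl
  have h₂ := runs_addVar (r := r) (dsEnv n N N (2 * N)) o .n [.W] (by simp) (by simp) (by simp) rfl
  have h₃ := (runs_push_var (r := r) (dsEnv n N N (2 * N + n)) o .W)
  have h₄ := (runs_push_var (r := r) (dsEnv n N N (2 * N + n + 1)) o .W)
  have e₁ : (fun z => dsEnv n N 0 0 z + [DsVar.T, .W, .W].count z * dsEnv n N 0 0 .N) =
      dsEnv n N N (2 * N) := by
    funext z; cases z <;> simp [dsEnv]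
  have e₂ : (fun z => dsEnv n N N (2 * N) z + [DsVar.W].count z * dsEnv n N N (2 * N) .n) =
      dsEnv n N N (2 * N + n) := by
    funext z; cases z <;> simp [dsEnv]
  have e₃ : ∀ a, Function.update (dsEnv n N N a) .W (dsEnv n N N a .W + 1) = dsEnv n N N (a + 1) := by
    intro a; funext z; cases z <;> simp [dsEnv]
  rw [e₁] at h₁
  rw [e₂] at h₂
  rw [e₃] at h₃ h₄
  refine (h₁.seq (h₂.seq (h₃.seq h₄))).mono ?_
  simp only [dsEnv, List.length_cons, List.length_nil]
  omega

/-- Two updates, at places that may coincide, are recognized by their values. -/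
theorem update_update_eq {K : Type} [DecidableEq K] {A : K → Type} (S R : ∀ k, A k) {a b : K}
    {x : A a} {y : A b} (ha : R a = x) (hb : a ≠ b → R b = y)
    (h : ∀ k, k ≠ a → k ≠ b → R k = S k) :
    Function.update (Function.update S b y) a x = R := by
  funext k
  rcases eq_or_ne k a with rfl | hk
  · simp [ha]
  · rcases eq_or_ne k b with rfl | hk'
    · simp [hk, hb hk.symm]
    · simp [hk, hk', h k hk hk']

/-- A single nonempty stack. -/
def oneStk (k : DsStk) (x : List (DsΓ r k)) : ∀ k, List (DsΓ r k) := Function.update (fun _ => []) k x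

theorem oneStk_self (k : DsStk) (x : List (DsΓ r k)) : oneStk k x k = x := Function.update_self _ _ _

theorem oneStk_of_ne {k k' : DsStk} (x : List (DsΓ r k)) (h : k' ≠ k) : oneStk k x k' = [] :=
  Function.update_of_ne h _ _

theorem runs_clearVar (env : DsVar → ℕ) (o : List (DescSym r)) (x : DsVar) :
    (clear (.var x)).Runs (dsState r env o) (dsState r (Function.update env x 0) o)
      (2 * env x + 1) := by
  refine (runs_clear (Γ := DsΓ r) (DsStk.var x) (dsState r env o)).congr
    (congrArg (fun S => MState.mk S (Stream'.const false) [] 1)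
      (show Function.update (dsStk r env o) (.var x) [] = _ from update_dsStk_var env o x 0)) ?_
  exact (congrArg (2 * · + 1) (List.length_replicate (n := env x) (a := ()))).le

/-- A text that can be written with loops over the parameter and numbers that are polynomial in the
parameter is computable in polynomial time. -/
theorem computable_of_emits (c d : ℕ) {g : (DsVar → ℕ) → List (DescSym r)}
    (hg : Emits {.i, .j, .t} g) (F : ℕ → List (DescSym r))
    (hF : ∀ n, F n = g (dsEnv n (c * (n + 1) ^ d) (c * (n + 1) ^ d) (2 * (c * (n + 1) ^ d) + n + 2))) :
    Nonempty (TM2ComputableInPolyTime Computability.unaryEncodeNat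
      (id : List (DescSym r) → List (DescSym r)) F) := by
  obtain ⟨A, P, hA⟩ := hg
  obtain ⟨A', P', hA'⟩ := exists_power (r := r) c d
  let Q : Polynomial ℕ := Polynomial.C c * (Polynomial.X + 1) ^ d
  let V : Polynomial ℕ := 2 * Q + Polynomial.X + 2
  let M : Mach DsStk (DsΓ r) Unit := seq (move .inp (.var .n) fun _ => ()) (seq A' (seq setWidth
    (seq A (seq (clear (.var .n)) (seq (clear (.var .N)) (seq (clear (.var .T))
      (seq (clear (.var .W)) (move .out .res id))))))))
  let R : Polynomial ℕ := (3 * Polynomial.X + 1) + P' + (9 * Q + 7 * Polynomial.X + 6) + P.comp V +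
      (2 * Polynomial.X + 1) + (2 * Q + 1) + (2 * Q + 1) + (2 * V + 1) + (3 * P.comp V + 1)
  have hQ : ∀ n, Q.eval n = c * (n + 1) ^ d := fun n => by simp [Q]
  have hV : ∀ n, V.eval n = 2 * Q.eval n + n + 2 := fun n => by simp [V]
  let _ : Fintype DsStk := Fintype.ofFinite _
  let _ : Fintype (DsΓ r .inp) := (inferInstance : Fintype Bool)
  refine ⟨⟨⟨M.toTM2 .inp .res, Equiv.refl _, Equiv.refl _⟩,
    R + 1,
    fun n => Classical.choice ?_⟩⟩
  have hlen : (Computability.unaryEncodeNat n).length = n :=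
    Computability.unary_decode_encode_nat n
  set N := Q.eval n with hN
  rw [hQ] at hN
  have h₁ : (move .inp (.var .n) fun _ => () : Mach DsStk (DsΓ r) Unit).Runs
      ⟨oneStk .inp (Computability.unaryEncodeNat n), Stream'.const false, [], 1⟩ (dsState r (dsEnv n 0 0 0) []) (3 * n + 1) := by
    refine (runs_move (Γ := DsΓ r) (k := .inp) (k' := .var .n) (by simp) (fun _ => ()) _).congr
      (congrArg (fun S => MState.mk S (Stream'.const false) [] 1)
        (update_update_eq _ (dsStk r (dsEnv n 0 0 0) []) rfl (fun _ => ?_) fun k hk hk' => ?_)) ?_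
    · refine Eq.symm ((List.append_nil _).trans
        ((congrArg (fun l => (List.map (fun _ => ()) l).reverse) (oneStk_self .inp _)).trans ?_))
      exact List.eq_replicate_iff.2 ⟨(List.length_reverse.trans (List.length_map _)).trans
        ((congrArg List.length (oneStk_self .inp _)).trans hlen), fun _ _ => rfl⟩
    · refine Eq.trans ?_ (oneStk_of_ne _ hk).symm
      cases k with
      | var x => cases x <;> first | exact absurd rfl hk' | rfl
      | _ => rfl
    · exact (congrArg (3 * · + 1) ((congrArg List.length (oneStk_self .inp _)).trans hlen)).le
  have h₂ := hA' n []
  rw [← hN] at h₂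
  have h₃ := runs_setWidth (r := r) n N []
  have h₄ := hA (dsEnv n N N (2 * N + n + 2)) [] (V.eval n)
    (by rintro z (rfl | rfl | rfl) <;> rfl) (fun x => by
      rw [hV]; cases x <;> simp [dsEnv] <;> omega)
  have hgl : (g (dsEnv n N N (2 * N + n + 2))).length ≤ P.eval (V.eval n) := by
    have := h₄.length_le .out
    replace this : ((g (dsEnv n N N (2 * N + n + 2))).reverse ++ []).length ≤
      ([] : List (DescSym r)).length + P.eval (V.eval n) := this
    simpa using this
  rw [List.append_nil] at h₄
  generalize hG : g (dsEnv n N N (2 * N + n + 2)) = o at h₄ hgl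
  have h₅ : (clear (.var .n)).Runs (dsState r (dsEnv n N N (2 * N + n + 2)) o.reverse)
      (dsState r (dsEnv 0 N N (2 * N + n + 2)) o.reverse) (2 * n + 1) :=
    (runs_clearVar _ _ _).congr (congrArg (dsState r · _)
      (funext fun z => by cases z <;> simp [dsEnv])) le_rfl
  have h₆ : (clear (.var .N)).Runs (dsState r (dsEnv 0 N N (2 * N + n + 2)) o.reverse)
      (dsState r (dsEnv 0 0 N (2 * N + n + 2)) o.reverse) (2 * N + 1) :=
    (runs_clearVar _ _ _).congr (congrArg (dsState r · _)
      (funext fun z => by cases z <;> simp [dsEnv])) le_rfl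
  have h₇ : (clear (.var .T)).Runs (dsState r (dsEnv 0 0 N (2 * N + n + 2)) o.reverse)
      (dsState r (dsEnv 0 0 0 (2 * N + n + 2)) o.reverse) (2 * N + 1) :=
    (runs_clearVar _ _ _).congr (congrArg (dsState r · _)
      (funext fun z => by cases z <;> simp [dsEnv])) le_rfl
  have h₈ : (clear (.var .W)).Runs (dsState r (dsEnv 0 0 0 (2 * N + n + 2)) o.reverse)
      (dsState r (fun _ => 0) o.reverse) (2 * (2 * N + n + 2) + 1) :=
    (runs_clearVar _ _ _).congr (congrArg (dsState r · _)
      (funext fun z => by cases z <;> simp [dsEnv])) le_rfl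
  have h₉ := runs_move (Γ := DsΓ r) (G := Unit) (k := .out) (k' := .res) (by simp) id
    (dsState r (fun _ => 0) o.reverse)
  have hfin : Function.update (Function.update (dsStk r (fun _ => 0) o.reverse) DsStk.res
      ((List.map id o.reverse).reverse ++ [])) DsStk.out [] =
        oneStk .res o := by
    refine update_update_eq _ _ rfl (fun _ => ?_) fun k hk hk' => ?_
    · refine (oneStk_self .res o).trans (Eq.symm ((List.append_nil _).trans ?_))
      rw [List.map_id, List.reverse_reverse]
    · refine (oneStk_of_ne _ hk').trans ?_
      cases k <;> first | exact absurd rfl hk | rfl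
  have hrun := h₁.seq (h₂.seq (h₃.seq (h₄.seq (h₅.seq (h₆.seq (h₇.seq (h₈.seq h₉)))))))
  have hol : ((dsState r (fun _ => 0) o.reverse).stk .out).length = o.length :=
    List.length_reverse
  have hout := toTM2_outputs M .inp .res (x := Computability.unaryEncodeNat n) (y := o)
    (hrun.mono (T' := R.eval n) (by
      simp only [R, hQ, hV, ← hN, Polynomial.eval_add, Polynomial.eval_mul, Polynomial.eval_comp,
        Polynomial.eval_X, Polynomial.eval_ofNat, Polynomial.eval_one] at hgl ⊢
      rw [hol]
      omega)) rfl rfl hfin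
  have hFo : F n = o := by rw [hF n, ← hN, hG]
  have e₁ : ∀ l : List Bool, l.map (Equiv.refl Bool).invFun = l := fun l => List.map_id l
  have e₂ : ∀ l : List (DescSym r), l.map (Equiv.refl (DescSym r)).invFun = l :=
    fun l => List.map_id l
  have e₃ : R.eval n + 1 = (R + 1).eval (Computability.unaryEncodeNat n).length := by
    rw [hlen]
    exact ((Polynomial.eval_add (p := R) (q := 1)).trans
      (congrArg (R.eval n + ·) Polynomial.eval_one)).symm
  rw [← hFo, ← e₁ (Computability.unaryEncodeNat n), ← e₂ (F n), e₃] at hout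
  exact hout

end arithmetic


/-! ### Levels whose gates connect blocks of variables -/

/-- The restriction to vectors of positive degree may be dropped, and the minimum over the gates be
taken before the minimum with the degree of the vector. -/
theorem Circuit.eval_layer_le_iff {n c d : ℕ} (C : FuzzyCircuit n c) (L : Level I c d)
    (s : FuzzySet (Fin n → Bool)) (w : Fin d → Bool) (u : I) :
    (C.layer L).eval s w ≤ u ↔ ∀ v, min (C.eval s v) (⨅ k, (L.gate k).fn
      (fun i => v ((L.gate k).inVar i)) fun j => w ((L.gate k).outVar j)) ≤ u := by
  have : Nonempty (Fin L.numGates) := ⟨⟨0, L.numGates_pos⟩⟩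
  have hval : ∀ v : Fin c → Bool, (⨅ k : Fin L.numGates, mu1 (C.eval s v)
      ((L.gate k).fn (fun i => v ((L.gate k).inVar i)) fun j => w ((L.gate k).outVar j))) =
      min (C.eval s v) (⨅ k, (L.gate k).fn
        (fun i => v ((L.gate k).inVar i)) fun j => w ((L.gate k).outVar j)) :=
    fun v => inf_iInf.symm
  refine iSup_le_iff.trans ⟨fun h v => ?_, fun h v => (hval v.1).trans_le (h v.1)⟩
  by_cases hv : 0 < C.eval s v
  · exact (hval v).symm.trans_le (h ⟨v, hv⟩)
  · rw [le_antisymm (not_lt.1 hv) unitInterval.nonneg']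
    exact (min_le_left _ _).trans unitInterval.nonneg'

section blocks

variable {K E : Type} {B B' c d : ℕ}

/-- The `i`-th block of `B` bits. -/
def block {m : ℕ} (v : Fin (m * B) → Bool) (i : Fin m) : Fin B → Bool :=
  fun b => v (finProdFinEquiv (i, b))

/-- The bit vector with given blocks. -/
def ofBlocks {m : ℕ} (x : Fin m → Fin B → Bool) : Fin (m * B) → Bool :=
  fun z => x (finProdFinEquiv.symm z).1 (finProdFinEquiv.symm z).2

theorem block_ofBlocks {m : ℕ} (x : Fin m → Fin B → Bool) (i : Fin m) :
    block (ofBlocks x) i = x i := by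
  funext b
  simp [block, ofBlocks]

theorem ofBlocks_eq_iff {m : ℕ} {x : Fin m → Fin B → Bool} {v : Fin (m * B) → Bool} :
    ofBlocks x = v ↔ ∀ i, x i = block v i := by
  refine ⟨fun h i => by rw [← h, block_ofBlocks], fun h => funext fun z => ?_⟩
  rw [ofBlocks, h, block, Prod.mk.eta, Equiv.apply_symm_apply]

/-- A gate that reads `a` blocks of `B` variables and determines a block of `B'` variables. -/
structure BlockGate (K : Type) (B B' c : ℕ) where
  a : ℕ
  ins : Fin a ↪ Fin c
  fn : (Fin a → Fin B → Bool) → (Fin B' → Bool) → K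

/-- The gate that determines the `j`-th block. -/
def BlockGate.gate (G : BlockGate K B B' c) (j : Fin d) : Gate K (c * B) (d * B') where
  a := G.a * B
  b := B'
  inVar := (finProdFinEquiv.symm.toEmbedding.trans
    (G.ins.prodMap (Function.Embedding.refl _))).trans finProdFinEquiv.toEmbedding
  outVar := ⟨fun b => finProdFinEquiv (j, b), fun b b' h => by simpa using h⟩
  fn := fun v w => G.fn (block v) w

theorem BlockGate.gate_inVar (G : BlockGate K B B' c) (j : Fin d) (i : Fin G.a) (b : Fin B) :
    (G.gate j).inVar (finProdFinEquiv (i, b)) = finProdFinEquiv (G.ins i, b) :=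
  congrArg (fun p => finProdFinEquiv (Prod.map G.ins id p)) (finProdFinEquiv.symm_apply_apply (i, b))

/-- A level that consists of one gate for each block. -/
def blockLevel (hd : 0 < d) (G : Fin d → BlockGate K B B' c) : Level K (c * B) (d * B') where
  numGates := d
  numGates_pos := hd
  gate := fun j => (G j).gate j
  existsUnique_out := fun z => by
    refine ⟨⟨(finProdFinEquiv.symm z).1, (finProdFinEquiv.symm z).2⟩, ?_, ?_⟩
    · exact Equiv.apply_symm_apply _ _
    · rintro ⟨j, b⟩ h
      obtain ⟨rfl, rfl⟩ := Prod.ext_iff.1 ((Equiv.symm_apply_eq _).2 (Eq.symm h))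
      rfl

theorem blockLevel_value (hd : 0 < d) (G : Fin d → BlockGate I B B' c) (v : Fin (c * B) → Bool)
    (w : Fin (d * B') → Bool) (j : Fin d) : ((blockLevel hd G).gate j).fn
      (fun i => v (((blockLevel hd G).gate j).inVar i))
      (fun b => w (((blockLevel hd G).gate j).outVar b)) =
        (G j).fn (fun i => block v ((G j).ins i)) (block w j) := by
  change (G j).fn (block fun i => v (((G j).gate j).inVar i)) _ = _
  congr 1
  funext i b
  exact congrArg v ((G j).gate_inVar j i b)

/-- The degree of a transition between bit vectors. -/
noncomputable def blockValue (G : Fin d → BlockGate I B B' c) (v : Fin (c * B) → Bool)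
    (w : Fin (d * B') → Bool) : I := ⨅ j, (G j).fn (fun i => block v ((G j).ins i)) (block w j)

theorem Circuit.eval_blockLevel_le_iff {n : ℕ} (C : FuzzyCircuit n (c * B)) (hd : 0 < d)
    (G : Fin d → BlockGate I B B' c) (s : FuzzySet (Fin n → Bool)) (w : Fin (d * B') → Bool)
    (u : I) : (C.layer (blockLevel hd G)).eval s w ≤ u ↔
      ∀ v, min (C.eval s v) (blockValue G v w) ≤ u := by
  rw [Circuit.eval_layer_le_iff]
  have h : ∀ v, (⨅ k, ((blockLevel hd G).gate k).fn
      (fun i => v (((blockLevel hd G).gate k).inVar i))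
      (fun b => w (((blockLevel hd G).gate k).outVar b))) = blockValue G v w :=
    fun v => iInf_congr (blockLevel_value hd G v w)
  simp only [h]

/-- The truth table of a gate between blocks. -/
def blockTable {r a : ℕ} (fn : (Fin a → Fin B → Bool) → (Fin B' → Bool) → Fin r) :
    List (DescSym r) :=
  (List.range (2 ^ (a * B))).flatMap fun x =>
    (List.range (2 ^ B')).map fun y => DescSym.deg (fn (block (bits (a * B) x)) (bits B' y))

theorem ofFn_label {r m : ℕ} (i : Fin m) :
    (List.ofFn fun b : Fin B => unary (r := r) (finProdFinEquiv (i, b) : Fin (m * B))).flatten =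
      blockLabels r B i := by
  rw [blockLabels, List.flatMap_def, ← List.map_coe_finRange_eq_range, List.map_map,
    ← List.ofFn_eq_map]
  congr 2
  funext b
  simp only [Function.comp_apply, finProdFinEquiv_apply_val]
  congr 1
  ring

theorem BlockGate.describe_gate {r : ℕ} (G : BlockGate (Fin r) B B' c) (j : Fin d) :
    (G.gate j).describe = gateText B B' (List.ofFn fun i => (G.ins i : ℕ)) j (blockTable G.fn) := by
  have h : (List.ofFn fun i => unary (r := r) ((G.gate j).inVar i : ℕ)).flatten =
      (List.ofFn fun i => (G.ins i : ℕ)).flatMap (blockLabels r B) := by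
    refine (congrArg List.flatten (ofFn_eq_flatten (m := G.a) (k := B) _)).trans ?_
    rw [List.flatten_flatten, List.map_ofFn, List.flatMap_def, List.map_ofFn]
    congr 2
    funext i
    refine Eq.trans (congrArg List.flatten (congrArg List.ofFn (funext fun b => ?_)))
      (ofFn_label (G.ins i))
    exact congrArg (fun x : Fin (c * B) => unary (x : ℕ)) (G.gate_inVar j i b)
  rw [Gate.describe, h]
  refine congrArg (fun l => _ ++ [DescSym.semicolon] ++ l ++ [DescSym.semicolon] ++ _ ++
    [DescSym.endGate]) (ofFn_label j)

theorem Circuit.describe_blockLevel {r n : ℕ} (C : Circuit (Fin r) n (c * B)) (hd : 0 < d)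
    (G : Fin d → BlockGate (Fin r) B B' c) (tx : ℕ → List (DescSym r))
    (h : ∀ j : Fin d, gateText B B' (List.ofFn fun i => ((G j).ins i : ℕ)) j
      (blockTable (G j).fn) = tx j) : (C.layer (blockLevel hd G)).describe =
      C.describe ++ (List.range d).flatMap tx ++ [DescSym.endLevel] := by
  rw [Circuit.describe]
  congr 2
  rw [List.flatMap_def, ← List.map_coe_finRange_eq_range, List.map_map, ← List.ofFn_eq_map]
  refine congrArg List.flatten (congrArg List.ofFn (funext fun j => ?_))
  exact ((G j).describe_gate j).trans (h j)

/-- A partial function on blocks. -/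
structure BlockMap (B B' c : ℕ) where
  a : ℕ
  ins : Fin a ↪ Fin c
  map : (Fin a → Fin B → Bool) → Option (Fin B' → Bool)

/-- The value of a partial function at the blocks of a bit vector. -/
def BlockMap.apply (g : BlockMap B B' c) (v : Fin (c * B) → Bool) : Option (Fin B' → Bool) :=
  g.map fun i => block v (g.ins i)

/-- The gate for a partial function: degree `1` at the value, `0` elsewhere. The names of these
degrees are `some none` and `none`. -/
def BlockMap.toGate (κ : Option (Option E) → K) (g : BlockMap B B' c) : BlockGate K B B' c :=
  ⟨g.a, g.ins, fun v w => κ (if g.map v = some w then some none else none)⟩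

/-- The fuzzy constant that takes the code of each `e` with the degree that is named after `e`. -/
def guessGate (κ : Option (Option E) → K) (dec : (Fin B' → Bool) → Option (Option E)) :
    BlockGate K B B' c :=
  ⟨0, Function.Embedding.ofIsEmpty, fun _ w => κ (dec w)⟩

/-- The value that is named by an element of `Option (Option E)`. -/
def degree (weight : Option E → I) : Option (Option E) → I
  | none => 0
  | some e => weight e

/-- The gates of a level, the zeroth of which guesses while the others apply partial functions. -/
def guessGates (κ : Option (Option E) → K) (dec : (Fin B' → Bool) → Option (Option E))
    (g : ℕ → BlockMap B B' c) (j : Fin d) : BlockGate K B B' c :=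
  if (j : ℕ) = 0 then guessGate κ dec else (g j).toGate κ

theorem BlockMap.toGate_fn (weight : Option E → I) (h1 : weight none = 1) (g : BlockMap B B' c)
    (v : Fin (c * B) → Bool) (w : Fin B' → Bool) :
    (g.toGate (degree weight)).fn (fun i => block v (g.ins i)) w =
      if g.apply v = some w then 1 else 0 := by
  change degree weight (if g.apply v = some w then some none else none) = _
  split_ifs
  · exact h1
  · rfl

theorem blockValue_toGate (weight : Option E → I) (h1 : weight none = 1)
    (g : Fin d → BlockMap B B' c) (v : Fin (c * B) → Bool) (w : Fin (d * B') → Bool) :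
    blockValue (fun j => (g j).toGate (degree weight)) v w =
      open Classical in if ∀ j, (g j).apply v = some (block w j) then 1 else 0 := by
  split_ifs with h
  · exact le_antisymm unitInterval.le_one' (le_iInf fun j =>
      (((g j).toGate_fn weight h1 v _).trans (if_pos (h j))).ge)
  · obtain ⟨j, hj⟩ := not_forall.1 h
    exact le_antisymm ((iInf_le _ j).trans
      (((g j).toGate_fn weight h1 v _).trans (if_neg hj)).le) unitInterval.nonneg'

theorem blockValue_guessGates (weight : Option E → I) (h1 : weight none = 1)
    (dec : (Fin B' → Bool) → Option (Option E))
    (g : ℕ → BlockMap B B' c) (v : Fin (c * B) → Bool) (w : Fin (d * B') → Bool) (hd : 0 < d) :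
    blockValue (guessGates (degree weight) dec g) v w =
      open Classical in
      if ∀ j : Fin d, (j : ℕ) ≠ 0 → (g j).apply v = some (block w j) then
        degree weight (dec (block w ⟨0, hd⟩)) else 0 := by
  have key : ∀ j : Fin d, (j : ℕ) ≠ 0 →
      (guessGates (d := d) (degree weight) dec g j).fn (fun i => block v
        ((guessGates (d := d) (degree weight) dec g j).ins i)) (block w j) =
          if (g j).apply v = some (block w j) then 1 else 0 := by
    intro j hj
    rw [guessGates, if_neg hj]
    exact (g j).toGate_fn weight h1 v _
  have key' : (guessGates (c := c) (B := B) (d := d) (degree weight) dec g ⟨0, hd⟩).fn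
      (fun i => block v ((guessGates (d := d) (degree weight) dec g ⟨0, hd⟩).ins i))
        (block w ⟨0, hd⟩) = degree weight (dec (block w ⟨0, hd⟩)) := rfl
  split_ifs with h
  · refine le_antisymm ((iInf_le _ ⟨0, hd⟩).trans key'.le) (le_iInf fun j => ?_)
    by_cases hj : (j : ℕ) = 0
    · obtain rfl : j = ⟨0, hd⟩ := Fin.ext hj
      exact key'.ge
    · exact unitInterval.le_one'.trans ((key j hj).trans (if_pos (h j hj))).ge
  · simp only [not_forall] at h
    obtain ⟨j, hj, h⟩ := h
    exact le_antisymm ((iInf_le _ j).trans ((key j hj).trans (if_neg h)).le) unitInterval.nonneg'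

end blocks


/-! ### Circuits that simulate a fuzzy Turing machine -/

instance : Finite AuxSym :=
  Finite.of_injective (fun a : AuxSym => match a with
    | .cent => (0 : Fin 4) | .dollar => 1 | .one => 2 | .blank => 3)
    fun a b h => by cases a <;> cases b <;> simp_all

namespace DFTM

variable {Δ Γ : Type} (M : DFTM Δ Γ)

/-- A guess made at one step: to idle (`none`), or the state and the scanned symbols, together with
a move. -/
abbrev Guess : Type :=
  Option (M.Q × M.S × AuxSym × (M.Q × M.S × Option Γ × SignType × SignType))

/-- The degree of a guess. -/
noncomputable def weight : M.Guess → I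
  | none => 1
  | some (q, σ₁, τ, m) => open Classical in if h : q ∉ M.F then M.δ ⟨q, h⟩ σ₁ τ m else 0

/-- The content of a cell. A symbol `none` on the work tape stands for a symbol that follows from
that on the left: `$` next to a known symbol, blank otherwise. An output symbol `none` means that
the end of the output lies further left; `some none` serves as the left end of the output tape. -/
structure Cell where
  work : Option M.S
  st : Option M.Q
  aux : AuxSym
  ah : Bool
  out : Option (Option Γ)

instance [Finite Γ] : Finite M.Cell :=
  have := M.finite_Q
  have := M.finite_S
  Finite.of_injective (fun z : M.Cell => (z.work, z.st, z.aux, z.ah, z.out)) fun a b h => by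
    cases a; cases b; simpa using h

instance [Finite Γ] : Finite M.Guess :=
  have := M.finite_Q
  have := M.finite_S
  inferInstance

variable {M}

/-- The symbol on the work tape in a cell, given its left neighbour. -/
def Cell.content (y z : M.Cell) : M.S := z.work.getD (if y.work.isSome then M.dollar else M.blank)

/-- The cell from which a head comes by a move. -/
def Cell.source (d : SignType) (y z x : M.Cell) : M.Cell :=
  match d with
  | .pos => y
  | .zero => z
  | .neg => x

open Classical in
/-- The content of a cell after a step, where `y` and `x` are its left and right neighbours. There
is none when the guess does not agree with the cell. -/
noncomputable def Cell.next (e : M.Guess) (y z x : M.Cell) : Option M.Cell :=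
  match e with
  | none => some { z with work := some (y.content z) }
  | some (q, σ₁, τ, m) =>
    if (∀ q' ∈ z.st, q' = q ∧ y.content z = σ₁) ∧ (z.ah = true → z.aux = τ) then
      some {
        work := some (if z.st.isSome then m.2.1 else y.content z)
        st := if (Cell.source m.2.2.2.1 y z x).st.isSome then some m.1 else none
        aux := z.aux
        ah := (Cell.source m.2.2.2.2 y z x).ah
        out := if z.out.isNone ∧ y.out.isSome then m.2.2.1.map some else z.out }
    else none

variable (M)

/-- The cells beyond both ends. -/
def padCell : M.Cell := ⟨some M.blank, none, .blank, false, some none⟩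

/-- An initial cell outside the input, except for the two endmarkers. -/
def blankCell : M.Cell := ⟨some M.blank, none, .blank, false, none⟩

/-- The initial cell `0`, where both heads are. -/
def centCell : M.Cell := ⟨some M.cent, some M.q₀, .cent, true, none⟩

/-- The initial cell that follows the space for the input. It contains `$` or a blank, depending on the
length of the input. -/
def pendingCell : M.Cell := ⟨none, none, .dollar, false, none⟩

/-- An initial cell in the space for the input. At the end of the input and beyond it, the symbol is not
known from the code of the symbol at this position alone. -/
def inputCell (o : Option Δ) : M.Cell := ⟨o.map M.inp, none, .one, false, none⟩

variable {M}

open Classical in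
/-- The content of the block `j` that represents a part of the configuration `c`. Cell `0` of the
tapes is in block `N + 2`. The symbols at the positions in `P` are left undetermined. -/
noncomputable def cellAt (n N : ℕ) (P : Set ℤ) (c : M.Config) (j : ℕ) : M.Cell :=
  if j = 1 ∨ 2 * N + n + 4 ≤ j then M.padCell else
    { work := if (j : ℤ) - (N + 2) ∈ P then none else some (c.tape (j - (N + 2)))
      st := if c.head = j - (N + 2) then some c.state else none
      aux := auxTape n (j - (N + 2))
      ah := decide (c.auxHead = j - (N + 2))
      out := c.out[j - 2]?.map some }

/-- The guess agrees with the configuration. -/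
def Agrees (n : ℕ) (e : M.Guess) (c : M.Config) : Prop :=
  ∀ q σ₁ τ m, e = some (q, σ₁, τ, m) →
    c.state = q ∧ c.tape c.head = σ₁ ∧ auxTape n c.auxHead = τ

/-- The configuration after the guess. -/
def step (e : M.Guess) (c : M.Config) : M.Config :=
  match e with
  | none => c
  | some (_, _, _, m) => M.next c m

/-- The positions and the length of the output are bounded. -/
structure Config.Bounded (c : M.Config) (t : ℕ) : Prop where
  head : |c.head| ≤ t
  auxHead : |c.auxHead| ≤ t
  out : c.out.length ≤ t

/-- The symbols at the positions in `P` follow from those on the left. -/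
def Determined (P : Set ℤ) (c : M.Config) : Prop :=
  open Classical in
  ∀ i ∈ P, 1 ≤ i ∧ c.tape i = if i - 1 ∈ P then M.blank else M.dollar

theorem abs_signType_le (d : SignType) : |(d : ℤ)| ≤ 1 := by cases d <;> simp

theorem Config.Bounded.step {c : M.Config} {t : ℕ} (h : c.Bounded t) (e : M.Guess) :
    (step e c).Bounded (t + 1) := by
  obtain ⟨h₁, h₂, h₃⟩ := h
  rcases e with _ | ⟨q, σ₁, τ, p, s, η, d₁, d₂⟩
  · exact ⟨h₁.trans (by simp), h₂.trans (by simp), h₃.trans (by simp)⟩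
  · refine ⟨?_, ?_, ?_⟩
    · exact (abs_add_le _ _).trans (by have := abs_signType_le d₁; push_cast; omega)
    · exact (abs_add_le _ _).trans (by have := abs_signType_le d₂; push_cast; omega)
    · have : η.toList.length ≤ 1 := by cases η <;> simp
      simp only [DFTM.step, next, List.length_append]
      omega

theorem cellAt_of_mem {n N j : ℕ} (P : Set ℤ) (c : M.Config) (h₁ : j ≠ 1) (h₂ : j < 2 * N + n + 4) :
    open Classical in cellAt n N P c j = 
    { work := if (j : ℤ) - (N + 2) ∈ P then none else some (c.tape (j - (N + 2)))
      st := if c.head = j - (N + 2) then some c.state else none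
      aux := auxTape n (j - (N + 2))
      ah := decide (c.auxHead = j - (N + 2))
      out := c.out[j - 2]?.map some } := by
  rw [cellAt, if_neg (by omega)]

theorem cellAt_pad {n N j : ℕ} (P : Set ℤ) (c : M.Config) (h : j = 1 ∨ 2 * N + n + 4 ≤ j) :
    cellAt n N P c j = M.padCell := by
  rw [cellAt, if_pos h]

open Classical in
theorem cellAt_st {n N j : ℕ} {P : Set ℤ} {c : M.Config} (h : c.Bounded N) :
    (cellAt n N P c j).st = if c.head = j - (N + 2) then some c.state else none := by
  by_cases hj : j = 1 ∨ 2 * N + n + 4 ≤ j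
  · rw [cellAt_pad _ _ hj, if_neg]
    · rfl
    · have := abs_le.1 h.head; omega
  · rw [cellAt, if_neg hj]

open Classical in
theorem cellAt_ah {n N j : ℕ} {P : Set ℤ} {c : M.Config} (h : c.Bounded N) :
    (cellAt n N P c j).ah = decide (c.auxHead = j - (N + 2)) := by
  by_cases hj : j = 1 ∨ 2 * N + n + 4 ≤ j
  · rw [cellAt_pad _ _ hj]
    refine Eq.symm (decide_eq_false ?_)
    have := abs_le.1 h.auxHead; omega
  · rw [cellAt, if_neg hj]

theorem content_cellAt {n N j : ℕ} {P : Set ℤ} {c : M.Config} (hP : Determined P c)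
    (h₁ : 2 ≤ j) (h₂ : j < 2 * N + n + 4) :
    (cellAt n N P c (j - 1)).content (cellAt n N P c j) = c.tape (j - (N + 2)) := by
  rw [cellAt_of_mem P c (j := j) (by omega) h₂, Cell.content]
  by_cases hj : (j : ℤ) - (N + 2) ∈ P
  · obtain ⟨h, e⟩ := hP _ hj
    rw [cellAt_of_mem P c (j := j - 1) (by omega) (by omega)]
    have : ((j - 1 : ℕ) : ℤ) - (N + 2) = j - (N + 2) - 1 := by omega
    simp only [this, hj, if_true, Option.getD_none, e]
    by_cases h' : (j : ℤ) - (N + 2) - 1 ∈ P <;> simp [h', this]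
  · simp [hj]

theorem source_st {n N j : ℕ} {P : Set ℤ} {c : M.Config} (h : c.Bounded N) (h₁ : 2 ≤ j)
    (d : SignType) : (Cell.source d (cellAt n N P c (j - 1)) (cellAt n N P c j)
      (cellAt n N P c (j + 1))).st.isSome = true ↔ c.head + d = j - (N + 2) := by
  cases d <;> simp only [Cell.source, cellAt_st h] <;> split_ifs with h' <;> simp <;> omega

theorem source_ah {n N j : ℕ} {P : Set ℤ} {c : M.Config} (h : c.Bounded N) (h₁ : 2 ≤ j)
    (d : SignType) : (Cell.source d (cellAt n N P c (j - 1)) (cellAt n N P c j)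
      (cellAt n N P c (j + 1))).ah = true ↔ c.auxHead + d = j - (N + 2) := by
  cases d <;> simp only [Cell.source, cellAt_ah h, decide_eq_true_eq] <;> simp <;> omega

theorem cellAt_out_isSome {n N j : ℕ} {P : Set ℤ} {c : M.Config}
    (h₁ : 2 ≤ j) (h₂ : j < 2 * N + n + 4) :
    (cellAt n N P c (j - 1)).out.isSome = true ↔ j ≤ c.out.length + 2 := by
  by_cases hj : j = 2
  · subst hj
    simp [cellAt_pad P c (j := 1) (Or.inl rfl), padCell]
  · rw [cellAt_of_mem P c (j := j - 1) (by omega) (by omega)]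
    simp
    omega

theorem getElem?_append_toList {α : Type} (l : List α) (o : Option α) (i : ℕ) :
    (l ++ o.toList)[i]? = if l.length = i then o else l[i]? := by
  rcases lt_trichotomy i l.length with h | h | h
  · rw [List.getElem?_append_left h, if_neg (by omega)]
  · subst h; cases o <;> simp
  · rw [if_neg (by omega), List.getElem?_eq_none (by cases o <;> simp <;> omega),
      List.getElem?_eq_none (by omega)]

/-- Within the window, the cells develop as prescribed by the guess. All symbols on the work tape are
known after one step. -/
theorem cell_next_of_agrees {n N j : ℕ} {P : Set ℤ} {c : M.Config} {e : M.Guess}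
    (hc : c.Bounded N) (hP : Determined P c) (he : Agrees n e c)
    (h₁ : 2 ≤ j) (h₂ : j < 2 * N + n + 4) :
    Cell.next e (cellAt n N P c (j - 1)) (cellAt n N P c j) (cellAt n N P c (j + 1)) =
      some (cellAt n N ∅ (step e c) j) := by
  have hcont := content_cellAt hP h₁ h₂
  have hj := cellAt_of_mem P c (j := j) (by omega) h₂
  have hj' := cellAt_of_mem ∅ (step e c) (j := j) (by omega) h₂
  rcases e with _ | ⟨q, σ₁, τ, p, s, η, d₁, d₂⟩
  · rw [hj']
    simp only [Cell.next, hcont, DFTM.step, Set.mem_empty_iff_false, if_false]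
    rw [hj]
    rfl
  · obtain ⟨e₁, e₂, e₃⟩ := he _ _ _ _ rfl
    have hst := source_st (n := n) (P := P) hc h₁ d₁
    have hah := source_ah (n := n) (P := P) hc h₁ d₂
    have hout := cellAt_out_isSome (P := P) (c := c) h₁ h₂
    rw [Cell.next, if_pos ?_, hj']
    · simp only [Option.some.injEq, Cell.mk.injEq]
      refine ⟨?_, ?_, ?_, ?_, ?_⟩
      · simp only [hcont]
        simp only [hj, Set.mem_empty_iff_false, if_false, DFTM.step, next,
          Function.update_apply, Option.some.injEq]
        by_cases h : c.head = j - (N + 2)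
        · simp [h]
        · simp [h, Ne.symm h]
      · exact if_congr hst rfl rfl
      · rw [hj]
      · exact Bool.eq_iff_iff.2 (hah.trans decide_eq_true_iff.symm)
      · simp only [hout, DFTM.step, next, getElem?_append_toList]
        rw [hj]
        by_cases h : c.out.length = j - 2
        · simp [h]; omega
        · rw [if_neg, if_neg h]
          simp
          omega
    · rw [hcont, hj]
      simp only [Option.mem_def, decide_eq_true_eq]
      refine ⟨fun q' hq => ?_, fun h => by rw [← h, e₃]⟩
      split_ifs at hq with h
      · simp only [Option.some.injEq] at hq
        exact ⟨hq.symm.trans e₁, by rw [← h, e₂]⟩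

/-- A guess that does not agree with the configuration is detected in a cell with a head. -/
theorem agrees_of_cell_next {n N : ℕ} {P : Set ℤ} {c : M.Config} {e : M.Guess}
    (hc : c.Bounded N) (hP : Determined P c) (h : ∀ j, 2 ≤ j → j < 2 * N + n + 4 →
      Cell.next e (cellAt n N P c (j - 1)) (cellAt n N P c j) (cellAt n N P c (j + 1)) ≠ none) :
    Agrees n e c := by
  rintro q σ₁ τ m rfl
  have H : ∀ i : ℤ, |i| ≤ N → ∃ j : ℕ, 2 ≤ j ∧ j < 2 * N + n + 4 ∧ (j : ℤ) - (N + 2) = i := by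
    intro i hi
    have := abs_le.1 hi
    exact ⟨(i + (N + 2)).toNat, by omega, by omega, by omega⟩
  have key : ∀ j, 2 ≤ j → j < 2 * N + n + 4 →
      (c.head = j - (N + 2) → c.state = q ∧ c.tape (j - (N + 2)) = σ₁) ∧
        (c.auxHead = j - (N + 2) → auxTape n (j - (N + 2)) = τ) := by
    intro j h₁ h₂
    have := h j h₁ h₂
    rw [Cell.next, content_cellAt hP h₁ h₂, cellAt_of_mem P c (j := j) (by omega) h₂] at this
    simp only [ne_eq, ite_eq_right_iff, reduceCtorEq, imp_false, not_not] at this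
    refine ⟨fun e => this.1 _ (by simp [e]), fun e => this.2 (by simp [e])⟩
  obtain ⟨j, h₁, h₂, e₁⟩ := H _ hc.head
  obtain ⟨j', h₁', h₂', e₁'⟩ := H _ hc.auxHead
  have k₁ := (key j h₁ h₂).1 e₁.symm
  rw [e₁] at k₁
  have k₂ := (key j' h₁' h₂').2 e₁'.symm
  rw [e₁'] at k₂
  exact ⟨k₁.1, k₁.2, k₂⟩

end DFTM

namespace DFTM

/-! ### The simulating circuits and their outcomes -/

variable {Δ Γ : Type} {M : DFTM Δ Γ}

/-- The positions at which the gates that read the input leave the symbol undetermined. -/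
def pending (n : ℕ) (x : List Δ) : Set ℤ := {i | (x.length : ℤ) < i ∧ i ≤ n + 1}

theorem determined_initConfig (n : ℕ) (x : List Δ) :
    Determined (pending n x) (M.initConfig x) := by
  rintro i ⟨h₁, h₂⟩
  refine ⟨by omega, ?_⟩
  have h0 : i ≠ 0 := by omega
  simp only [initConfig, initTape, h0, if_false]
  by_cases h : i = x.length + 1
  · rw [if_pos h, if_neg]
    rintro ⟨h, -⟩
    omega
  · rw [if_neg h, if_pos (by omega), if_pos ⟨by omega, by omega⟩, List.getElem?_eq_none (by omega)]
    rfl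

theorem bounded_initConfig (x : List Δ) : (M.initConfig x).Bounded 0 :=
  ⟨by simp [initConfig], by simp [initConfig], by simp [initConfig]⟩

variable (M) in
/-- The initial content of the blocks that do not depend on the input. -/
def initCell (n N j : ℕ) : M.Cell :=
  if j = 1 ∨ 2 * N + n + 4 ≤ j then M.padCell
  else if j = N + 2 then M.centCell
  else if j = N + 3 + n then M.pendingCell
  else M.blankCell

theorem cellAt_initConfig {n N j : ℕ} {x : List Δ} (hx : x.length ≤ n) (hj : j ≠ 0) :
    cellAt n N (pending n x) (M.initConfig x) j =
      if N + 3 ≤ j ∧ j - (N + 3) < n then M.inputCell x[j - (N + 3)]? else M.initCell n N j := by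
  by_cases hp : j = 1 ∨ 2 * N + n + 4 ≤ j
  · rw [cellAt_pad _ _ hp, if_neg (by omega), initCell, if_pos hp]
  rw [cellAt_of_mem _ _ (by omega) (by omega)]
  have e₁ : (M.initConfig x).out[j - 2]?.map some = none := rfl
  have e₂ : (if (M.initConfig x).head = j - (N + 2) then some (M.initConfig x).state else none) =
      if j = N + 2 then some M.q₀ else none :=
    if_congr (by change (0 : ℤ) = _ ↔ _; omega) rfl rfl
  have e₃ : decide ((M.initConfig x).auxHead = j - (N + 2)) = decide (j = N + 2) :=
    decide_eq_decide.2 (by change (0 : ℤ) = _ ↔ _; omega)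
  rw [e₁, e₂, e₃]
  by_cases h : N + 3 ≤ j ∧ j - (N + 3) < n
  · rw [if_pos h, if_neg (by omega : ¬ j = N + 2)]
    have e : ((j : ℤ) - (N + 2) - 1).toNat = j - (N + 3) := by omega
    have e' : auxTape n ((j : ℤ) - (N + 2)) = .one := by
      rw [auxTape, if_neg (by omega), if_pos (by omega)]
    rw [inputCell, e', decide_eq_false (by omega)]
    congr 1
    split_ifs with hP
    · rw [List.getElem?_eq_none (by have := hP.1; omega)]
      rfl
    · have hlt : j - (N + 3) < x.length := by
        by_contra hlt
        exact hP ⟨by omega, by omega⟩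
      simp only [initConfig, initTape, e, List.getElem?_eq_getElem hlt]
      rw [if_neg (by omega), if_neg (by omega), if_pos (by omega)]
      rfl
  rw [if_neg h]
  by_cases h' : j = N + 2
  · have hP : (j : ℤ) - (N + 2) ∉ pending n x := fun hP => by have := hP.1; omega
    subst h'
    rw [initCell, if_neg hp, if_pos rfl, if_neg hP, centCell]
    simp [initConfig, initTape, auxTape]
  · rw [initCell, if_neg hp, if_neg h', if_neg h', decide_eq_false h']
    by_cases hj' : j = N + 3 + n
    · have hP : (j : ℤ) - (N + 2) ∈ pending n x := ⟨by omega, by omega⟩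
      rw [if_pos hP, if_pos hj', pendingCell]
      congr 1
      rw [auxTape, if_neg (by omega), if_neg (by omega), if_pos (by omega)]
    · have hP : (j : ℤ) - (N + 2) ∉ pending n x := fun hP => by have := hP.1; have := hP.2; omega
      rw [if_neg hP, if_neg hj', blankCell]
      congr 1
      · simp only [initConfig, initTape]
        rw [if_neg (by omega), if_neg (by omega)]
        split_ifs
        · rw [List.getElem?_eq_none (by omega)]
          rfl
        · rfl
      · rw [auxTape, if_neg (by omega), if_neg (by omega), if_neg (by omega)]

section levels

variable {B k l : ℕ} (code : M.Guess ⊕ M.Cell → Fin B → Bool) (eΔ : Δ ≃ Fin k) (eΓ : Γ ≃ Fin l)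

/-- The code of a possibly absent symbol, as it occurs in the code of a string. -/
def symBits (o : Option Δ) : Fin k → Bool := fun j => o.map eΔ == some j

theorem symBits_injective : Function.Injective (symBits eΔ) := by
  intro o o' h
  have h' : ∀ j, o.map eΔ = some j ↔ o'.map eΔ = some j := fun j =>
    beq_iff_eq.symm.trans ((Bool.eq_iff_iff.1 (congrFun h j)).trans beq_iff_eq)
  exact Option.map_injective eΔ.injective (Option.ext h')

/-- The guess with a given code. -/
noncomputable def decodeGuess (w : Fin B → Bool) : Option M.Guess :=
  (Function.partialInv code w).bind Sum.getLeft?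

/-- The cell with a given code. -/
noncomputable def decodeCell (w : Fin B → Bool) : Option M.Cell :=
  (Function.partialInv code w).bind Sum.getRight?

variable {code} in
theorem decodeGuess_code (h : Function.Injective code) (e : M.Guess) :
    decodeGuess code (code (.inl e)) = some e := by
  simp [decodeGuess, Function.partialInv_left h]

variable {code} in
theorem decodeCell_code (h : Function.Injective code) (z : M.Cell) :
    decodeCell code (code (.inr z)) = some z := by
  simp [decodeCell, Function.partialInv_left h]

variable {code} in
theorem decodeGuess_eq_some (h : Function.Injective code) {w : Fin B → Bool} {e : M.Guess}
    (hw : decodeGuess code w = some e) : w = code (.inl e) := by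
  obtain ⟨x, hx, he⟩ := Option.bind_eq_some_iff.1 hw
  rw [Sum.getLeft?_eq_some_iff] at he
  subst he
  exact (h.isPartialInv _ _).1 hx |>.symm

/-- A block that contains a constant cell. -/
def constMap (B₀ c : ℕ) (z : M.Cell) : BlockMap B₀ B c :=
  ⟨0, Function.Embedding.ofIsEmpty, fun _ => some (code (.inr z))⟩

/-- A block that contains a symbol of the input. -/
noncomputable def inputMap {n : ℕ} (i : Fin n) : BlockMap k B n :=
  ⟨1, ⟨fun _ => i, fun _ _ _ => Subsingleton.elim _ _⟩, fun v =>
    (Function.partialInv (symBits eΔ) (v 0)).map fun o => code (.inr (M.inputCell o))⟩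

/-- The initial blocks. -/
noncomputable def initMap (n N j : ℕ) : BlockMap k B n :=
  if h : N + 3 ≤ j ∧ j - (N + 3) < n then inputMap code eΔ ⟨j - (N + 3), h.2⟩
  else constMap code k n (M.initCell n N j)

/-- The guess, the block `j` and its neighbours. -/
def neighbours {V j : ℕ} (h : 2 ≤ j ∧ j + 1 < V) : Fin 4 ↪ Fin V :=
  ⟨![⟨0, by omega⟩, ⟨j - 1, by omega⟩, ⟨j, by omega⟩, ⟨j + 1, by omega⟩], fun a b hab => by
    fin_cases a <;> fin_cases b <;> simp_all <;> omega⟩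

/-- The content of a block after a step. -/
noncomputable def cellMap {V : ℕ} (ins : Fin 4 ↪ Fin V) : BlockMap B B V :=
  ⟨4, ins, fun v => (decodeGuess code (v 0)).bind fun e => (decodeCell code (v 1)).bind fun y =>
    (decodeCell code (v 2)).bind fun z => (decodeCell code (v 3)).bind fun x =>
      (Cell.next e y z x).map fun z' => code (.inr z')⟩

/-- The blocks after a step. -/
noncomputable def stepMap (V j : ℕ) : BlockMap B B V :=
  if h : 2 ≤ j ∧ j + 1 < V then cellMap code (neighbours h) else constMap code B V M.padCell

open Classical in
/-- The output symbol in a cell, provided that no head is there in a state that is not halting. -/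
noncomputable def Cell.outBits (z : M.Cell) : Option (Fin l → Bool) :=
  if ∀ q ∈ z.st, q ∈ M.F then some (symBits eΓ z.out.join) else none

/-- The symbols of the output. -/
noncomputable def outMap (V : ℕ) (i : Fin V) : BlockMap B l V :=
  ⟨1, ⟨fun _ => i, fun _ _ _ => Subsingleton.elim _ _⟩, fun v =>
    (decodeCell code (v 0)).bind (Cell.outBits eΓ)⟩

variable {K : Type} (κ : Option M.Guess → K)

/-- The circuit that simulates `t` steps on codes of strings of length at most `n`, the work tape
being represented with a margin of `N` cells. -/
noncomputable def simCircuit (n N : ℕ) : ℕ → Circuit K (n * k) ((2 * N + n + 5) * B)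
  | 0 => .layer .input (blockLevel (Nat.succ_pos _)
      (guessGates κ (decodeGuess code) (initMap code eΔ n N)))
  | t + 1 => .layer (simCircuit n N t) (blockLevel (Nat.succ_pos _)
      (guessGates κ (decodeGuess code) (stepMap code (2 * N + n + 5))))

/-- The circuit that simulates `N` steps and extracts the output. -/
noncomputable def outCircuit (n N : ℕ) : Circuit K (n * k) ((2 * N + n + 2) * l) :=
  .layer (simCircuit code eΔ κ n N N) (blockLevel (Nat.succ_pos _) fun j : Fin (2 * N + n + 2) =>
    (outMap code eΓ (2 * N + n + 5) ⟨j + 2, by omega⟩).toGate κ)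

theorem map_simCircuit {K' : Type} (D : K → K') (n N t : ℕ) :
    (simCircuit code eΔ κ n N t).map D = simCircuit code eΔ (fun o => D (κ o)) n N t := by
  have H : ∀ {c B₀ : ℕ} (g : ℕ → BlockMap B₀ B c), Level.map D (blockLevel (d := 2 * N + n + 5)
      (Nat.succ_pos _) (guessGates κ (decodeGuess code) g)) =
      blockLevel (Nat.succ_pos _) (guessGates (fun o => D (κ o)) (decodeGuess code) g) := by
    intro c B₀ g
    have : ∀ j : Fin (2 * N + n + 5), Gate.map D
        ((guessGates (B := B₀) (c := c) κ (decodeGuess code) g j).gate j) =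
        (guessGates (fun o => D (κ o)) (decodeGuess code) g j).gate j := by
      intro j
      unfold guessGates
      split_ifs <;> rfl
    simp only [Level.map, blockLevel, this]
  induction t with
  | zero => exact congrArg (Circuit.layer _) (H _)
  | succ t ih => simp only [simCircuit, Circuit.map, ih, H]

theorem map_outCircuit {K' : Type} (D : K → K') (n N : ℕ) :
    (outCircuit code eΔ eΓ κ n N).map D = outCircuit code eΔ eΓ (fun o => D (κ o)) n N := by
  rw [outCircuit, Circuit.map, map_simCircuit]
  rfl

/-- The bit vector that represents a configuration. -/
noncomputable def configBits (n N : ℕ) (P : Set ℤ) (e : M.Guess) (c : M.Config) :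
    Fin ((2 * N + n + 5) * B) → Bool :=
  ofBlocks fun j => if (j : ℕ) = 0 then code (.inl e) else code (.inr (cellAt n N P c j))

variable {code}

theorem initMap_apply {n N : ℕ} {x : List Δ} (hx : x.length ≤ n) {j : ℕ} (hj : j ≠ 0) :
    (initMap code eΔ n N j).apply (encode eΔ n x) =
      some (code (.inr (cellAt n N (pending n x) (M.initConfig x) j))) := by
  rw [cellAt_initConfig hx hj, initMap]
  split_ifs with h
  · have : block (encode eΔ n x) ⟨j - (N + 3), h.2⟩ = symBits eΔ x[j - (N + 3)]? := by
      funext b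
      simp [block, encode, symBits]
    change Option.map _ (Function.partialInv (symBits eΔ) (block (encode eΔ n x) _)) = _
    refine (congrArg (fun z => Option.map _ (Function.partialInv (symBits eΔ) z)) this).trans ?_
    rw [Function.partialInv_left (symBits_injective eΔ)]
    rfl
  · rfl

theorem stepMap_apply (hcode : Function.Injective code) {n N : ℕ} (P : Set ℤ) (e : M.Guess)
    (c : M.Config) {j : ℕ} (h : 2 ≤ j ∧ j + 1 < 2 * N + n + 5) :
    (stepMap code (2 * N + n + 5) j).apply (configBits code n N P e c) =
      (Cell.next e (cellAt n N P c (j - 1)) (cellAt n N P c j) (cellAt n N P c (j + 1))).map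
        fun z => code (.inr z) := by
  rw [stepMap, dif_pos h]
  have e₀ : block (configBits code n N P e c) ⟨0, by omega⟩ = code (.inl e) :=
    (block_ofBlocks _ _).trans (if_pos rfl)
  have e₁ : ∀ i (hi : i < 2 * N + n + 5), i ≠ 0 →
      block (configBits code n N P e c) ⟨i, hi⟩ = code (.inr (cellAt n N P c i)) :=
    fun i hi h0 => (block_ofBlocks _ _).trans (if_neg h0)
  change ((decodeGuess code (block (configBits code n N P e c) ⟨0, _⟩)).bind fun e =>
    (decodeCell code (block (configBits code n N P _ c) ⟨j - 1, _⟩)).bind fun y =>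
    (decodeCell code (block (configBits code n N P _ c) ⟨j, _⟩)).bind fun z =>
    (decodeCell code (block (configBits code n N P _ c) ⟨j + 1, _⟩)).bind fun x =>
      (Cell.next e y z x).map fun z' => code (.inr z')) = _
  rw [e₀, e₁ _ _ (by omega), e₁ _ _ (by omega), e₁ _ _ (by omega), decodeGuess_code hcode,
    decodeCell_code hcode, decodeCell_code hcode, decodeCell_code hcode]
  rfl

theorem outMap_apply (hcode : Function.Injective code) {n N : ℕ} (P : Set ℤ) (e : M.Guess)
    (c : M.Config) {j : ℕ} (h : j + 2 < 2 * N + n + 5) :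
    (outMap code eΓ (2 * N + n + 5) ⟨j + 2, h⟩).apply (configBits code n N P e c) =
      Cell.outBits eΓ (cellAt n N P c (j + 2)) := by
  have e₁ : block (configBits code n N P e c) ⟨j + 2, h⟩ = code (.inr (cellAt n N P c (j + 2))) :=
    (block_ofBlocks _ _).trans (if_neg (by simp))
  change (decodeCell code (block (configBits code n N P e c) ⟨j + 2, h⟩)).bind _ = _
  rw [e₁, decodeCell_code hcode]
  rfl

end levels

end DFTM
namespace DFTM

variable {Δ Γ : Type} {M : DFTM Δ Γ}

section values

variable {B k l : ℕ} {code : M.Guess ⊕ M.Cell → Fin B → Bool}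
  (eΔ : Δ ≃ Fin k) (eΓ : Γ ≃ Fin l)

theorem eq_configBits_iff {n N : ℕ} {P : Set ℤ} {e : M.Guess} {c : M.Config}
    {v : Fin ((2 * N + n + 5) * B) → Bool} : v = configBits code n N P e c ↔
      block v ⟨0, Nat.succ_pos _⟩ = code (.inl e) ∧
      ∀ j : Fin (2 * N + n + 5), (j : ℕ) ≠ 0 → some (code (.inr (cellAt n N P c j))) =
        some (block v j) := by
  rw [eq_comm, configBits, ofBlocks_eq_iff]
  constructor
  · refine fun h => ⟨(h ⟨0, _⟩).symm, fun j hj => ?_⟩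
    rw [← h j, if_neg hj]
  · rintro ⟨h₁, h₂⟩ j
    by_cases hj : (j : ℕ) = 0
    · obtain rfl : j = ⟨0, Nat.succ_pos _⟩ := Fin.ext hj
      exact h₁.symm
    · rw [if_neg hj]
      exact Option.some.inj (h₂ j hj)

/-- A level with a guess leads to the codes of a configuration with all guesses. -/
theorem guess_value (hcode : Function.Injective code) {n N B₀ d : ℕ}
    {g : ℕ → BlockMap B₀ B d} {v : Fin (d * B₀) → Bool} {P : Set ℤ} {c : M.Config}
    (h : ∀ j < 2 * N + n + 5, j ≠ 0 → (g j).apply v = some (code (.inr (cellAt n N P c j))))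
    (w : Fin ((2 * N + n + 5) * B) → Bool) :
    (∀ e, w = configBits code n N P e c →
      blockValue (guessGates (degree M.weight) (decodeGuess code) g) v w = M.weight e) ∧
    (blockValue (guessGates (degree M.weight) (decodeGuess code) g) v w = 0 ∨
      ∃ e, w = configBits code n N P e c ∧
        blockValue (guessGates (degree M.weight) (decodeGuess code) g) v w = M.weight e) := by
  have H := blockValue_guessGates M.weight rfl (decodeGuess code) g v w (Nat.succ_pos _)
  have key : ∀ e, w = configBits code n N P e c →
      blockValue (guessGates (degree M.weight) (decodeGuess code) g) v w = M.weight e := by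
    intro e hw
    obtain ⟨h₁, h₂⟩ := eq_configBits_iff.1 hw
    have h₃ : ∀ j : Fin (2 * N + n + 5), (j : ℕ) ≠ 0 → (g j).apply v = some (block w j) :=
      fun j hj => (h j j.2 hj).trans (h₂ j hj)
    rw [H, if_pos h₃, h₁, decodeGuess_code hcode]
    rfl
  refine ⟨key, ?_⟩
  by_cases hj : ∀ j : Fin (2 * N + n + 5), (j : ℕ) ≠ 0 → (g j).apply v = some (block w j)
  · cases he : decodeGuess code (block w ⟨0, Nat.succ_pos _⟩) with
    | none => left; rw [H, if_pos hj, he]; rfl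
    | some e =>
      have hw := eq_configBits_iff.2 ⟨decodeGuess_eq_some hcode he, fun j hj0 =>
        (h j j.2 hj0).symm.trans (hj j hj0)⟩
      exact .inr ⟨e, hw, key e hw⟩
  · left; rw [H, if_neg hj]

/-- The transition from a configuration `c` with the guess `e`: it is possible only if `e` agrees with
`c`, it leads to the configuration after `e`, and its degree is that of the following guess `e'`. -/
theorem step_value (hcode : Function.Injective code) {n N : ℕ} {P : Set ℤ} {c : M.Config}
    {e : M.Guess} (hc : c.Bounded N) (hP : Determined P c)
    (w : Fin ((2 * N + n + 5) * B) → Bool) :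
    (Agrees n e c → ∀ e', w = configBits code n N ∅ e' (step e c) →
      blockValue (guessGates (degree M.weight) (decodeGuess code) (stepMap code (2 * N + n + 5)))
        (configBits code n N P e c) w = M.weight e') ∧
    (blockValue (guessGates (degree M.weight) (decodeGuess code) (stepMap code (2 * N + n + 5)))
        (configBits code n N P e c) w = 0 ∨
      Agrees n e c ∧ ∃ e', w = configBits code n N ∅ e' (step e c) ∧
        blockValue (guessGates (degree M.weight) (decodeGuess code)
          (stepMap code (2 * N + n + 5))) (configBits code n N P e c) w = M.weight e') := by
  by_cases he : Agrees n e c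
  · have := guess_value hcode (P := ∅) (c := step e c) (n := n) (N := N)
      (g := stepMap code (2 * N + n + 5)) (v := configBits code n N P e c) (fun j hj h0 => by
        by_cases h : 2 ≤ j ∧ j + 1 < 2 * N + n + 5
        · rw [stepMap_apply hcode P e c h, cell_next_of_agrees hc hP he h.1 (by omega)]
          rfl
        · rw [stepMap, dif_neg h, cellAt_pad _ _ (by omega)]
          rfl) w
    exact ⟨fun _ => this.1, this.2.imp id fun h => ⟨he, h⟩⟩
  · refine ⟨fun h => absurd h he, .inl ?_⟩
    have : ∃ j, 2 ≤ j ∧ j < 2 * N + n + 4 ∧ Cell.next e (cellAt n N P c (j - 1))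
        (cellAt n N P c j) (cellAt n N P c (j + 1)) = none := by
      by_contra! h
      exact he (agrees_of_cell_next hc hP h)
    obtain ⟨j, h₁, h₂, hj⟩ := this
    rw [blockValue_guessGates M.weight rfl _ _ _ _ (Nat.succ_pos _), if_neg]
    intro h
    have := h ⟨j, by omega⟩ (by simp only; omega)
    rw [stepMap_apply hcode P e c ⟨h₁, by omega⟩, hj] at this
    simp at this

/-- The last level accepts exactly the halting configurations, and leads to the code of the output. -/
theorem out_value (hcode : Function.Injective code) {n N : ℕ} {P : Set ℤ} {c : M.Config}
    {e : M.Guess} (hc : c.Bounded N) (w : Fin ((2 * N + n + 2) * l) → Bool) :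
    blockValue (fun j : Fin (2 * N + n + 2) =>
      (outMap code eΓ (2 * N + n + 5) ⟨j + 2, by omega⟩).toGate (degree M.weight))
        (configBits code n N P e c) w =
      open Classical in if c.state ∈ M.F ∧ encode eΓ _ c.out = w then 1 else 0 := by
  classical
  rw [blockValue_toGate M.weight rfl]
  refine if_congr ?_ rfl rfl
  have H : ∀ j : Fin (2 * N + n + 2),
      Cell.outBits eΓ (cellAt n N P c (j + 2)) = some (block w j) ↔
        (c.head = (j : ℤ) - N → c.state ∈ M.F) ∧ block (encode eΓ _ c.out) j = block w j := by
    intro j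
    have h₁ : (cellAt n N P c (j + 2)).out.join = c.out[(j : ℕ)]? := by
      rw [cellAt_of_mem _ _ (by omega) (by omega)]
      change (c.out[(j : ℕ)]?.map some).join = _
      cases c.out[(j : ℕ)]? <;> rfl
    have h₂ : symBits eΓ c.out[(j : ℕ)]? = block (encode eΓ (2 * N + n + 2) c.out) j := by
      funext b
      simp [block, encode, symBits]
    have h₃ : (∀ q ∈ (cellAt n N P c (j + 2)).st, q ∈ M.F) ↔
        (c.head = (j : ℤ) - N → c.state ∈ M.F) := by
      rw [cellAt_st hc]
      have : ((j + 2 : ℕ) : ℤ) - (N + 2) = j - N := by push_cast; ring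
      rw [this]
      by_cases h : c.head = (j : ℤ) - N <;> simp [h]
    rw [Cell.outBits, h₁, h₂, ← h₃]
    split_ifs with h
    · exact Option.some_inj.trans (and_iff_right h).symm
    · exact iff_of_false (fun h' => nomatch h') fun h' => h h'.1
  constructor
  · intro h
    have h' := fun j => (H j).1 ((outMap_apply eΓ hcode P e c _).symm.trans (h j))
    refine ⟨?_, funext fun z => ?_⟩
    · have := abs_le.1 hc.head
      refine (h' ⟨(c.head + N).toNat, by omega⟩).1 ?_
      simp only
      omega
    · have := congrFun (h' (finProdFinEquiv.symm z).1).2 (finProdFinEquiv.symm z).2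
      simpa only [block, Prod.mk.eta, Equiv.apply_symm_apply] using this
  · rintro ⟨h₁, rfl⟩ j
    exact (outMap_apply eΓ hcode P e c _).trans ((H j).2 ⟨fun _ => h₁, rfl⟩)

end values

end DFTM
namespace DFTM

variable {Δ Γ : Type} {M : DFTM Δ Γ}

section reachable

/-- The sets of undetermined positions with which the configuration `c` may be represented after
`t` levels. -/
def Represents (n t : ℕ) (P : Set ℤ) (c : M.Config) : Prop :=
  (∃ x : List Δ, t = 0 ∧ x.length ≤ n ∧ c = M.initConfig x ∧ P = pending n x) ∨
    0 < t ∧ P = ∅ ∧ c.Bounded t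

theorem Config.Bounded.mono {c : M.Config} {t t' : ℕ} (h : c.Bounded t) (ht : t ≤ t') :
    c.Bounded t' :=
  ⟨h.head.trans (by exact_mod_cast ht), h.auxHead.trans (by exact_mod_cast ht), h.out.trans ht⟩

theorem Represents.bounded {n t : ℕ} {P : Set ℤ} {c : M.Config} (h : Represents n t P c) :
    c.Bounded t := by
  rcases h with ⟨x, rfl, -, rfl, -⟩ | ⟨-, -, h⟩
  · exact bounded_initConfig x
  · exact h

theorem Represents.determined {n t : ℕ} {P : Set ℤ} {c : M.Config} (h : Represents n t P c) :
    Determined P c := by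
  rcases h with ⟨x, -, -, rfl, rfl⟩ | ⟨-, rfl, -⟩
  · exact determined_initConfig n x
  · exact fun i hi => absurd hi (Set.notMem_empty i)

theorem exists_of_conf_zero_pos {s : FuzzySet (List Δ)} {c : M.Config} (h : 0 < M.conf s 0 c) :
    ∃ x, c = M.initConfig x ∧ 0 < s x := by
  by_contra! H
  refine absurd h (not_lt.2 (iSup_le ?_))
  rintro ⟨x, hx⟩
  exact H x hx

theorem bounded_of_conf_pos {s : FuzzySet (List Δ)} {i : ℕ} {c : M.Config}
    (h : 0 < M.conf s i c) : c.Bounded i := by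
  induction i generalizing c with
  | zero =>
    obtain ⟨x, rfl, -⟩ := exists_of_conf_zero_pos h
    exact bounded_initConfig x
  | succ i ih =>
    by_contra hc
    refine absurd h (not_lt.2 (iSup_le ?_))
    rintro ⟨⟨⟨c₀, h₀⟩, m⟩, hm⟩
    refine (min_le_left _ _).trans (not_lt.1 fun hpos => hc ?_)
    replace hm : M.next c₀ m = c := hm
    -- The state and the symbols in the guess are arbitrary: only the move matters.
    have := (ih hpos).step (some (M.q₀, M.blank, .blank, m))
    rwa [step, hm] at this

/-- Every configuration of positive degree fits into the window of the circuit. -/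
theorem exists_represents {s : FuzzySet (List Δ)} {n i t : ℕ} (hs : ∀ x, 0 < s x → x.length ≤ n)
    {c : M.Config} (h : 0 < M.conf s i c) (hi : i ≤ t) : ∃ P, Represents n t P c := by
  rcases Nat.eq_zero_or_pos t with rfl | ht
  · obtain rfl : i = 0 := Nat.le_zero.1 hi
    obtain ⟨x, rfl, hx⟩ := exists_of_conf_zero_pos h
    exact ⟨_, .inl ⟨x, rfl, hs x hx, rfl, rfl⟩⟩
  · exact ⟨∅, .inr ⟨ht, rfl, (bounded_of_conf_pos h).mono hi⟩⟩

theorem conf_le_conf_next (s : FuzzySet (List Δ)) (i : ℕ) {c : M.Config} {q σ₁ τ m}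
    (h : Agrees (len s) (some (q, σ₁, τ, m)) c) :
    min (M.conf s i c) (M.weight (some (q, σ₁, τ, m))) ≤ M.conf s (i + 1) (M.next c m) := by
  obtain ⟨rfl, rfl, rfl⟩ := h _ _ _ _ rfl
  by_cases hq : c.state ∈ M.F
  · refine (min_le_right _ _).trans (le_of_eq_of_le ?_ unitInterval.nonneg')
    simp [weight, hq]
  · have : M.weight (some (c.state, c.tape c.head, auxTape (len s) c.auxHead, m)) =
        M.δ ⟨c.state, hq⟩ (c.tape c.head) (auxTape (len s) c.auxHead) m := by simp [weight, hq]
    rw [this]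
    exact le_iSup (fun m' : {m' : {c : M.Config // c.state ∉ M.F} ×
            (M.Q × M.S × Option Γ × SignType × SignType) // M.next m'.1.1 m'.2 = M.next c m} =>
        mu1 (M.conf s i m'.1.1.1)
          (M.δ ⟨m'.1.1.1.state, m'.1.1.2⟩ (m'.1.1.1.tape m'.1.1.1.head)
            (auxTape (len s) m'.1.1.1.auxHead) m'.1.2)) ⟨(⟨c, hq⟩, m), rfl⟩

/-- To bound `conf_{i+1}` from above, it suffices to consider guesses that agree with the
configuration. -/
theorem conf_succ_le {s : FuzzySet (List Δ)} {i : ℕ} {c' : M.Config} {u : I}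
    (h : ∀ c e, Agrees (len s) e c → step e c = c' → min (M.conf s i c) (M.weight e) ≤ u) :
    M.conf s (i + 1) c' ≤ u := by
  refine iSup_le ?_
  rintro ⟨⟨⟨c, hq⟩, m⟩, hm⟩
  have := h c (some (c.state, c.tape c.head, auxTape (len s) c.auxHead, m)) (by
    rintro q σ₁ τ m' h
    simp only [Option.some.injEq, Prod.mk.injEq] at h
    exact ⟨h.1, h.2.1, h.2.2.1⟩) hm
  rwa [weight, dif_pos hq] at this

/-- The length of the input is determined by the position of the first `$`. -/
theorem initConfig_inj {x y : List Δ} (h : M.initConfig x = M.initConfig y) : x = y := by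
  have hlen : ∀ x y : List Δ, M.initConfig x = M.initConfig y → ¬ x.length < y.length := by
    intro x y h hlt
    have := congrFun (congrArg Config.tape h) (x.length + 1)
    simp only [initConfig, initTape] at this
    rw [if_neg (by omega : ¬ (x.length : ℤ) + 1 = 0), if_pos trivial,
      if_neg (by omega : ¬ (x.length : ℤ) + 1 = 0),
      if_neg (by omega : ¬ (x.length : ℤ) + 1 = y.length + 1),
      if_pos (by omega : 0 < (x.length : ℤ) + 1)] at this
    have e : ((x.length : ℤ) + 1 - 1).toNat = x.length := by omega
    rw [e, List.getElem?_eq_getElem hlt] at this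
    exact M.inp_ne_dollar _ this.symm
  have hl : x.length = y.length := by
    have := hlen x y h
    have := hlen y x h.symm
    omega
  refine List.ext_getElem hl fun i h₁ h₂ => M.inp_injective ?_
  have := congrFun (congrArg Config.tape h) (i + 1)
  simp only [initConfig, initTape] at this
  have e : ((i : ℤ) + 1 - 1).toNat = i := by omega
  rw [if_neg (by omega), if_neg (by omega), if_pos (by omega), if_neg (by omega),
    if_neg (by omega), if_pos (by omega), e, List.getElem?_eq_getElem h₁,
    List.getElem?_eq_getElem h₂] at this
  exact this

theorem conf_zero_initConfig (s : FuzzySet (List Δ)) (x : List Δ) :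
    M.conf s 0 (M.initConfig x) = s x := by
  refine le_antisymm (iSup_le ?_) (le_iSup
    (fun y : {y : List Δ // M.initConfig x = M.initConfig y} => s y) ⟨x, rfl⟩)
  rintro ⟨y, hy⟩
  exact (congrArg s (initConfig_inj hy)).ge

end reachable

section eval

variable {B k l : ℕ} {code : M.Guess ⊕ M.Cell → Fin B → Bool} (eΔ : Δ ≃ Fin k) (eΓ : Γ ≃ Fin l)

/-- The outcome of the simulation of `t` steps: each configuration that is reached within `t` steps
occurs with the degree of reaching it, together with each guess for the following step. -/
theorem simCircuit_eval_le_iff (hcode : Function.Injective code) (s : FuzzySet (List Δ)) (n N : ℕ)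
    (hn : len s = n) (hs : ∀ x, 0 < s x → x.length ≤ n) (t : ℕ) (ht : t ≤ N)
    (v : Fin ((2 * N + n + 5) * B) → Bool) (u : I) :
    (simCircuit code eΔ (degree M.weight) n N t).eval (encodeFuzzy eΔ n s) v ≤ u ↔
      ∀ e c P, Represents n t P c → configBits code n N P e c = v →
        ∀ i ≤ t, min (M.conf s i c) (M.weight e) ≤ u := by
  induction t generalizing v u with
  | zero =>
    rw [simCircuit, Circuit.eval_blockLevel_le_iff]
    change (∀ v₀, min (encodeFuzzy eΔ n s v₀) _ ≤ u) ↔ _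
    -- The degree of a code is a supremum over strings; the implication `⇨` of the Heyting algebra
    -- `[0, 1]`, adjoint to `min`, takes it out of the minimum.
    have h₀ : (∀ v₀, min (encodeFuzzy eΔ n s v₀) (blockValue (guessGates (degree M.weight)
        (decodeGuess code) (initMap code eΔ n N)) v₀ v) ≤ u) ↔
        ∀ x : List Δ, x.length ≤ n → min (s x) (blockValue (guessGates (degree M.weight)
          (decodeGuess code) (initMap code eΔ n N)) (encode eΔ n x) v) ≤ u := by
      refine (forall_congr' fun v₀ => le_himp_iff.symm.trans iSup_le_iff).trans ?_
      constructor
      · exact fun h x hx => le_himp_iff.1 (h _ ⟨x, hx, rfl⟩)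
      · rintro h v₀ ⟨x, hx, rfl⟩
        exact le_himp_iff.2 (h x hx)
    rw [h₀]
    constructor
    · rintro h e c P (⟨x, -, hx, rfl, rfl⟩ | ⟨h0, -⟩) rfl i hi
      · obtain rfl : i = 0 := Nat.le_zero.1 hi
        have := h x hx
        rwa [(guess_value hcode (fun j _ hj => initMap_apply eΔ hx hj) _).1 e rfl,
          ← conf_zero_initConfig (M := M) s] at this
      · exact absurd h0 (lt_irrefl 0)
    · intro h x hx
      rcases (guess_value hcode (fun j _ hj => initMap_apply eΔ hx hj) v).2 with h0 | ⟨e, hv, he⟩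
      · rw [h0]
        exact (min_le_right _ _).trans unitInterval.nonneg'
      · rw [he, ← conf_zero_initConfig (M := M) s]
        exact h e _ _ (.inl ⟨x, rfl, hx, rfl, rfl⟩) hv.symm 0 le_rfl
  | succ t ih =>
    rw [simCircuit, Circuit.eval_blockLevel_le_iff]
    have h₀ : (∀ v₀, min ((simCircuit code eΔ (degree M.weight) n N t).eval (encodeFuzzy eΔ n s) v₀)
        (blockValue (guessGates (degree M.weight) (decodeGuess code)
          (stepMap code (2 * N + n + 5))) v₀ v) ≤ u) ↔
        ∀ e c P, Represents n t P c → ∀ i ≤ t, min (min (M.conf s i c) (M.weight e))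
          (blockValue (guessGates (degree M.weight) (decodeGuess code)
            (stepMap code (2 * N + n + 5))) (configBits code n N P e c) v) ≤ u := by
      refine (forall_congr' fun v₀ => le_himp_iff.symm.trans (ih (by omega) v₀ _)).trans ?_
      constructor
      · exact fun h e c P hP i hi => le_himp_iff.1 (h _ e c P hP rfl i hi)
      · rintro h v₀ e c P hP rfl i hi
        exact le_himp_iff.2 (h e c P hP i hi)
    rw [h₀]
    have hb : ∀ {P : Set ℤ} {c : M.Config}, Represents n t P c → c.Bounded N :=
      fun h => h.bounded.mono (by omega)
    constructor
    · rintro h e' c' P (⟨x, h0, -⟩ | ⟨-, rfl, hc'⟩) hv i hi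
      · exact absurd h0 (Nat.succ_ne_zero t)
      have key : ∀ j ≤ t, ∀ c e, Agrees n e c → step e c = c' →
          min (M.conf s j c) (M.weight e) ≤ M.weight e' ⇨ u := by
        intro j hj c e he hc
        by_cases hpos : 0 < M.conf s j c
        · obtain ⟨P, hP⟩ := exists_represents hs hpos hj
          have := h e c P hP j hj
          rwa [(step_value hcode (hb hP) hP.determined _).1 he e' (by rw [hc, hv]),
            ← le_himp_iff] at this
        · rw [le_antisymm (not_lt.1 hpos) unitInterval.nonneg']
          exact (min_le_left _ _).trans unitInterval.nonneg'
      refine le_himp_iff.1 ?_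
      rcases Nat.lt_or_ge t i with hti | hti
      · obtain rfl : i = t + 1 := by omega
        subst hn
        exact conf_succ_le fun c e => key t le_rfl c e
      · -- A configuration reached earlier survives by idling, which has degree `1`.
        have := key i hti c' none (fun _ _ _ _ h => nomatch h) rfl
        rwa [weight, min_eq_left unitInterval.le_one'] at this
    · intro h e c P hP i hi
      rcases (step_value hcode (hb hP) hP.determined v).2 with h0 | ⟨he, e', hv, hval⟩
      · rw [h0]
        exact (min_le_right _ _).trans unitInterval.nonneg'
      · rw [hval]
        have h' := h e' (step e c) ∅ (.inr ⟨Nat.succ_pos t, rfl, hP.bounded.step e⟩) hv.symm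
        rcases e with _ | ⟨q, σ₁, τ, m⟩
        · exact (min_le_min_right _ (min_le_left _ _)).trans (h' i (by omega))
        · subst hn
          exact (min_le_min_right _ (conf_le_conf_next s i he)).trans (h' (i + 1) (by omega))

/-- The outcome of the circuit on the code of `s`: the degree of a bit vector is the supremum of the
degrees of halting configurations within `N` steps whose output it encodes. -/
theorem outCircuit_eval_le_iff (hcode : Function.Injective code) (s : FuzzySet (List Δ)) (n N : ℕ)
    (hn : len s = n) (hs : ∀ x, 0 < s x → x.length ≤ n) (w : Fin ((2 * N + n + 2) * l) → Bool)
    (u : I) : (outCircuit code eΔ eΓ (degree M.weight) n N).eval (encodeFuzzy eΔ n s) w ≤ u ↔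
      ∀ c : M.Config, c.state ∈ M.F → encode eΓ _ c.out = w → ∀ i ≤ N, M.conf s i c ≤ u := by
  rw [outCircuit, Circuit.eval_blockLevel_le_iff]
  have hsim := simCircuit_eval_le_iff eΔ hcode s n N hn hs N le_rfl
  constructor
  · intro h c hc hw i hi
    by_cases hpos : 0 < M.conf s i c
    · obtain ⟨P, hP⟩ := exists_represents hs hpos hi
      have := le_himp_iff.2 (h (configBits code n N P none c))
      rw [hsim] at this
      have := le_himp_iff.1 (this none c P hP rfl i hi)
      rwa [out_value eΓ hcode hP.bounded, if_pos ⟨hc, hw⟩, weight,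
        min_eq_left unitInterval.le_one', min_eq_left unitInterval.le_one'] at this
    · rw [le_antisymm (not_lt.1 hpos) unitInterval.nonneg']
      exact unitInterval.nonneg'
  · intro h v
    refine le_himp_iff.1 ((hsim _ _).2 ?_)
    rintro e c P hP rfl i hi
    refine le_himp_iff.2 ?_
    rw [out_value eΓ hcode hP.bounded]
    split_ifs with hc
    · exact (min_le_left _ _).trans ((min_le_left _ _).trans (h c hc.1 hc.2 i hi))
    · exact (min_le_right _ _).trans unitInterval.nonneg'

end eval

end DFTM
namespace DFTM

/-! ### The simulating circuits form a uniform family -/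

variable {Δ Γ : Type} {M : DFTM Δ Γ}

section text

variable {r B k l : ℕ} (code : M.Guess ⊕ M.Cell → Fin B → Bool) (eΔ : Δ ≃ Fin k) (eΓ : Γ ≃ Fin l)
  (κ : Option M.Guess → Fin r)

/-- The truth table of the gate that guesses. -/
noncomputable def guessTable (B₀ : ℕ) : List (DescSym r) :=
  blockTable (guessGate (B := B₀) (c := 0) κ (decodeGuess code)).fn

/-- The truth table of the gate for a constant cell. -/
noncomputable def constTable (B₀ : ℕ) (z : M.Cell) : List (DescSym r) :=
  blockTable ((constMap code B₀ 0 z).toGate κ).fn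

/-- The truth table of the gate that reads a symbol of the input. -/
noncomputable def inputTable : List (DescSym r) :=
  blockTable ((inputMap code eΔ (0 : Fin 1)).toGate κ).fn

/-- The truth table of the gate that determines the content of a cell after a step. -/
noncomputable def cellTable : List (DescSym r) :=
  blockTable ((cellMap code (Function.Embedding.refl (Fin 4))).toGate κ).fn

/-- The truth table of the gate that extracts a symbol of the output. -/
noncomputable def outTable : List (DescSym r) :=
  blockTable ((outMap code eΓ 1 0).toGate κ).fn

/-- The description of the level that reads the input, where `T = N` and `W = 2 N + n + 2`. -/
noncomputable def initText (n N T W : ℕ) : List (DescSym r) :=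
  gateText k B [] 0 (guessTable code κ k) ++ gateText k B [] 1 (constTable code κ k M.padCell) ++
    ((List.range N).flatMap fun i => gateText k B [] (2 + i) (constTable code κ k M.blankCell)) ++
    gateText k B [] (2 + N) (constTable code κ k M.centCell) ++
    ((List.range n).flatMap fun i => gateText k B [i] (3 + (N + i)) (inputTable code eΔ κ)) ++
    gateText k B [] (3 + (N + n)) (constTable code κ k M.pendingCell) ++
    ((List.range T).flatMap fun i =>
      gateText k B [] (4 + (N + (n + i))) (constTable code κ k M.blankCell)) ++
    gateText k B [] (2 + W) (constTable code κ k M.padCell) ++ [.endLevel]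

/-- The description of a level that simulates a step. -/
noncomputable def stepText (W : ℕ) : List (DescSym r) :=
  gateText B B [] 0 (guessTable code κ B) ++ gateText B B [] 1 (constTable code κ B M.padCell) ++
    ((List.range W).flatMap fun i =>
      gateText B B [0, 1 + i, 2 + i, 3 + i] (2 + i) (cellTable code κ)) ++
    gateText B B [] (2 + W) (constTable code κ B M.padCell) ++ [.endLevel]

/-- The description of the level that extracts the output. -/
noncomputable def outText (W : ℕ) : List (DescSym r) :=
  ((List.range W).flatMap fun i => gateText B l [2 + i] i (outTable code eΓ κ)) ++ [.endLevel]

theorem emits_initText : Emits {.i, .j, .t} fun env =>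
    initText code eΔ κ (env .n) (env .N) (env .T) (env .W) := by
  have hc : ∀ (vs : ℕ × List DsVar) (z : List (DescSym r)), DsVar.j ∉ vs.2 →
      Emits {.i, .j} fun env => gateText k B [] (linear vs env) z := fun vs z h =>
    (Emits.gate k B [] vs z (by simp) h).mono (by simp)
  have h₁ := (Emits.gate k B [] (2, [.i]) (constTable code κ k M.blankCell) (by simp)
    (by simp)).loop (v := .N) (w := .i) (by simp) (by simp) (by simp)
    (fun env a => by simp [linear])
  have h₂ := (Emits.gate k B [(0, [.i])] (3, [.N, .i]) (inputTable code eΔ κ) (by simp)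
    (by simp)).loop (v := .n) (w := .i) (by simp) (by simp) (by simp)
    (fun env a => by simp [linear])
  have h₃ := (Emits.gate k B [] (4, [.N, .n, .i]) (constTable code κ k M.blankCell) (by simp)
    (by simp)).loop (v := .T) (w := .i) (by simp) (by simp) (by simp)
    (fun env a => by simp [linear])
  refine (((((((((hc (0, []) (guessTable code κ k) (by simp)).append
    (hc (1, []) (constTable code κ k M.padCell) (by simp))).append h₁).append
    (hc (2, [.N]) (constTable code κ k M.centCell) (by simp))).append h₂).append
    (hc (3, [.N, .n]) (constTable code κ k M.pendingCell) (by simp))).append h₃).append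
    (hc (2, [.W]) (constTable code κ k M.padCell) (by simp))).append
    (Emits.const _ [.endLevel])).mono (Z' := {.i, .j, .t})
      (by intro z hz; simp only [Set.mem_insert_iff, Set.mem_singleton_iff] at hz ⊢; tauto)
      |>.congr fun env _ => ?_
  simp [initText, linear]

theorem emits_stepText : Emits {.i, .j} fun env => stepText code κ (env .W) := by
  have hc : ∀ (vs : ℕ × List DsVar) (z : List (DescSym r)), DsVar.j ∉ vs.2 →
      Emits {.i, .j} fun env => gateText B B [] (linear vs env) z := fun vs z h =>
    (Emits.gate B B [] vs z (by simp) h).mono (by simp)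
  have h₁ := (Emits.gate B B [(0, []), (1, [.i]), (2, [.i]), (3, [.i])] (2, [.i])
    (cellTable code κ) (by simp) (by simp)).loop (v := .W) (w := .i) (by simp) (by simp) (by simp)
    (fun env a => by simp [linear])
  refine (((((hc (0, []) (guessTable code κ B) (by simp)).append
    (hc (1, []) (constTable code κ B M.padCell) (by simp))).append h₁).append
    (hc (2, [.W]) (constTable code κ B M.padCell) (by simp))).append
    (Emits.const _ [.endLevel])).congr fun env _ => ?_
  simp [stepText, linear]

theorem emits_outText : Emits {.i, .j, .t} fun env => outText code eΓ κ (env .W) := by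
  have h₁ := (Emits.gate B l [(2, [.i])] (0, [.i])
    (outTable code eΓ κ) (by simp) (by simp)).loop (v := .W) (w := .i) (by simp) (by simp) (by simp)
    (fun env a => by simp [linear])
  refine (h₁.append (Emits.const _ [.endLevel])).mono (Z' := {.i, .j, .t})
      (by intro z hz; simp only [Set.mem_insert_iff, Set.mem_singleton_iff] at hz ⊢; tauto)
      |>.congr fun env _ => ?_
  simp [outText, linear]

theorem emits_stepTexts : Emits {.i, .j, .t} fun env =>
    (List.range (env .T)).flatMap fun _ => stepText code κ (env .W) := by
  have h := (emits_stepText code κ).loop (v := .T) (w := .t) (by simp) (by simp) (by simp)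
    (fun env a => by simp)
  refine h.mono (Z' := {.i, .j, .t})
      (by intro z hz; simp only [Set.mem_insert_iff, Set.mem_singleton_iff] at hz ⊢; tauto)
      |>.congr fun env _ => ?_
  simp

theorem flatMap_range_add {α : Type} (f : ℕ → List α) (a b : ℕ) :
    (List.range (a + b)).flatMap f =
      (List.range a).flatMap f ++ (List.range b).flatMap fun i => f (a + i) := by
  rw [List.range_add, List.flatMap_append, List.flatMap_map]

theorem flatMap_range_one {α : Type} (f : ℕ → List α) : (List.range 1).flatMap f = f 0 := by
  simp

/-- The descriptions of the gates of a level with a guess, given those of the gates other than the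
zeroth. -/
theorem guessGates_text {d c B₀ : ℕ} (g : ℕ → BlockMap B₀ B c) (tx : ℕ → List (DescSym r))
    (h0 : tx 0 = gateText B₀ B [] 0 (guessTable code κ B₀))
    (h : ∀ j < d, j ≠ 0 → gateText B₀ B (List.ofFn fun i => ((g j).ins i : ℕ)) j
      (blockTable ((g j).toGate κ).fn) = tx j) (j : Fin d) :
    gateText B₀ B (List.ofFn fun i => ((guessGates κ (decodeGuess code) g j).ins i : ℕ)) j
      (blockTable (guessGates κ (decodeGuess code) g j).fn) = tx j := by
  by_cases hj : (j : ℕ) = 0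
  · have e : guessGates κ (decodeGuess code) g j = guessGate κ (decodeGuess code) := if_pos hj
    rw [e, hj, h0]
    rfl
  · have e : guessGates κ (decodeGuess code) g j = (g j).toGate κ := if_neg hj
    rw [e]
    exact h j j.2 hj

theorem describe_init (n N : ℕ) : (simCircuit code eΔ κ n N 0).describe =
    initText code eΔ κ n N N (2 * N + n + 2) := by
  let tx : ℕ → List (DescSym r) := fun j =>
    if j = 0 then gateText k B [] 0 (guessTable code κ k)
    else if N + 3 ≤ j ∧ j - (N + 3) < n then gateText k B [j - (N + 3)] j (inputTable code eΔ κ)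
    else gateText k B [] j (constTable code κ k (M.initCell n N j))
  have h := Circuit.describe_blockLevel (r := r) (.input : Circuit (Fin r) (n * k) (n * k))
    (d := 2 * N + n + 5) (Nat.succ_pos _) (guessGates κ (decodeGuess code) (initMap code eΔ n N)) tx
    (guessGates_text code κ _ tx rfl fun j _ hj => by
      simp only [tx, hj, if_false]
      by_cases hn : N + 3 ≤ j ∧ j - (N + 3) < n
      · rw [if_pos hn, initMap, dif_pos hn]
        rfl
      · rw [if_neg hn, initMap, dif_neg hn]
        rfl)
  have hpad : ∀ j, j = 1 ∨ 2 * N + n + 4 ≤ j →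
      tx j = gateText k B [] j (constTable code κ k M.padCell) := fun j hj => by
    simp only [tx, initCell]
    rw [if_neg (by omega), if_neg (by omega), if_pos hj]
  have hblank : ∀ j, 2 ≤ j → j < 2 * N + n + 4 → ¬(N + 2 ≤ j ∧ j ≤ N + 3 + n) →
      tx j = gateText k B [] j (constTable code κ k M.blankCell) := fun j h₁ h₂ h₃ => by
    simp only [tx, initCell]
    rw [if_neg (by omega), if_neg (by omega), if_neg (by omega), if_neg (by omega),
      if_neg (by omega)]
  have hcent : tx (2 + N) = gateText k B [] (2 + N) (constTable code κ k M.centCell) := by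
    simp only [tx, initCell]
    rw [if_neg (by omega), if_neg (by omega), if_neg (by omega), if_pos (by omega)]
  have hpend : tx (3 + (N + n)) =
      gateText k B [] (3 + (N + n)) (constTable code κ k M.pendingCell) := by
    simp only [tx, initCell]
    rw [if_neg (by omega), if_neg (by omega), if_neg (by omega), if_neg (by omega),
      if_pos (by omega)]
  have hin : ∀ i < n, tx (3 + (N + i)) =
      gateText k B [i] (3 + (N + i)) (inputTable code eΔ κ) := fun i hi => by
    simp only [tx]
    rw [if_neg (by omega), if_pos (by omega), show 3 + (N + i) - (N + 3) = i by omega]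
  refine h.trans ?_
  rw [show 2 * N + n + 5 = 1 + (1 + (N + (1 + (n + (1 + (N + 1)))))) by ring]
  simp only [flatMap_range_add, flatMap_range_one]
  rw [initText, show Circuit.describe (.input : Circuit (Fin r) (n * k) (n * k)) = [] from rfl,
    List.nil_append]
  simp only [List.append_assoc]
  refine congrArg₂ _ rfl (congrArg₂ _ (hpad 1 (.inl rfl)) (congrArg₂ _ ?_ (congrArg₂ _ ?_
    (congrArg₂ _ ?_ (congrArg₂ _ ?_ (congrArg₂ _ ?_ (congrArg₂ _ ?_ rfl)))))))
  · refine List.flatMap_congr fun i hi => ?_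
    rw [List.mem_range] at hi
    rw [← hblank (2 + i) (by omega) (by omega) (by omega)]
    congr 1; omega
  · rw [← hcent]; congr 1; omega
  · refine List.flatMap_congr fun i hi => ?_
    rw [← hin i (List.mem_range.1 hi)]
    congr 1; omega
  · rw [← hpend]; congr 1; omega
  · refine List.flatMap_congr fun i hi => ?_
    rw [List.mem_range] at hi
    rw [← hblank (4 + (N + (n + i))) (by omega) (by omega) (by omega)]
    congr 1; omega
  · rw [← hpad _ (.inr (by omega))]; congr 1; omega

theorem describe_step (n N t : ℕ) : (simCircuit code eΔ κ n N (t + 1)).describe =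
    (simCircuit code eΔ κ n N t).describe ++ stepText code κ (2 * N + n + 2) := by
  let tx : ℕ → List (DescSym r) := fun j =>
    if j = 0 then gateText B B [] 0 (guessTable code κ B)
    else if 2 ≤ j ∧ j + 1 < 2 * N + n + 5 then
      gateText B B [0, j - 1, j, j + 1] j (cellTable code κ)
    else gateText B B [] j (constTable code κ B M.padCell)
  have h := Circuit.describe_blockLevel (r := r) (simCircuit code eΔ κ n N t)
    (d := 2 * N + n + 5) (Nat.succ_pos _)
    (guessGates κ (decodeGuess code) (stepMap code (2 * N + n + 5))) tx
    (guessGates_text code κ _ tx rfl fun j _ hj => by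
      simp only [tx, hj, if_false]
      by_cases hn : 2 ≤ j ∧ j + 1 < 2 * N + n + 5
      · rw [if_pos hn, stepMap, dif_pos hn]
        rfl
      · rw [if_neg hn, stepMap, dif_neg hn]
        rfl)
  have hpad : ∀ j, j = 1 ∨ j = 2 * N + n + 4 →
      tx j = gateText B B [] j (constTable code κ B M.padCell) := fun j hj => by
    simp only [tx]
    rw [if_neg (by omega), if_neg (by omega)]
  refine h.trans ?_
  generalize (simCircuit code eΔ κ n N t).describe = z
  rw [show 2 * N + n + 5 = 1 + (1 + ((2 * N + n + 2) + 1)) by ring]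
  rw [flatMap_range_add _ 1, flatMap_range_add _ 1, flatMap_range_add _ (2 * N + n + 2) 1]
  simp only [flatMap_range_one]
  rw [stepText]
  simp only [List.append_assoc]
  refine congrArg₂ _ rfl (congrArg₂ _ rfl (congrArg₂ _ (hpad 1 (.inl rfl)) (congrArg₂ _ ?_
    (congrArg₂ _ ?_ rfl))))
  · refine List.flatMap_congr fun i hi => ?_
    rw [List.mem_range] at hi
    simp only [tx]
    rw [if_neg (by omega), if_pos (by omega)]
    rw [show 1 + (1 + i) - 1 = 1 + i by omega, show 1 + (1 + i) + 1 = 3 + i by omega,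
      show 1 + (1 + i) = 2 + i by omega]
  · rw [← hpad _ (.inr (by omega))]; congr 1; omega

theorem describe_outCircuit (n N : ℕ) : (outCircuit code eΔ eΓ κ n N).describe =
    initText code eΔ κ n N N (2 * N + n + 2) ++
      ((List.range N).flatMap fun _ => stepText code κ (2 * N + n + 2)) ++
      outText code eΓ κ (2 * N + n + 2) := by
  have hsim : ∀ t, (simCircuit code eΔ κ n N t).describe =
      initText code eΔ κ n N N (2 * N + n + 2) ++
        (List.range t).flatMap fun _ => stepText code κ (2 * N + n + 2) := by
    intro t
    induction t with
    | zero => rw [describe_init]; simp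
    | succ t ih => rw [describe_step, ih, List.range_succ]; simp
  rw [← hsim N]
  refine (Circuit.describe_blockLevel _ (Nat.succ_pos _) _
    (fun j => gateText B l [2 + j] j (outTable code eΓ κ)) fun j => ?_).trans ?_
  · rw [Nat.add_comm 2]
    rfl
  · rw [outText, List.append_assoc]

theorem outCircuit_computable (c d : ℕ) :
    Nonempty (Turing.TM2ComputableInPolyTime Computability.unaryEncodeNat
      (id : List (DescSym r) → List (DescSym r)) fun n =>
        (outCircuit code eΔ eΓ κ n (c * (n + 1) ^ d)).describe) :=
  computable_of_emits c d (((emits_initText code eΔ κ).append (emits_stepTexts code κ)).append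
    (emits_outText code eΓ κ)) _ fun n => describe_outCircuit code eΔ eΓ κ n _

end text

section family

variable {B k l : ℕ} {code : M.Guess ⊕ M.Cell → Fin B → Bool} (eΔ : Δ ≃ Fin k) (eΓ : Γ ≃ Fin l)

theorem outCircuit_uniform [Finite Γ] (c d : ℕ) : IsUniform fun n =>
    outCircuit code eΔ eΓ (degree M.weight) n (c * (n + 1) ^ d) := by
  let κ : Option M.Guess ≃ Fin (Nat.card (Option M.Guess)) := Finite.equivFin _
  refine ⟨_, fun i => degree M.weight (κ.symm i), fun n =>
    outCircuit code eΔ eΓ κ n (c * (n + 1) ^ d), fun n => ?_, outCircuit_computable code eΔ eΓ κ c d⟩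
  rw [map_outCircuit]
  simp only [Equiv.symm_apply_apply]

/-- The output is a supremum over halting configurations within the running time. -/
theorem output_le_iff {s : FuzzySet (List Δ)} {t : ℕ} {w : List Γ} {u : I} :
    M.output s t w ≤ u ↔
      ∀ c : M.Config, c.state ∈ M.F → c.out = w → ∀ i ≤ t, M.conf s i c ≤ u := by
  refine iSup_le_iff.trans ⟨fun h c hc hw i hi => ?_, fun h => ?_⟩
  · have := h ⟨c, hc, hw⟩
    simp only [final, if_pos hc] at this
    exact (le_iSup (fun i : Fin (t + 1) => M.conf s i c) ⟨i, by omega⟩).trans this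
  · rintro ⟨c, hc, hw⟩
    simp only [final, if_pos hc]
    exact iSup_le fun i => h c hc hw i (by omega)

/-- A bound `N` for the running time may be used in place of the running time itself, since no halting
configuration has positive degree later. The output has at most `N` symbols, which fit into the
`2 N + n + 2` blocks of the outcome. -/
theorem outCircuit_computes (hcode : Function.Injective code)
    {FΘ₁ : Set (FuzzySet (List Δ))} {FΘ₂ : Set (FuzzySet (List Γ))}
    (hΘ₁ : ∀ s ∈ FΘ₁, IsAdmissible s) (f : FΘ₁ → FΘ₂) (N : ℕ → ℕ)
    (hN : ∀ s : FΘ₁, ∃ t, M.IsRunningTime s.1 t ∧ t ≤ N (len s.1) ∧ M.output s.1 t = (f s).1) :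
    FamilyComputes eΔ eΓ (fun n => outCircuit code eΔ eΓ (degree M.weight) n (N n)) f := by
  intro s
  obtain ⟨t, ht, htN, hf⟩ := hN s
  have hs : ∀ x, 0 < s.1 x → x.length ≤ len s.1 := fun x hx =>
    le_csSup ((hΘ₁ s.1 s.2).1.image _).bddAbove ⟨x, hx, rfl⟩
  have key : ∀ w u, (f s).1 w ≤ u ↔
      ∀ c : M.Config, c.state ∈ M.F → c.out = w → ∀ i ≤ N (len s.1), M.conf s.1 i c ≤ u := by
    intro w u
    rw [← hf, output_le_iff]
    refine ⟨fun h c hc hw i hi => ?_, fun h c hc hw i hi => h c hc hw i (hi.trans htN)⟩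
    rcases Nat.lt_or_ge t i with hti | hti
    · rw [ht.2 i hti c hc]
      exact unitInterval.nonneg'
    · exact h c hc hw i hti
  have hlen : ∀ (c : M.Config) i, i ≤ N (len s.1) → 0 < M.conf s.1 i c →
      c.out.length ≤ 2 * N (len s.1) + len s.1 + 2 := fun c i hi hpos => by
    have := (bounded_of_conf_pos hpos).out
    omega
  constructor
  · intro w hw
    by_contra hl
    refine absurd hw (not_lt.2 ((key w 0).2 fun c hc hcw i hi => ?_))
    by_contra hpos
    subst hcw
    exact hl (hlen c i hi (not_le.1 hpos))
  · funext v
    refine eq_of_forall_ge_iff fun u => ?_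
    rw [outCircuit_eval_le_iff eΔ eΓ hcode s.1 _ _ rfl hs]
    refine Iff.trans ⟨fun h y => ?_, fun h c hc hw i hi => ?_⟩ iSup_le_iff.symm
    · obtain ⟨y, hy, rfl⟩ := y
      refine (key y u).2 fun c hc hcy i hi => h c hc ?_ i hi
      rw [hcy]
    · by_cases hpos : 0 < M.conf s.1 i c
      · exact (key c.out u).1 (h ⟨c.out, hlen c i hi hpos, hw⟩) c hc rfl i hi
      · exact (not_lt.1 hpos).trans unitInterval.nonneg'

end family

/-- Every polynomial is bounded by a power that a stack machine can compute by repeated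
multiplication. -/
theorem exists_bound (p : Polynomial ℕ) : ∃ c d, ∀ n, p.eval n ≤ c * (n + 1) ^ d := by
  refine ⟨p.eval 1, p.natDegree, fun n => ?_⟩
  rw [Polynomial.eval_eq_sum_range, Polynomial.eval_eq_sum_range, Finset.sum_mul]
  refine Finset.sum_le_sum fun i hi => ?_
  rw [one_pow, mul_one]
  refine Nat.mul_le_mul_left _ ((Nat.pow_le_pow_left (Nat.le_succ n) i).trans ?_)
  exact Nat.pow_le_pow_right (Nat.succ_pos n) (by rw [Finset.mem_range] at hi; omega)

/-- Fuzzy functions that are computable in polynomial time are computed by uniform families of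
circuits. -/
theorem exists_circuits [Finite Γ] {k l : ℕ} (eΔ : Δ ≃ Fin k) (eΓ : Γ ≃ Fin l)
    {FΘ₁ : Set (FuzzySet (List Δ))} {FΘ₂ : Set (FuzzySet (List Γ))}
    (hΘ₁ : ∀ s ∈ FΘ₁, IsAdmissible s) (f : FΘ₁ → FΘ₂) (hM : M.ComputesInPolyTime f) :
    ∃ (m : ℕ → ℕ) (C : ∀ n, FuzzyCircuit (n * k) (m n * l)),
      IsUniform C ∧ FamilyComputes eΔ eΓ C f := by
  obtain ⟨p, hp⟩ := hM
  obtain ⟨c, d, hcd⟩ := exists_bound p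
  let eX : M.Guess ⊕ M.Cell ≃ Fin (Nat.card (M.Guess ⊕ M.Cell)) := Finite.equivFin _
  have hcode : Function.Injective fun x (b : Fin (Nat.card (M.Guess ⊕ M.Cell))) =>
      decide (eX x = b) := fun x y h => by
    have := congrFun h (eX x)
    simp only [decide_true] at this
    exact (eX.injective (of_decide_eq_true this.symm)).symm
  refine ⟨_, _, outCircuit_uniform (code := fun x b => decide (eX x = b)) eΔ eΓ c d,
    outCircuit_computes eΔ eΓ hcode hΘ₁ f (fun n => c * (n + 1) ^ d) fun s => ?_⟩
  obtain ⟨t, ht, htp, hf⟩ := hp s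
  exact ⟨t, ht, htp.trans (hcd _), hf⟩

end DFTM
end Fuzzy

theorem mainTheorem1 {Δ Γ : Type} [Nonempty Δ] [Nonempty Γ] {k l : ℕ}
    (eΔ : Δ ≃ Fin k) (eΓ : Γ ≃ Fin l)
    (FΘ₁ : Set (Fuzzy.FuzzySet (List Δ))) (FΘ₂ : Set (Fuzzy.FuzzySet (List Γ)))
    (hΘ₁ : ∀ s ∈ FΘ₁, Fuzzy.IsAdmissible s) (hΘ₂ : ∀ b ∈ FΘ₂, Fuzzy.IsAdmissible b)
    (f : FΘ₁ → FΘ₂) :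
    ((∃ M : Fuzzy.DFTM Δ Γ, M.ComputesInPolyTime f) →
      ∃ (m : ℕ → ℕ) (C : ∀ n, Fuzzy.FuzzyCircuit (n * k) (m n * l)),
        Fuzzy.IsUniform C ∧ Fuzzy.HasPolySize C ∧ Fuzzy.FamilyComputes eΔ eΓ C f) ∧
    ((∃ (m : ℕ → ℕ) (C : ∀ n, Fuzzy.FuzzyCircuit (n * k) (m n * l)),
        Fuzzy.IsUniform C ∧ Fuzzy.HasPolySize C ∧ Fuzzy.FamilyComputes eΔ eΓ C f) →
      ∃ M : Fuzzy.DFTM Δ Γ, M.ComputesInPolyTime f) := by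
  have : Finite Δ := .of_equiv _ eΔ.symm
  have : Finite Γ := .of_equiv _ eΓ.symm
  have hl : 0 < l := (eΓ (Classical.arbitrary Γ)).pos
  constructor
  · rintro ⟨M, hM⟩
    obtain ⟨m, C, hC, hf⟩ := Fuzzy.DFTM.exists_circuits eΔ eΓ hΘ₁ f hM
    exact ⟨m, C, hC, hC.hasPolySize, hf⟩
  · rintro ⟨m, C, hC, -, hf⟩
    exact Fuzzy.exists_DFTM_of_circuits eΔ eΓ hl hΘ₁ hΘ₂ f C hC hf
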